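/- **Setting.** Let $U\subset\mathbb R^3$ be a bounded open set with a polyhedral mesh $\mathcal M_h=\mathcal T_h\cup\mathcal F_h\cup\mathcal E_h\cup\mathcal V_h$ (finitely many pairwise disjoint open polyhedral elements $T$, relatively open planar polygonal faces $F$, open segments $E$ and vertices $V$; elements and faces are simply connected with connected boundary and star-shaped with respect to a ball, resp. disc, centred at a chosen point $x_T\in T$, resp. $x_F\in F$; the boundary of an element (face) is made of faces (edges) of the mesh, and the element (face) lies on exactly one side of each of them). Faces carry unit normals $n_F$, edges unit tangents $t_E$, and $n_{FE}=n_F\times t_E$. Let $\omega_{TF}=1$ if $n_F$ points out of $T$, $-1$ otherwise; $\omega_{FE}=1$ if $n_{FE}$ points out of $F$, $-1$ otherwise; $\omega_{EV}=1$ if $t_E$ points towards $V$, $-1$ otherwise. $\mathcal F_T,\mathcal E_T,\mathcal E_F,\mathcal V_E$ denote the faces and edges of $T$, the edges of $F$ and the vertices of $E$, and $h_P$ the diameter of $P$. Fix $k\ge 0$ and, for each $P\in\mathcal T_h\cup\mathcal F_h$, a set of $\eta_P\ge2$ faces (edges) of $P$, not pairwise aligned, such that $P$ lies on one side of the plane (line)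 spanned by each of them; put $\ell_P=k+1-\eta_P$. $\mathcal P^\ell(P)$ is the space of restrictions to $P$ of polynomials of total degree $\le\ell$ ($\{0\}$ if $\ell<0$), $\boldsymbol{\mathcal P}^\ell(T)=\mathcal P^\ell(T)^3$, and $\boldsymbol{\mathcal P}^\ell(F)$ consists of the tangential fields in $\mathcal P^\ell(F)^3$. With $\mathbf{rot}_Fr=\nabla r\times n_F$, let $\mathcal R^\ell(F)=\mathbf{rot}_F\mathcal P^{\ell+1}(F)$, $\mathcal R^{c,\ell}(F)=(x-x_F)\mathcal P^{\ell-1}(F)$, $\mathcal R^\ell(T)=\mathrm{curl}\,\boldsymbol{\mathcal P}^{\ell+1}(T)$, $\mathcal R^{c,\ell}(T)=(x-x_T)\mathcal P^{\ell-1}(T)$, $\mathcal G^\ell(T)=\nabla\mathcal P^{\ell+1}(T)$, $\mathcal G^{c,\ell}(T)=(x-x_T)\times\boldsymbol{\mathcal P}^{\ell-1}(T)$. $\pi_{\mathcal X}$ denotes the $L^2$-orthogonal projector on $\mathcal X$. The spaces are $$X_{\rm grad}=\{((q_T),(q_F),(q_E),(q_V))\}=\prod_T\mathcal P^{\ell_T}(T)\times\prod_F\mathcal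 P^{\ell_F}(F)\times\prod_E\mathcal P^{k-1}(E)\times\mathbb R^{\mathcal V_h},$$ $$X_{\rm curl}=\{((v_T,v_T^c),(v_F,v^c_F),(v_E))\}=\prod_T\big(\mathcal R^{k-1}(T)\times\mathcal R^{c,\ell_T+1}(T)\big)\times\prod_F\big(\mathcal R^{k-1}(F)\times\mathcal R^{c,\ell_F+1}(F)\big)\times\prod_E\mathcal P^k(E),$$ $$X_{\rm div}=\{((w_T,w_T^c),(w_F))\}=\prod_T\big(\mathcal G^{k-1}(T)\times\mathcal G^{c,k}(T)\big)\times\prod_F\mathcal P^k(F).$$ Let $S_{G,P}$ and $S_{C,P}$ ($P\in\mathcal T_h\cup\mathcal F_h$) be any linear operators with values in $\boldsymbol{\mathcal P}^k(P)$, defined on the restrictions of $X_{\rm grad}$, resp. $X_{\rm curl}$, to $P$ and its boundary entities (serendipity operators). *Reconstructions.* The following polynomials are defined by the stated relations. - $G_Eq\in\mathcal P^k(E)$: $\int_EG_Eq\,r=-\int_Eq_Er'+\sum_{V\in\mathcal V_E}\omega_{EV}q_Vr(x_V)$ for all $r\in\mathcal P^k(E)$. $\gamma_Eq\in\mathcal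 P^{k+1}(E)$: $\gamma_Eq(x_V)=q_V$ for $V\in\mathcal V_E$ and $\pi_{\mathcal P^{k-1}(E)}\gamma_Eq=q_E$. - $G_Fq\in\boldsymbol{\mathcal P}^k(F)$: $\int_FG_Fq\cdot(w+\tau)=\sum_{E\in\mathcal E_F}\omega_{FE}\int_E\gamma_Eq\,w\cdot n_{FE}+\int_FS_{G,F}q\cdot\tau$ on $\mathcal R^k(F)\times\mathcal R^{c,k}(F)$. $\gamma_Fq\in\mathcal P^{k+1}(F)$: $\int_F\gamma_Fq\,\mathrm{div}_Fw=-\int_FG_Fq\cdot w+\sum_{E\in\mathcal E_F}\omega_{FE}\int_E\gamma_Eq\,w\cdot n_{FE}$ for $w\in\mathcal R^{c,k+2}(F)$. - $G_Tq\in\boldsymbol{\mathcal P}^k(T)$: $\int_TG_Tq\cdot(w+\tau)=\sum_{F\in\mathcal F_T}\omega_{TF}\int_F\gamma_Fq\,w\cdot n_F+\int_TS_{G,T}q\cdot\tau$ on $\mathcal R^k(T)\times\mathcal R^{c,k}(T)$. $P_{\rm grad}q|_T\in\mathcal P^{k+1}(T)$: $\int_TP_{\rm grad}q\,\mathrm{div}\,w=-\int_TG_Tq\cdot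 w+\sum_{F\in\mathcal F_T}\omega_{TF}\int_F\gamma_Fq\,w\cdot n_F$ for $w\in\mathcal R^{c,k+2}(T)$. - $C_Fv\in\mathcal P^k(F)$: $\int_FC_Fv\,r=\int_Fv_F\cdot\mathbf{rot}_Fr-\sum_{E\in\mathcal E_F}\omega_{FE}\int_Ev_Er$ for $r\in\mathcal P^k(F)$. $\gamma_{t,F}v\in\boldsymbol{\mathcal P}^k(F)$: $\int_F\gamma_{t,F}v\cdot(\mathbf{rot}_Fr+\tau)=\int_FC_Fv\,r+\sum_{E\in\mathcal E_F}\omega_{FE}\int_Ev_Er+\int_FS_{C,F}v\cdot\tau$ for $r\in\mathcal P^{k+1}(F)$ with $\int_Fr=0$ and $\tau\in\mathcal R^{c,k}(F)$. - $\mathbf C_Tv\in\boldsymbol{\mathcal P}^k(T)$: $\int_T\mathbf C_Tv\cdot w=\int_Tv_T\cdot\mathrm{curl}\,w+\sum_{F\in\mathcal F_T}\omega_{TF}\int_F\gamma_{t,F}v\cdot(w\times n_F)$ for $w\in\boldsymbol{\mathcal P}^k(T)$. $P_{\rm curl}v|_T\in\boldsymbol{\mathcal P}^k(T)$: $\int_TP_{\rm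 curl}v\cdot(\mathrm{curl}\,w+\tau)=\int_T\mathbf C_Tv\cdot w-\sum_{F\in\mathcal F_T}\omega_{TF}\int_F\gamma_{t,F}v\cdot(w\times n_F)+\int_TS_{C,T}v\cdot\tau$ on $\mathcal G^{c,k+1}(T)\times\mathcal R^{c,k}(T)$. - $D_Tw\in\mathcal P^k(T)$: $\int_TD_Tw\,q=-\int_Tw_T\cdot\nabla q+\sum_{F\in\mathcal F_T}\omega_{TF}\int_Fw_Fq$ for $q\in\mathcal P^k(T)$. $P_{\rm div}w|_T\in\boldsymbol{\mathcal P}^k(T)$: $\int_TP_{\rm div}w\cdot(\nabla r+\tau)=-\int_TD_Tw\,r+\sum_{F\in\mathcal F_T}\omega_{TF}\int_Fw_Fr+\int_Tw_T^c\cdot\tau$ for $r\in\mathcal P^{k+1}(T)$ with $\int_Tr=0$ and $\tau\in\mathcal G^{c,k}(T)$. *Discrete gradient and curl.* $G_hq\in X_{\rm curl}$ has components $\pi_{\mathcal R^{k-1}(T)}G_Tq$, $\pi_{\mathcal R^{c,\ell_T+1}(T)}G_Tq$, $\pi_{\mathcal R^{k-1}(F)}G_Fq$, $\pi_{\mathcal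 R^{c,\ell_F+1}(F)}G_Fq$, $G_Eq$; $C_hv\in X_{\rm div}$ has components $\pi_{\mathcal G^{k-1}(T)}\mathbf C_Tv$, $\pi_{\mathcal G^{c,k}(T)}\mathbf C_Tv$, $C_Fv$. Let $\mathbf C_hv$ be the piecewise polynomial field equal to $\mathbf C_Tv$ on $T$. *Discrete products.* For $\bullet\in\{\mathrm{curl},\mathrm{div}\}$, $(x,y)_\bullet=\sum_T\big[\int_TP_\bullet x\cdot P_\bullet y+s_{\bullet,T}(x,y)\big]$ with $$s_{{\rm curl},T}(w,v)=\sum_{F\in\mathcal F_T}h_F\int_F\big((P_{\rm curl}w)_{t,F}-\gamma_{t,F}w\big)\cdot\big((P_{\rm curl}v)_{t,F}-\gamma_{t,F}v\big)+\sum_{E\in\mathcal E_T}h_E^2\int_E(P_{\rm curl}w\cdot t_E-w_E)(P_{\rm curl}v\cdot t_E-v_E),$$ $$s_{{\rm div},T}(w,v)=\sum_{F\in\mathcal F_T}h_F\int_F(P_{\rm div}w\cdot n_F-w_F)(P_{\rm div}v\cdot n_F-v_F),\qquad s_{{\rm div},h}=\sum_Ts_{{\rm div},T},$$ where $P_\bullet$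 is taken from $T$ and $z_{t,F}=n_F\times(z\times n_F)$. *Lie algebra.* Let $\mathfrak g$ be a finite-dimensional real Lie algebra with basis $(e_I)$ and an ad-invariant inner product $\langle\cdot,\cdot\rangle$, i.e. $\langle[x,y],z\rangle=-\langle y,[x,z]\rangle$. All spaces are tensored with $\mathfrak g$, operators act componentwise on $v=v^I\otimes e_I$, and products (and $s_{{\rm div},h}$) are tensored with $\langle\cdot,\cdot\rangle$; $\|\cdot\|_\bullet^2=(\cdot,\cdot)_\bullet$. Put $[v,q]=v^Iq^J\otimes[e_I,e_J]$ and ${}^*[v,w]=(v^I\times w^J)\otimes[e_I,e_J]$ for vector fields $v,w$ and functions $q$. For $v,w\in X_{\rm curl}\otimes\mathfrak g$ let ${}^*[v,w]_h\in X_{\rm div}\otimes\mathfrak g$ have components $\pi_{\mathcal G^{k-1}(T)}{}^*[P_{\rm curl}v,P_{\rm curl}w]$, $\pi_{\mathcal G^{c,k}(T)}{}^*[P_{\rm curl}v,P_{\rm curl}w]$ and $\pi_{\mathcal P^k(F)}({}^*[\gamma_{t,F}v,\gamma_{t,F}w]\cdot n_F)$. *Scheme.* Let $0=t^0<\dots<t^N$,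 $\delta^{n+1}v=(v^{n+1}-v^n)/(t^{n+1}-t^n)$, $A^{n+1/2}=\frac12(A^n+A^{n+1})$, and let $A^n,E^n\in X_{\rm curl}\otimes\mathfrak g$, $\lambda^n\in X_{\rm grad}\otimes\mathfrak g$ satisfy, for $0\le n<N$ and all $v\in X_{\rm curl}\otimes\mathfrak g$, $q\in X_{\rm grad}\otimes\mathfrak g$: $\delta^{n+1}A=-E^{n+1}$, $$(\delta^{n+1}E,v)_{\rm curl}+(G_h\lambda^{n+1},v)_{\rm curl}+\int_U\langle[P_{\rm curl}A^{n+1},P_{\rm grad}\lambda^{n+1}],P_{\rm curl}v\rangle=(C_hA^{n+1},C_hv)_{\rm div}+\mathfrak N(A^n,A^{n+1};v),$$ $$(\delta^{n+1}E,G_hq)_{\rm curl}+\int_U\langle P_{\rm curl}\delta^{n+1}E,[P_{\rm curl}A^n,P_{\rm grad}q]\rangle=0,$$ where $\mathfrak N\in\{\mathfrak N_1,\mathfrak N_2\}$ is one of $$\mathfrak N_1=(C_hA^{n+1},{}^*[A^{n+1/2},v]_h)_{\rm div}+\big(\tfrac12{}^*[A^{n+1},A^{n+1}]_h,\;C_hv+{}^*[A^{n+1/2},v]_h\big)_{\rm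 div},$$ $$\mathfrak N_2=\int_U\langle\mathbf C_hA^{n+1},{}^*[P_{\rm curl}A^{n+1/2},P_{\rm curl}v]\rangle+\int_U\big\langle\tfrac12{}^*[P_{\rm curl}A^{n+1},P_{\rm curl}A^{n+1}],\;\mathbf C_hv+{}^*[P_{\rm curl}A^{n+1/2},P_{\rm curl}v]\big\rangle.$$ **Proposition (energy dissipation).** If the initial data satisfy $$\mathfrak C^0(q):=(E^0,G_hq)_{\rm curl}+\int_U\langle P_{\rm curl}E^0,[P_{\rm curl}A^0,P_{\rm grad}q]\rangle=0\qquad\text{for all }q\in X_{\rm grad}\otimes\mathfrak g,$$ then, for all $0\le n<N$, $$\tfrac12\|E^{n+1}\|_{\rm curl}^2+\mathfrak B^{n+1}\le\tfrac12\|E^n\|_{\rm curl}^2+\mathfrak B^n,$$ where $\mathfrak B^n=\frac12\|C_hA^n+\frac12{}^*[A^n,A^n]_h\|_{\rm div}^2$ if $\mathfrak N=\mathfrak N_1$, and $\mathfrak B^n=\frac12\|\mathbf C_hA^n+\frac12{}^*[P_{\rm curl}A^n,P_{\rm curl}A^n]\|_{L^2(U)\otimes\mathfrak g}^2+\frac12s_{{\rm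 div},h}(C_hA^n,C_hA^n)$ if $\mathfrak N=\mathfrak N_2$. -/

import Mathlib

open MeasureTheory MvPolynomial
open scoped Matrix

namespace YM

noncomputable section

/-! ## Ambient three-dimensional space and polynomial calculus -/

/-- Euclidean space of dimension three (points and vectors). -/
abbrev E3 : Type := EuclideanSpace ℝ (Fin 3)

/-- Three-variate real polynomials. -/
abbrev Poly3 : Type := MvPolynomial (Fin 3) ℝ

/-- Polynomial vector fields on three-dimensional space. -/
abbrev VPoly3 : Type := Fin 3 → Poly3

/-- Cross product of vectors. -/
def cross (a b : E3) : E3 := WithLp.toLp 2 (a.ofLp ⨯₃ b.ofLp)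

/-- Value of a polynomial at a point. -/
def evalS (p : Poly3) (x : E3) : ℝ := eval x.ofLp p

/-- Value of a polynomial vector field at a point. -/
def evalV (w : VPoly3) (x : E3) : E3 := WithLp.toLp 2 (fun i => eval x.ofLp (w i))

/-- Polynomials of total degree at most `l`; this is `{0}` if `l < 0`. -/
def Pol (l : ℤ) : Submodule ℝ Poly3 :=
  if 0 ≤ l then restrictTotalDegree (Fin 3) ℝ l.toNat else ⊥

/-- Vector fields with components in `Pol l`. -/
def VPol (l : ℤ) : Submodule ℝ VPoly3 := Submodule.pi Set.univ (fun _ => Pol l)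

/-- The constant polynomial field `a`. -/
def constV (a : E3) : VPoly3 := fun i => C (a i)

/-- The polynomial field `x ↦ x - c`. -/
def posV (c : E3) : VPoly3 := fun i => X i - C (c i)

/-- Derivative of a polynomial in the direction `a`. -/
def dirDeriv (a : E3) (p : Poly3) : Poly3 := ∑ i, C (a i) * pderiv i p

/-- Gradient. -/
def gradP : Poly3 →ₗ[ℝ] VPoly3 where
  toFun p := fun i => pderiv i p
  map_add' p q := by ext1 i; simp
  map_smul' c p := by ext1 i; simp

/-- Divergence. -/
def divP (w : VPoly3) : Poly3 := ∑ i, pderiv i (w i)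

/-- Curl. -/
def curlP : VPoly3 →ₗ[ℝ] VPoly3 where
  toFun w := ![pderiv 1 (w 2) - pderiv 2 (w 1), pderiv 2 (w 0) - pderiv 0 (w 2),
    pderiv 0 (w 1) - pderiv 1 (w 0)]
  map_add' v w := by ext1 i; fin_cases i <;> simp <;> ring
  map_smul' c w := by ext1 i; fin_cases i <;> simp [smul_sub]

/-- Multiplication of scalar polynomials by `x - c`. -/
def mulPos (c : E3) : Poly3 →ₗ[ℝ] VPoly3 where
  toFun p := fun i => p * posV c i
  map_add' p q := by ext1 i; simp [add_mul]
  map_smul' a p := by ext1 i; simp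

/-- The map `w ↦ (x - c) × w`. -/
def crossPos (c : E3) : VPoly3 →ₗ[ℝ] VPoly3 where
  toFun w := posV c ⨯₃ w
  map_add' v w := by simp
  map_smul' a w := by
    ext1 i; fin_cases i <;> simp [crossProduct]

/-- Two-dimensional vector curl of (the restriction of) a polynomial on a plane with unit normal
`n`: the tangential gradient rotated by `-π/2` in the plane oriented by `n`, that is `∇r × n`. -/
def rotP (n : E3) : Poly3 →ₗ[ℝ] VPoly3 where
  toFun r := gradP r ⨯₃ constV n
  map_add' p q := by simp
  map_smul' a p := by
    ext1 i; fin_cases i <;> simp [crossProduct]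

/-- Divergence on a plane with unit normal `n` of (the restriction of) a field that is tangential
on that plane: the trace of its derivative over the tangent directions. -/
def divF (n : E3) (w : VPoly3) : Poly3 := divP w - ∑ i, C (n i) * dirDeriv n (w i)

/-! ## Polynomial functions on sets

A polynomial function on a mesh entity `P` is a restriction to `P` of a three-variate polynomial.
It is stored as a function on the closure of `P` (so that it can be evaluated on the boundary),
extended by zero. -/

/-- Restriction of a polynomial to (the closure of) `P`. -/
def restrS (P : Set E3) : Poly3 →ₗ[ℝ] (E3 → ℝ) where
  toFun p := (closure P).indicator (evalS p)
  map_add' p q := by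
    ext x; by_cases h : x ∈ closure P <;> simp [h, evalS]
  map_smul' a p := by
    ext x; by_cases h : x ∈ closure P <;> simp [h, evalS]

/-- Restriction of a polynomial vector field to (the closure of) `P`. -/
def restrV (P : Set E3) : VPoly3 →ₗ[ℝ] (E3 → E3) where
  toFun w := (closure P).indicator (evalV w)
  map_add' v w := by
    ext x i; by_cases h : x ∈ closure P <;> simp [h, evalV]
  map_smul' a w := by
    ext x i; by_cases h : x ∈ closure P <;> simp [h, evalV]

/-- `P^l(P)`. -/
def PolS (P : Set E3) (l : ℤ) : Submodule ℝ (E3 → ℝ) := (Pol l).map (restrS P)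

/-- `P^l(P)³`. -/
def PolV (P : Set E3) (l : ℤ) : Submodule ℝ (E3 → E3) := (VPol l).map (restrV P)

/-- The fields of `P^l(P)³` that are orthogonal to `n`. -/
def PolTan (P : Set E3) (n : E3) (l : ℤ) : Submodule ℝ (E3 → E3) where
  carrier := {f | f ∈ PolV P l ∧ ∀ x, inner ℝ (f x) n = 0}
  add_mem' := by
    rintro f g ⟨hf, hf'⟩ ⟨hg, hg'⟩
    exact ⟨add_mem hf hg, fun x => by simp [inner_add_left, hf', hg']⟩
  zero_mem' := ⟨zero_mem _, fun x => by simp⟩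
  smul_mem' := by
    rintro a f ⟨hf, hf'⟩
    exact ⟨Submodule.smul_mem _ a hf, fun x => by simp [inner_smul_left, hf']⟩

/-- The unique object satisfying `Q` (the value `0` is used if there is no such unique object). -/
def theUnique {α : Type*} [Zero α] (Q : α → Prop) : α :=
  open Classical in if h : ∃! a, Q a then h.choose else 0

/-- `L²(m)`-orthogonal projection of `f` on the space `V` of functions. -/
def l2proj {G : Type*} [NormedAddCommGroup G] [InnerProductSpace ℝ G] (m : Measure E3)
    (V : Submodule ℝ (E3 → G)) (f : E3 → G) : V :=
  theUnique fun u : V => ∀ w : V,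
    ∫ x, inner ℝ ((u : E3 → G) x) ((w : E3 → G) x) ∂m = ∫ x, inner ℝ (f x) ((w : E3 → G) x) ∂m

/-! ## Polyhedral meshes -/

/-- The vector `n` points out of `S` at `x`: close to `x`, the ray in the direction `-n` is inside
`S` and the ray in the direction `n` is outside `S`. -/
def PointsOut (S : Set E3) (x n : E3) : Prop :=
  ∃ ε > 0, ∀ s ∈ Set.Ioo (0 : ℝ) ε, x - s • n ∈ S ∧ x + s • n ∉ S

/-- The plane through `c` with normal `n`. -/
def planeAt (c n : E3) : Set E3 := {x | inner ℝ (x - c) n = 0}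

/-- A polyhedral mesh of a bounded open domain: open polyhedral elements, relatively open planar
polygonal faces, open segments as edges, and vertices, all pairwise disjoint, with a unit normal to
each face, an orientation of each edge (from `src` to `tgt`), and a centre in each element and
face. -/
structure PolyMesh where
  /-- the meshed domain -/
  domain : Set E3
  domain_open : IsOpen domain
  domain_bounded : Bornology.IsBounded domain
  /-- number of elements -/
  nT : ℕ
  /-- number of faces -/
  nF : ℕ
  /-- number of edges -/
  nE : ℕ
  /-- number of vertices -/
  nV : ℕ
  cell : Fin nT → Set E3
  face : Fin nF → Set E3
  vert : Fin nV → E3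
  /-- first vertex of an edge -/
  src : Fin nE → Fin nV
  /-- last vertex of an edge -/
  tgt : Fin nE → Fin nV
  /-- unit normal orienting a face -/
  normal : Fin nF → E3
  /-- centre of an element -/
  cellPt : Fin nT → E3
  /-- centre of a face -/
  facePt : Fin nF → E3
  src_ne_tgt : ∀ E, src E ≠ tgt E
  normal_unit : ∀ F, ‖normal F‖ = 1
  -- elements
  cell_open : ∀ T, IsOpen (cell T)
  cell_bounded : ∀ T, Bornology.IsBounded (cell T)
  cell_simply_connected : ∀ T, SimplyConnectedSpace (cell T)
  cell_frontier_connected : ∀ T, IsConnected (frontier (cell T))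
  cellPt_mem : ∀ T, cellPt T ∈ cell T
  cell_star : ∀ T, ∃ r > 0, ∀ y ∈ Metric.ball (cellPt T) r, StarConvex ℝ y (cell T)
  -- faces
  facePt_mem : ∀ F, facePt F ∈ face F
  face_planar : ∀ F, ∃ U : Set E3, IsOpen U ∧ face F = U ∩ planeAt (facePt F) (normal F)
  face_bounded : ∀ F, Bornology.IsBounded (face F)
  face_simply_connected : ∀ F, SimplyConnectedSpace (face F)
  face_boundary_connected : ∀ F, IsConnected (closure (face F) \ face F)
  face_star : ∀ F, ∃ r > 0,
    ∀ y ∈ Metric.ball (facePt F) r ∩ planeAt (facePt F) (normal F), StarConvex ℝ y (face F)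
  -- the elements partition the domain, and the mesh entities are pairwise disjoint
  cell_subset : ∀ T, cell T ⊆ domain
  cover : closure domain = ⋃ T, closure (cell T)
  entities_disjoint : Pairwise (Function.onFun Disjoint
    (Sum.elim cell (Sum.elim face (Sum.elim
      (fun E => openSegment ℝ (vert (src E)) (vert (tgt E))) (fun V => ({vert V} : Set E3))))))
  -- boundaries of elements (faces) are made of faces (edges) of the mesh
  cell_boundary : ∀ T, frontier (cell T) =
    ⋃ F ∈ {F | face F ⊆ frontier (cell T)}, closure (face F)
  face_boundary : ∀ F, closure (face F) \ face F =
    ⋃ E ∈ {E | openSegment ℝ (vert (src E)) (vert (tgt E)) ⊆ closure (face F) \ face F},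
      closure (openSegment ℝ (vert (src E)) (vert (tgt E)))
  face_used : ∀ F, ∃ T, face F ⊆ frontier (cell T)
  edge_used : ∀ E, ∃ F, openSegment ℝ (vert (src E)) (vert (tgt E)) ⊆ closure (face F) \ face F
  vert_used : ∀ V, ∃ E, V = src E ∨ V = tgt E
  -- an element lies on exactly one side of each of its faces, a face on exactly one side of each
  -- of its edges
  cell_one_sided : ∀ T F, face F ⊆ frontier (cell T) →
    (∀ x ∈ face F, PointsOut (cell T) x (normal F)) ∨
    (∀ x ∈ face F, PointsOut (cell T) x (-normal F))
  face_one_sided : ∀ F E,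
    openSegment ℝ (vert (src E)) (vert (tgt E)) ⊆ closure (face F) \ face F →
    (∀ x ∈ openSegment ℝ (vert (src E)) (vert (tgt E)),
      PointsOut (face F) x (cross (normal F) (vert (tgt E) - vert (src E)))) ∨
    (∀ x ∈ openSegment ℝ (vert (src E)) (vert (tgt E)),
      PointsOut (face F) x (-cross (normal F) (vert (tgt E) - vert (src E))))

namespace PolyMesh

variable (M : PolyMesh)

/-- The open segment carrying an edge. -/
def edge (E : Fin M.nE) : Set E3 := openSegment ℝ (M.vert (M.src E)) (M.vert (M.tgt E))

/-- Unit tangent `t_E`. -/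
def tangent (E : Fin M.nE) : E3 :=
  ‖M.vert (M.tgt E) - M.vert (M.src E)‖⁻¹ • (M.vert (M.tgt E) - M.vert (M.src E))

/-- The unit vector `n_FE` such that `(t_E, n_FE, n_F)` is right-handed. -/
def normalFE (F : Fin M.nF) (E : Fin M.nE) : E3 := cross (M.normal F) (M.tangent E)

open Classical in
/-- Faces of an element. -/
def facesT (T : Fin M.nT) : Finset (Fin M.nF) := {F | M.face F ⊆ frontier (M.cell T)}

open Classical in
/-- Edges of a face. -/
def edgesF (F : Fin M.nF) : Finset (Fin M.nE) := {E | M.edge E ⊆ closure (M.face F) \ M.face F}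

open Classical in
/-- Edges of an element. -/
def edgesT (T : Fin M.nT) : Finset (Fin M.nE) := {E | ∃ F ∈ M.facesT T, E ∈ M.edgesF F}

/-- Vertices of an edge. -/
def vertsE (E : Fin M.nE) : Finset (Fin M.nV) := {M.src E, M.tgt E}

/-- Vertices of a face. -/
def vertsF (F : Fin M.nF) : Finset (Fin M.nV) := (M.edgesF F).biUnion M.vertsE

/-- Vertices of an element. -/
def vertsT (T : Fin M.nT) : Finset (Fin M.nV) := (M.edgesT T).biUnion M.vertsE

open Classical in
/-- `ω_TF = 1` if `n_F` points out of `T`, and `-1` otherwise. -/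
def oTF (T : Fin M.nT) (F : Fin M.nF) : ℝ :=
  if ∀ x ∈ M.face F, PointsOut (M.cell T) x (M.normal F) then 1 else -1

open Classical in
/-- `ω_FE = 1` if `n_FE` points out of `F`, and `-1` otherwise. -/
def oFE (F : Fin M.nF) (E : Fin M.nE) : ℝ :=
  if ∀ x ∈ M.edge E, PointsOut (M.face F) x (M.normalFE F E) then 1 else -1

/-- `ω_EV = 1` if `t_E` points towards `V`, and `-1` otherwise. -/
def oEV (E : Fin M.nE) (V : Fin M.nV) : ℝ := if V = M.tgt E then 1 else -1

/-- Lebesgue measure on an element. -/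
def mT (T : Fin M.nT) : Measure E3 := volume.restrict (M.cell T)

/-- Surface measure on a face. -/
def mF (F : Fin M.nF) : Measure E3 := (Measure.euclideanHausdorffMeasure 2).restrict (M.face F)

/-- Length measure on an edge. -/
def mE (E : Fin M.nE) : Measure E3 := (Measure.euclideanHausdorffMeasure 1).restrict (M.edge E)

/-- Diameter of a face. -/
def hF (F : Fin M.nF) : ℝ := Metric.diam (M.face F)

/-- Diameter (length) of an edge. -/
def hE (E : Fin M.nE) : ℝ := Metric.diam (M.edge E)

/-! ### Polynomial subspaces on elements and faces -/

/-- Tangential polynomial fields on a face. -/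
def vPolF (F : Fin M.nF) (l : ℤ) : Submodule ℝ (E3 → E3) := PolTan (M.face F) (M.normal F) l

/-- `R^l(F)`: vector curls on `F` of `P^{l+1}(F)`. -/
def RF (F : Fin M.nF) (l : ℤ) : Submodule ℝ (E3 → E3) :=
  (Pol (l + 1)).map (restrV (M.face F) ∘ₗ rotP (M.normal F))

/-- `R^{c,l}(F) = (x - x_F) P^{l-1}(F)`. -/
def RcF (F : Fin M.nF) (l : ℤ) : Submodule ℝ (E3 → E3) :=
  (Pol (l - 1)).map (restrV (M.face F) ∘ₗ mulPos (M.facePt F))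

/-- `R^l(T)`: curls of `P^{l+1}(T)³`. -/
def RT (T : Fin M.nT) (l : ℤ) : Submodule ℝ (E3 → E3) :=
  (VPol (l + 1)).map (restrV (M.cell T) ∘ₗ curlP)

/-- `R^{c,l}(T) = (x - x_T) P^{l-1}(T)`. -/
def RcT (T : Fin M.nT) (l : ℤ) : Submodule ℝ (E3 → E3) :=
  (Pol (l - 1)).map (restrV (M.cell T) ∘ₗ mulPos (M.cellPt T))

/-- `G^l(T)`: gradients of `P^{l+1}(T)`. -/
def GT (T : Fin M.nT) (l : ℤ) : Submodule ℝ (E3 → E3) :=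
  (Pol (l + 1)).map (restrV (M.cell T) ∘ₗ gradP)

/-- `G^{c,l}(T) = (x - x_T) × P^{l-1}(T)³`. -/
def GcT (T : Fin M.nT) (l : ℤ) : Submodule ℝ (E3 → E3) :=
  (VPol (l - 1)).map (restrV (M.cell T) ∘ₗ crossPos (M.cellPt T))

end PolyMesh

/-! ## Serendipity spaces -/

/-- A polyhedral mesh with a polynomial degree `k` and, for each element (resp. face), a selection
of at least two of its faces (resp. edges) that are not pairwise aligned and such that the element
(resp. face) lies on one side of the plane (resp. line) spanned by each of them. -/
structure Discretisation extends PolyMesh where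
  /-- polynomial degree -/
  k : ℕ
  bdryT : Fin nT → Finset (Fin nF)
  bdryF : Fin nF → Finset (Fin nE)
  bdryT_subset : ∀ T, bdryT T ⊆ toPolyMesh.facesT T
  bdryF_subset : ∀ F, bdryF F ⊆ toPolyMesh.edgesF F
  two_le_bdryT : ∀ T, 2 ≤ (bdryT T).card
  two_le_bdryF : ∀ F, 2 ≤ (bdryF F).card
  bdryT_not_aligned : ∀ T, ∀ F ∈ bdryT T, ∀ F' ∈ bdryT T, F ≠ F' →
    affineSpan ℝ (face F) ≠ affineSpan ℝ (face F')
  bdryF_not_aligned : ∀ F, ∀ E ∈ bdryF F, ∀ E' ∈ bdryF F, E ≠ E' →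
    affineSpan ℝ (toPolyMesh.edge E) ≠ affineSpan ℝ (toPolyMesh.edge E')
  bdryT_one_side : ∀ T, ∀ F ∈ bdryT T,
    (∀ x ∈ cell T, 0 ≤ inner ℝ (x - facePt F) (normal F)) ∨
    (∀ x ∈ cell T, inner ℝ (x - facePt F) (normal F) ≤ 0)
  bdryF_one_side : ∀ F, ∀ E ∈ bdryF F,
    (∀ x ∈ face F, 0 ≤ inner ℝ (x - vert (src E)) (toPolyMesh.normalFE F E)) ∨
    (∀ x ∈ face F, inner ℝ (x - vert (src E)) (toPolyMesh.normalFE F E) ≤ 0)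

namespace Discretisation

variable (D : Discretisation)

/-- `ℓ_T = k + 1 - η_T`. -/
def lT (T : Fin D.nT) : ℤ := D.k + 1 - (D.bdryT T).card

/-- `ℓ_F = k + 1 - η_F`. -/
def lF (F : Fin D.nF) : ℤ := D.k + 1 - (D.bdryF F).card

/-- Global gradient space: components on elements, faces, edges, vertices. -/
abbrev XGrad : Type :=
  (∀ T, PolS (D.cell T) (D.lT T)) × (∀ F, PolS (D.face F) (D.lF F)) ×
  (∀ E, PolS (D.edge E) (D.k - 1)) × (Fin D.nV → ℝ)

/-- Global curl space: components in `R^{k-1}(T)`, `R^{c,ℓ_T+1}(T)`, `R^{k-1}(F)`,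
`R^{c,ℓ_F+1}(F)` and `P^k(E)`. -/
abbrev XCurl : Type :=
  (∀ T, D.RT T (D.k - 1)) × (∀ T, D.RcT T (D.lT T + 1)) ×
  (∀ F, D.RF F (D.k - 1)) × (∀ F, D.RcF F (D.lF F + 1)) × (∀ E, PolS (D.edge E) D.k)

/-- Global divergence space: components in `G^{k-1}(T)`, `G^{c,k}(T)` and `P^k(F)`. -/
abbrev XDiv : Type :=
  (∀ T, D.GT T (D.k - 1)) × (∀ T, D.GcT T D.k) × (∀ F, PolS (D.face F) D.k)

/-- Gradient space on a face and its edges and vertices. -/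
abbrev XGradF (F : Fin D.nF) : Type :=
  PolS (D.face F) (D.lF F) ×
  (∀ E : {E // E ∈ D.edgesF F}, PolS (D.edge E) (D.k - 1)) × ({V // V ∈ D.vertsF F} → ℝ)

/-- Gradient space on an element and its faces, edges and vertices. -/
abbrev XGradT (T : Fin D.nT) : Type :=
  PolS (D.cell T) (D.lT T) × (∀ F : {F // F ∈ D.facesT T}, PolS (D.face F) (D.lF F)) ×
  (∀ E : {E // E ∈ D.edgesT T}, PolS (D.edge E) (D.k - 1)) × ({V // V ∈ D.vertsT T} → ℝ)

/-- Curl space on a face and its edges. -/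
abbrev XCurlF (F : Fin D.nF) : Type :=
  D.RF F (D.k - 1) × D.RcF F (D.lF F + 1) × (∀ E : {E // E ∈ D.edgesF F}, PolS (D.edge E) D.k)

/-- Curl space on an element and its faces and edges. -/
abbrev XCurlT (T : Fin D.nT) : Type :=
  D.RT T (D.k - 1) × D.RcT T (D.lT T + 1) ×
  (∀ F : {F // F ∈ D.facesT T}, D.RF F (D.k - 1)) ×
  (∀ F : {F // F ∈ D.facesT T}, D.RcF F (D.lF F + 1)) ×
  (∀ E : {E // E ∈ D.edgesT T}, PolS (D.edge E) D.k)

variable {D}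

/-- Restriction of a vector of the gradient space to a face. -/
def XGrad.onF (q : D.XGrad) (F : Fin D.nF) : D.XGradF F :=
  (q.2.1 F, fun E => q.2.2.1 E, fun V => q.2.2.2 V)

/-- Restriction of a vector of the gradient space to an element. -/
def XGrad.onT (q : D.XGrad) (T : Fin D.nT) : D.XGradT T :=
  (q.1 T, fun F => q.2.1 F, fun E => q.2.2.1 E, fun V => q.2.2.2 V)

/-- Restriction of a vector of the curl space to a face. -/
def XCurl.onF (v : D.XCurl) (F : Fin D.nF) : D.XCurlF F :=
  (v.2.2.1 F, v.2.2.2.1 F, fun E => v.2.2.2.2 E)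

/-- Restriction of a vector of the curl space to an element. -/
def XCurl.onT (v : D.XCurl) (T : Fin D.nT) : D.XCurlT T :=
  (v.1 T, v.2.1 T, fun F => v.2.2.1 F, fun F => v.2.2.2.1 F, fun E => v.2.2.2.2 E)

end Discretisation

/-- A choice of linear serendipity gradient and curl operators on all faces and elements. No
property of them other than linearity is required. -/
structure Serendipity (D : Discretisation) where
  gradF : ∀ F, D.XGradF F →ₗ[ℝ] D.vPolF F D.k
  gradT : ∀ T, D.XGradT T →ₗ[ℝ] PolV (D.cell T) D.k
  curlF : ∀ F, D.XCurlF F →ₗ[ℝ] D.vPolF F D.k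
  curlT : ∀ T, D.XCurlT T →ₗ[ℝ] PolV (D.cell T) D.k

/-! ## Polynomial reconstructions -/

namespace Serendipity

open Discretisation

variable {D : Discretisation} (S : Serendipity D)

/-- Edge gradient. -/
def edgeGrad (q : D.XGrad) (E : Fin D.nE) : PolS (D.edge E) D.k :=
  theUnique fun u => ∀ r ∈ Pol D.k,
    ∫ x, u.1 x * evalS r x ∂D.mE E =
      -(∫ x, (q.2.2.1 E).1 x * evalS (dirDeriv (D.tangent E) r) x ∂D.mE E)
      + ∑ V ∈ D.vertsE E, D.oEV E V * q.2.2.2 V * evalS r (D.vert V)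

/-- Edge potential reconstruction. -/
def trE (q : D.XGrad) (E : Fin D.nE) : PolS (D.edge E) (D.k + 1) :=
  theUnique fun u => (∀ V ∈ D.vertsE E, u.1 (D.vert V) = q.2.2.2 V) ∧
    l2proj (D.mE E) (PolS (D.edge E) (D.k - 1)) u.1 = q.2.2.1 E

/-- Face gradient. -/
def faceGrad (q : D.XGrad) (F : Fin D.nF) : D.vPolF F D.k :=
  theUnique fun u => ∀ (w : D.RF F D.k) (τ : D.RcF F D.k),
    ∫ x, inner ℝ (u.1 x) (w.1 x + τ.1 x) ∂D.mF F =
      ∑ E ∈ D.edgesF F, D.oFE F E *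
        ∫ x, (trE q E).1 x * inner ℝ (w.1 x) (D.normalFE F E) ∂D.mE E
      + ∫ x, inner ℝ ((S.gradF F (XGrad.onF q F)).1 x) (τ.1 x) ∂D.mF F

/-- Scalar potential reconstruction on a face; the test fields `w` of `R^{c,k+2}(F)` are written
`(x - x_F) p`. -/
def trF (q : D.XGrad) (F : Fin D.nF) : PolS (D.face F) (D.k + 1) :=
  theUnique fun u => ∀ p ∈ Pol (D.k + 1), ∀ w, w = mulPos (D.facePt F) p →
    ∫ x, u.1 x * evalS (divF (D.normal F) w) x ∂D.mF F =
      -(∫ x, inner ℝ ((S.faceGrad q F).1 x) (evalV w x) ∂D.mF F)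
      + ∑ E ∈ D.edgesF F, D.oFE F E *
        ∫ x, (trE q E).1 x * inner ℝ (evalV w x) (D.normalFE F E) ∂D.mE E

/-- Element gradient. -/
def cellGrad (q : D.XGrad) (T : Fin D.nT) : PolV (D.cell T) D.k :=
  theUnique fun u => ∀ (w : D.RT T D.k) (τ : D.RcT T D.k),
    ∫ x, inner ℝ (u.1 x) (w.1 x + τ.1 x) ∂D.mT T =
      ∑ F ∈ D.facesT T, D.oTF T F *
        ∫ x, (S.trF q F).1 x * inner ℝ (w.1 x) (D.normal F) ∂D.mF F
      + ∫ x, inner ℝ ((S.gradT T (XGrad.onT q T)).1 x) (τ.1 x) ∂D.mT T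

/-- Scalar potential reconstruction `P_grad` on an element; the test fields `w` of `R^{c,k+2}(T)`
are written `(x - x_T) p`. -/
def potGrad (q : D.XGrad) (T : Fin D.nT) : PolS (D.cell T) (D.k + 1) :=
  theUnique fun u => ∀ p ∈ Pol (D.k + 1), ∀ w, w = mulPos (D.cellPt T) p →
    ∫ x, u.1 x * evalS (divP w) x ∂D.mT T =
      -(∫ x, inner ℝ ((S.cellGrad q T).1 x) (evalV w x) ∂D.mT T)
      + ∑ F ∈ D.facesT T, D.oTF T F *
        ∫ x, (S.trF q F).1 x * inner ℝ (evalV w x) (D.normal F) ∂D.mF F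

/-- Face curl. -/
def faceCurl (v : D.XCurl) (F : Fin D.nF) : PolS (D.face F) D.k :=
  theUnique fun u => ∀ r ∈ Pol D.k,
    ∫ x, u.1 x * evalS r x ∂D.mF F =
      ∫ x, inner ℝ ((v.2.2.1 F).1 x) (evalV (rotP (D.normal F) r) x) ∂D.mF F
      - ∑ E ∈ D.edgesF F, D.oFE F E * ∫ x, (v.2.2.2.2 E).1 x * evalS r x ∂D.mE E

/-- Tangential vector potential reconstruction on a face. -/
def trFt (v : D.XCurl) (F : Fin D.nF) : D.vPolF F D.k :=
  theUnique fun u => ∀ r ∈ Pol (D.k + 1), ∫ x, evalS r x ∂D.mF F = 0 → ∀ τ : D.RcF F D.k,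
    ∫ x, inner ℝ (u.1 x) (evalV (rotP (D.normal F) r) x + τ.1 x) ∂D.mF F =
      ∫ x, (faceCurl v F).1 x * evalS r x ∂D.mF F
      + ∑ E ∈ D.edgesF F, D.oFE F E * ∫ x, (v.2.2.2.2 E).1 x * evalS r x ∂D.mE E
      + ∫ x, inner ℝ ((S.curlF F (XCurl.onF v F)).1 x) (τ.1 x) ∂D.mF F

/-- Element curl. -/
def cellCurl (v : D.XCurl) (T : Fin D.nT) : PolV (D.cell T) D.k :=
  theUnique fun u => ∀ w ∈ VPol D.k,
    ∫ x, inner ℝ (u.1 x) (evalV w x) ∂D.mT T =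
      ∫ x, inner ℝ ((v.1 T).1 x) (evalV (curlP w) x) ∂D.mT T
      + ∑ F ∈ D.facesT T, D.oTF T F *
        ∫ x, inner ℝ ((S.trFt v F).1 x) (cross (evalV w x) (D.normal F)) ∂D.mF F

/-- Vector potential reconstruction `P_curl` on an element; the test fields `w` of `G^{c,k+1}(T)`
are written `(x - x_T) × z`. -/
def potCurl (v : D.XCurl) (T : Fin D.nT) : PolV (D.cell T) D.k :=
  theUnique fun u => ∀ z ∈ VPol D.k, ∀ w, w = crossPos (D.cellPt T) z → ∀ τ : D.RcT T D.k,
    ∫ x, inner ℝ (u.1 x) (evalV (curlP w) x + τ.1 x) ∂D.mT T =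
      ∫ x, inner ℝ ((S.cellCurl v T).1 x) (evalV w x) ∂D.mT T
      - ∑ F ∈ D.facesT T, D.oTF T F *
        ∫ x, inner ℝ ((S.trFt v F).1 x) (cross (evalV w x) (D.normal F)) ∂D.mF F
      + ∫ x, inner ℝ ((S.curlT T (XCurl.onT v T)).1 x) (τ.1 x) ∂D.mT T

/-- Element divergence. -/
def cellDiv (w : D.XDiv) (T : Fin D.nT) : PolS (D.cell T) D.k :=
  theUnique fun u => ∀ q ∈ Pol D.k,
    ∫ x, u.1 x * evalS q x ∂D.mT T =
      -(∫ x, inner ℝ ((w.1 T).1 x) (evalV (gradP q) x) ∂D.mT T)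
      + ∑ F ∈ D.facesT T, D.oTF T F * ∫ x, (w.2.2 F).1 x * evalS q x ∂D.mF F

/-- Vector potential reconstruction `P_div` on an element. -/
def potDiv (w : D.XDiv) (T : Fin D.nT) : PolV (D.cell T) D.k :=
  theUnique fun u => ∀ r ∈ Pol (D.k + 1), ∫ x, evalS r x ∂D.mT T = 0 → ∀ τ : D.GcT T D.k,
    ∫ x, inner ℝ (u.1 x) (evalV (gradP r) x + τ.1 x) ∂D.mT T =
      -(∫ x, (cellDiv w T).1 x * evalS r x ∂D.mT T)
      + ∑ F ∈ D.facesT T, D.oTF T F * ∫ x, (w.2.2 F).1 x * evalS r x ∂D.mF F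
      + ∫ x, inner ℝ ((w.2.1 T).1 x) (τ.1 x) ∂D.mT T

/-! ## Discrete gradient and curl, discrete inner products -/

/-- Discrete gradient. -/
def uG (q : D.XGrad) : D.XCurl :=
  (fun T => l2proj (D.mT T) (D.RT T (D.k - 1)) (S.cellGrad q T).1,
   fun T => l2proj (D.mT T) (D.RcT T (D.lT T + 1)) (S.cellGrad q T).1,
   fun F => l2proj (D.mF F) (D.RF F (D.k - 1)) (S.faceGrad q F).1,
   fun F => l2proj (D.mF F) (D.RcF F (D.lF F + 1)) (S.faceGrad q F).1,
   fun E => edgeGrad q E)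

/-- Discrete curl. -/
def uC (v : D.XCurl) : D.XDiv :=
  (fun T => l2proj (D.mT T) (D.GT T (D.k - 1)) (S.cellCurl v T).1,
   fun T => l2proj (D.mT T) (D.GcT T D.k) (S.cellCurl v T).1,
   fun F => faceCurl v F)

/-- Tangential trace on a plane with unit normal `n`. -/
def tanTrace (n v : E3) : E3 := cross n (cross v n)

/-- Local stabilisation on the curl space. -/
def sCurl (w v : D.XCurl) (T : Fin D.nT) : ℝ :=
  ∑ F ∈ D.facesT T, D.hF F * ∫ x, inner ℝ
      (tanTrace (D.normal F) ((S.potCurl w T).1 x) - (S.trFt w F).1 x)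
      (tanTrace (D.normal F) ((S.potCurl v T).1 x) - (S.trFt v F).1 x) ∂D.mF F
  + ∑ E ∈ D.edgesT T, D.hE E ^ 2 * ∫ x,
      (inner ℝ ((S.potCurl w T).1 x) (D.tangent E) - (w.2.2.2.2 E).1 x) *
      (inner ℝ ((S.potCurl v T).1 x) (D.tangent E) - (v.2.2.2.2 E).1 x) ∂D.mE E

/-- Local stabilisation on the divergence space. -/
def sDiv (w v : D.XDiv) (T : Fin D.nT) : ℝ :=
  ∑ F ∈ D.facesT T, D.hF F * ∫ x,
      (inner ℝ ((potDiv w T).1 x) (D.normal F) - (w.2.2 F).1 x) *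
      (inner ℝ ((potDiv v T).1 x) (D.normal F) - (v.2.2 F).1 x) ∂D.mF F

/-- Discrete `L²`-product on the curl space. -/
def ipCurl (w v : D.XCurl) : ℝ :=
  ∑ T, (∫ x, inner ℝ ((S.potCurl w T).1 x) ((S.potCurl v T).1 x) ∂D.mT T + S.sCurl w v T)

/-- Discrete `L²`-product on the divergence space. -/
def ipDiv (w v : D.XDiv) : ℝ :=
  ∑ T, (∫ x, inner ℝ ((potDiv w T).1 x) ((potDiv v T).1 x) ∂D.mT T + sDiv w v T)

end Serendipity

/-! ## Lie algebra-valued objects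

Elements of `X ⊗ 𝔤` are written `v = v^I ⊗ e_I` in a basis `(e_I)` of `𝔤`, and are represented by
their components `v : ι → X`; operators act component by component. -/

section LieValued

open Discretisation

variable {D : Discretisation} (S : Serendipity D) {ι : Type*} [Fintype ι]
  {𝔤 : Type*} [LieRing 𝔤] [LieAlgebra ℝ 𝔤] (b : Module.Basis ι ℝ 𝔤) (B : LinearMap.BilinForm ℝ 𝔤)

/-- Tensorisation of a bilinear form on `X` with the inner product `B` of the Lie algebra. -/
def tens {X : Type*} (f : X → X → ℝ) (x y : ι → X) : ℝ :=
  ∑ I, ∑ J, f (x I) (y J) * B (b I) (b J)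

/-- Structure constants: `[e_I, e_J] = ∑ K, c_{IJ}^K e_K`. -/
def strConst (I J K : ι) : ℝ := b.repr ⁅b I, b J⁆ K

/-- Piecewise (element by element) vector fields. -/
abbrev PwV (D : Discretisation) : Type := Fin D.nT → E3 → E3

/-- Piecewise (element by element) scalar fields. -/
abbrev PwS (D : Discretisation) : Type := Fin D.nT → E3 → ℝ

/-- `L²`-product over the domain of piecewise fields, as a sum over the elements. -/
def l2Dom (f g : PwV D) : ℝ := ∑ T, ∫ x, inner ℝ (f T x) (g T x) ∂D.mT T

/-- The bracket `[v, q] = v^I q^J ⊗ [e_I, e_J]` of a vector and a scalar field. -/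
def bktS (v : ι → PwV D) (q : ι → PwS D) : ι → PwV D :=
  fun K T x => ∑ I, ∑ J, strConst b I J K • (q J T x • v I T x)

/-- The pointwise bracket `(v^I × w^J) ⊗ [e_I, e_J]`. -/
def bktPt (v w : ι → E3) : ι → E3 :=
  fun K => ∑ I, ∑ J, strConst b I J K • cross (v I) (w J)

/-- The bracket `(v^I × w^J) ⊗ [e_I, e_J]` of two piecewise vector fields. -/
def bktV (v w : ι → PwV D) : ι → PwV D :=
  fun K T x => bktPt b (fun I => v I T x) (fun I => w I T x) K

/-- The bracket with values in the divergence space. -/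
def bktDiv (v w : ι → D.XCurl) : ι → D.XDiv := fun K =>
  (fun T => l2proj (D.mT T) (D.GT T (D.k - 1)) fun x =>
      bktPt b (fun I => (S.potCurl (v I) T).1 x) (fun I => (S.potCurl (w I) T).1 x) K,
   fun T => l2proj (D.mT T) (D.GcT T D.k) fun x =>
      bktPt b (fun I => (S.potCurl (v I) T).1 x) (fun I => (S.potCurl (w I) T).1 x) K,
   fun F => l2proj (D.mF F) (PolS (D.face F) D.k) fun x =>
      inner ℝ (bktPt b (fun I => (S.trFt (v I) F).1 x) (fun I => (S.trFt (w I) F).1 x) K)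
        (D.normal F))

/-- Lie algebra-valued discrete gradient. -/
def gG (q : ι → D.XGrad) : ι → D.XCurl := fun I => S.uG (q I)

/-- Lie algebra-valued discrete curl. -/
def gC (v : ι → D.XCurl) : ι → D.XDiv := fun I => S.uC (v I)

/-- Lie algebra-valued piecewise polynomial curl. -/
def gCpw (v : ι → D.XCurl) : ι → PwV D := fun I T => (S.cellCurl (v I) T).1

/-- Lie algebra-valued vector potential on the curl space. -/
def gPcurl (v : ι → D.XCurl) : ι → PwV D := fun I T => (S.potCurl (v I) T).1

/-- Lie algebra-valued scalar potential on the gradient space. -/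
def gPgrad (q : ι → D.XGrad) : ι → PwS D := fun I T => (S.potGrad (q I) T).1

/-- The two discretisations of the nonlinear terms. -/
inductive Variant
  | one
  | two

/-- The nonlinear terms `𝔑(A, A'; v)`, where `A` is the potential at the current time step and `A'`
at the next one. -/
def nonlin : Variant → (ι → D.XCurl) → (ι → D.XCurl) → (ι → D.XCurl) → ℝ
  | .one, A, A', v =>
      tens b B Serendipity.ipDiv (gC S A') (bktDiv S b ((1 / 2 : ℝ) • (A + A')) v)
      + tens b B Serendipity.ipDiv ((1 / 2 : ℝ) • bktDiv S b A' A')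
          (gC S v + bktDiv S b ((1 / 2 : ℝ) • (A + A')) v)
  | .two, A, A', v =>
      tens b B l2Dom (gCpw S A') (bktV b (gPcurl S ((1 / 2 : ℝ) • (A + A'))) (gPcurl S v))
      + tens b B l2Dom ((1 / 2 : ℝ) • bktV b (gPcurl S A') (gPcurl S A'))
          (gCpw S v + bktV b (gPcurl S ((1 / 2 : ℝ) • (A + A'))) (gPcurl S v))

/-- The families `A`, `E`, `lam` solve the constrained scheme on the times `t 0 < ... < t N`. -/
structure IsSolution (m : Variant) (N : ℕ) (t : ℕ → ℝ) (A E : ℕ → ι → D.XCurl)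
    (lam : ℕ → ι → D.XGrad) : Prop where
  potential : ∀ n < N, (t (n + 1) - t n)⁻¹ • (A (n + 1) - A n) = -E (n + 1)
  evolution : ∀ n < N, ∀ v : ι → D.XCurl,
    tens b B S.ipCurl ((t (n + 1) - t n)⁻¹ • (E (n + 1) - E n)) v
      + tens b B S.ipCurl (gG S (lam (n + 1))) v
      + tens b B l2Dom (bktS b (gPcurl S (A (n + 1))) (gPgrad S (lam (n + 1)))) (gPcurl S v)
    = tens b B Serendipity.ipDiv (gC S (A (n + 1))) (gC S v) + nonlin S b B m (A n) (A (n + 1)) v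
  constraint : ∀ n < N, ∀ q : ι → D.XGrad,
    tens b B S.ipCurl ((t (n + 1) - t n)⁻¹ • (E (n + 1) - E n)) (gG S q)
      + tens b B l2Dom (gPcurl S ((t (n + 1) - t n)⁻¹ • (E (n + 1) - E n)))
          (bktS b (gPcurl S (A n)) (gPgrad S q)) = 0

/-- The constraint functional of a pair `(A, E)`. -/
def constraintFun (A E : ι → D.XCurl) (q : ι → D.XGrad) : ℝ :=
  tens b B S.ipCurl E (gG S q)
    + tens b B l2Dom (gPcurl S E) (bktS b (gPcurl S A) (gPgrad S q))

/-- Magnetic field of the first scheme, in the divergence space. -/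
def magOne (A : ι → D.XCurl) : ι → D.XDiv := gC S A + (1 / 2 : ℝ) • bktDiv S b A A

/-- Magnetic field of the second scheme, a piecewise polynomial field. -/
def magTwo (A : ι → D.XCurl) : ι → PwV D :=
  gCpw S A + (1 / 2 : ℝ) • bktV b (gPcurl S A) (gPcurl S A)

/-- Global stabilisation on the divergence space. -/
def sDivGlob (w v : D.XDiv) : ℝ := ∑ T, Serendipity.sDiv w v T

/-- The magnetic energy. -/
def magEnergy : Variant → (ι → D.XCurl) → ℝ
  | .one, A => 1 / 2 * tens b B Serendipity.ipDiv (magOne S b A) (magOne S b A)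
  | .two, A => 1 / 2 * tens b B l2Dom (magTwo S b A) (magTwo S b A)
      + 1 / 2 * tens b B sDivGlob (gC S A) (gC S A)

end LieValued

end

end YM

/-! Test the evolution equation with `v = E (n + 1)`, a multiple of the decrease of the potential.
Three facts then give the estimate.

The multiplier terms vanish. By symmetry of the products they add up to the constraint functional at
`(A (n + 1), E (n + 1))`. That functional stays zero: the third equation of the scheme says that,
with `A n` frozen, it does not change between `E n` and `E (n + 1)`. Replacing `A n` by `A (n + 1)`
then adds a multiple of the product of `P E` with `[P E, P q]`, which is zero because bracketing
with a scalar field is skew-adjoint for an ad-invariant product (`tens_bktSL_self`).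

The magnetic terms are a discrete derivative. The bracket of vector fields is symmetric, being built
from two antisymmetric products, so the midpoint in the scheme gives `[(A + A') / 2, A' - A] = [A',
A'] / 2 - [A, A] / 2` exactly. With `M = C A + [A, A] / 2`, their work is `-τ f(M', M' - M)`, where
`τ` is the inverse of the time step (`work_eq`).

Both energies are positive semidefinite quadratic forms, and such a form satisfies `f(y, y) / 2 -
f(x, x) / 2 ≤ f(y, y - x)` (`half_sub_half_le`). Applied to `E` and to `M`, this is the dissipation.

In the first variant everything lives in the product on the divergence space. In the second, the
square has to be completed in `L²`, so the product of discrete curls must split into the `L²`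
product of the element curls and the stabilisation. This is the identity `P_div (C_h v) = C_T v`
(`potDivL_uCL`), the deepest part of the proof. It says that the discrete divergence of a discrete
curl is zero, and the edge terms cancel since the boundary of the boundary of an element is zero
(`sum_oTF_mul_oFE`).

The reconstructions are defined as unique solutions of linear relations, with default value `0`.
They depend linearly on the data as soon as the relations are compatible, whether or not they are
uniquely solvable (`exists_linearMap_theUnique`). Solvability is established only where the defining
relations are used; the operators on the gradient space are treated as arbitrary functions. -/

namespace YM

noncomputable section

/-! ## Locally bounded measurable functions and their integral products -/

/-- A finite measure carried by a bounded set. -/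
class BoundedSupport (m : Measure E3) : Prop extends IsFiniteMeasure m where
  ae_norm_le : ∃ R : ℝ, ∀ᵐ x ∂m, ‖x‖ ≤ R

/-- The strongly measurable functions that are bounded on bounded sets. -/
def LocBdd (G : Type*) [NormedAddCommGroup G] [NormedSpace ℝ G] : Submodule ℝ (E3 → G) where
  carrier := {f | StronglyMeasurable f ∧ ∀ R : ℝ, ∃ C : ℝ, ∀ x, ‖x‖ ≤ R → ‖f x‖ ≤ C}
  add_mem' := by
    rintro f g ⟨hf, hf'⟩ ⟨hg, hg'⟩
    refine ⟨hf.add hg, fun R => ?_⟩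
    obtain ⟨C, hC⟩ := hf' R
    obtain ⟨C', hC'⟩ := hg' R
    exact ⟨C + C', fun x hx => (norm_add_le _ _).trans (add_le_add (hC x hx) (hC' x hx))⟩
  zero_mem' := ⟨stronglyMeasurable_zero, fun R => ⟨0, fun x _ => by simp⟩⟩
  smul_mem' := by
    rintro c f ⟨hf, hf'⟩
    refine ⟨hf.const_smul c, fun R => ?_⟩
    obtain ⟨C, hC⟩ := hf' R
    refine ⟨‖c‖ * C, fun x hx => ?_⟩
    rw [Pi.smul_apply, norm_smul]
    exact mul_le_mul_of_nonneg_left (hC x hx) (norm_nonneg c)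

section

variable {G : Type*} [NormedAddCommGroup G]

theorem locBdd_of_continuous [NormedSpace ℝ G] {f : E3 → G} (hf : Continuous f) :
    f ∈ LocBdd G := by
  refine ⟨hf.stronglyMeasurable, fun R => ?_⟩
  obtain ⟨C, hC⟩ := (isCompact_closedBall (0 : E3) R).exists_bound_of_continuousOn hf.continuousOn
  exact ⟨C, fun x hx => hC x (by simpa using hx)⟩

theorem locBdd_indicator [NormedSpace ℝ G] {f : E3 → G} (hf : f ∈ LocBdd G) {s : Set E3}
    (hs : IsClosed s) : s.indicator f ∈ LocBdd G := by
  refine ⟨hf.1.indicator hs.measurableSet, fun R => ?_⟩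
  obtain ⟨C, hC⟩ := hf.2 R
  exact ⟨C, fun x hx => (norm_indicator_le_norm_self _ _).trans (hC x hx)⟩

/-- The inner, scalar and cross products are all continuous with a bilinear bound, so this one
closure property makes every integrand below integrable and the integral products genuinely
bilinear. -/
theorem locBdd_comp₂ {G₁ G₂ G₃ : Type*} [NormedAddCommGroup G₁] [NormedSpace ℝ G₁]
    [NormedAddCommGroup G₂] [NormedSpace ℝ G₂] [NormedAddCommGroup G₃] [NormedSpace ℝ G₃]
    (φ : G₁ → G₂ → G₃) (hφ : Continuous fun p : G₁ × G₂ => φ p.1 p.2) (K : ℝ)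
    (hK : ∀ a b, ‖φ a b‖ ≤ K * ‖a‖ * ‖b‖) (hK0 : 0 ≤ K) {f : E3 → G₁} {g : E3 → G₂}
    (hf : f ∈ LocBdd G₁) (hg : g ∈ LocBdd G₂) : (fun x => φ (f x) (g x)) ∈ LocBdd G₃ := by
  refine ⟨hφ.comp_stronglyMeasurable (hf.1.prodMk hg.1), fun R => ?_⟩
  obtain ⟨C, hC⟩ := hf.2 R
  obtain ⟨C', hC'⟩ := hg.2 R
  refine ⟨K * C * C', fun x hx => (hK _ _).trans ?_⟩
  have h0 : 0 ≤ C := (norm_nonneg _).trans (hC x hx)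
  gcongr
  · exact hC x hx
  · exact hC' x hx

theorem locBdd_inner [InnerProductSpace ℝ G] {f g : E3 → G} (hf : f ∈ LocBdd G)
    (hg : g ∈ LocBdd G) : (fun x => (inner ℝ (f x) (g x) : ℝ)) ∈ LocBdd ℝ :=
  locBdd_comp₂ (fun a b => (inner ℝ a b : ℝ)) (by fun_prop) 1
    (fun a b => by simpa using norm_inner_le_norm (𝕜 := ℝ) a b) zero_le_one hf hg

theorem locBdd_smul [NormedSpace ℝ G] {f : E3 → ℝ} {g : E3 → G} (hf : f ∈ LocBdd ℝ)
    (hg : g ∈ LocBdd G) : (fun x => f x • g x) ∈ LocBdd G :=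
  locBdd_comp₂ (fun (a : ℝ) (b : G) => a • b) (by fun_prop) 1
    (fun a b => by simp [norm_smul]) zero_le_one hf hg

theorem integrable_of_locBdd [NormedSpace ℝ G] {f : E3 → G} (hf : f ∈ LocBdd G) (m : Measure E3)
    [BoundedSupport m] : Integrable f m := by
  obtain ⟨R, hR⟩ := BoundedSupport.ae_norm_le (m := m)
  obtain ⟨C, hC⟩ := hf.2 R
  exact Integrable.of_bound hf.1.aestronglyMeasurable C (hR.mono fun x hx => hC x hx)

/-- The integral product of two locally bounded functions. -/
def ip [InnerProductSpace ℝ G] (m : Measure E3) [BoundedSupport m] :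
    LocBdd G →ₗ[ℝ] LocBdd G →ₗ[ℝ] ℝ :=
  LinearMap.mk₂ ℝ (fun f g => ∫ x, (inner ℝ (f.1 x) (g.1 x) : ℝ) ∂m)
    (fun f f' g => by
      simp only [Submodule.coe_add, Pi.add_apply, inner_add_left]
      exact integral_add (integrable_of_locBdd (locBdd_inner f.2 g.2) m)
        (integrable_of_locBdd (locBdd_inner f'.2 g.2) m))
    (fun c f g => by
      simp only [Submodule.coe_smul, Pi.smul_apply, inner_smul_left, smul_eq_mul]
      exact integral_const_mul _ _)
    (fun f g g' => by
      simp only [Submodule.coe_add, Pi.add_apply, inner_add_right]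
      exact integral_add (integrable_of_locBdd (locBdd_inner f.2 g.2) m)
        (integrable_of_locBdd (locBdd_inner f.2 g'.2) m))
    (fun c f g => by
      simp only [Submodule.coe_smul, Pi.smul_apply, inner_smul_right, smul_eq_mul]
      exact integral_const_mul _ _)

theorem ip_apply [InnerProductSpace ℝ G] (m : Measure E3) [BoundedSupport m] (f g : LocBdd G) :
    ip m f g = ∫ x, (inner ℝ (f.1 x) (g.1 x) : ℝ) ∂m := rfl

theorem ip_apply_real (m : Measure E3) [BoundedSupport m] (f g : LocBdd ℝ) :
    ip m f g = ∫ x, f.1 x * g.1 x ∂m := by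
  rw [ip_apply]
  congr 1 with x
  simp [mul_comm]

theorem ip_comm [InnerProductSpace ℝ G] (m : Measure E3) [BoundedSupport m] (f g : LocBdd G) :
    ip m f g = ip m g f := by
  simp only [ip_apply, real_inner_comm]

theorem ip_self_nonneg [InnerProductSpace ℝ G] (m : Measure E3) [BoundedSupport m]
    (f : LocBdd G) : 0 ≤ ip m f f :=
  integral_nonneg fun _ => real_inner_self_nonneg

theorem ae_eq_zero_of_ip_self [InnerProductSpace ℝ G] (m : Measure E3) [BoundedSupport m]
    (f : LocBdd G) (h : ip m f f = 0) : f.1 =ᵐ[m] 0 := by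
  rw [ip_apply, integral_eq_zero_iff_of_nonneg (fun _ => real_inner_self_nonneg)
    (integrable_of_locBdd (locBdd_inner f.2 f.2) m)] at h
  filter_upwards [h] with x hx
  simpa using hx

theorem ip_congr_ae [InnerProductSpace ℝ G] {m : Measure E3} [BoundedSupport m]
    {f f' g g' : LocBdd G} (h : f.1 =ᵐ[m] f'.1) (h' : g.1 =ᵐ[m] g'.1) :
    ip m f g = ip m f' g' := by
  refine integral_congr_ae ?_
  filter_upwards [h, h'] with x hx hx'
  rw [hx, hx']

theorem ip_eq_zero_of_ae_right [InnerProductSpace ℝ G] {m : Measure E3} [BoundedSupport m]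
    (f : LocBdd G) {g : LocBdd G} (h : g.1 =ᵐ[m] 0) : ip m f g = 0 := by
  rw [ip_congr_ae (g' := 0) (f' := f) Filter.EventuallyEq.rfl h, map_zero]

end

/-! ## Objects defined by linear relations -/

theorem theUnique_spec {α : Type*} [Zero α] {Q : α → Prop} (h : ∃! a, Q a) : Q (theUnique Q) := by
  unfold theUnique
  rw [dif_pos h]
  exact h.choose_spec.1

/-- If the relations `β u p = R x p` (for all `p`) are compatible for every `x`, then the object
`u` they determine depends linearly on `x`; it satisfies them if they determine `u`. -/
theorem exists_linearMap_theUnique {X V P : Type*} [AddCommGroup X] [Module ℝ X]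
    [AddCommGroup V] [Module ℝ V] [FiniteDimensional ℝ V] [AddCommGroup P] [Module ℝ P]
    (β : V →ₗ[ℝ] P →ₗ[ℝ] ℝ) (R : X →ₗ[ℝ] P →ₗ[ℝ] ℝ)
    (hR : ∀ p, (∀ u, β u p = 0) → ∀ x, R x p = 0) (Q : X → V → Prop)
    (hQ : ∀ x u, Q x u ↔ ∀ p, β u p = R x p) :
    ∃ L : X →ₗ[ℝ] V, (∀ x, theUnique (Q x) = L x) ∧
      ((∀ u, (∀ p, β u p = 0) → u = 0) → ∀ x p, β (L x) p = R x p) := by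
  obtain rfl : Q = fun x u => ∀ p, β u p = R x p := by
    ext x u
    exact hQ x u
  -- Fredholm alternative: `V` is finite-dimensional, hence its own bidual, so the functionals on
  -- `P` of the form `β u` are exactly those that vanish on the common kernel of all of them.
  -- Compatibility places `R x` among these.
  have hex : ∀ x, ∃ u, ∀ p, β u p = R x p := by
    intro x
    have hmem : R x ∈ LinearMap.range
        (β.flip.dualMap ∘ₗ (Module.evalEquiv ℝ V).toLinearMap) := by
      rw [LinearMap.range_comp_of_range_eq_top _ (LinearEquiv.range _),
        LinearMap.range_dualMap_eq_dualAnnihilator_ker, Submodule.mem_dualAnnihilator]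
      intro p hp
      exact hR p (fun u => by rw [LinearMap.mem_ker] at hp; exact congrArg (fun l => l u) hp) x
    obtain ⟨u, hu⟩ := hmem
    exact ⟨u, fun p => by rw [← hu]; simp⟩
  by_cases hinj : ∀ u, (∀ p, β u p = 0) → u = 0
  · have huniq : ∀ x u u', (∀ p, β u p = R x p) → (∀ p, β u' p = R x p) → u = u' := by
      intro x u u' hu hu'
      rw [← sub_eq_zero]
      exact hinj _ fun p => by rw [map_sub, LinearMap.sub_apply, hu, hu', sub_self]
    have hspec : ∀ x p, β (theUnique fun u => ∀ p, β u p = R x p) p = R x p := fun x =>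
      theUnique_spec (Q := fun u => ∀ p, β u p = R x p)
        ((hex x).imp fun u hu => ⟨hu, fun u' hu' => huniq x _ _ hu' hu⟩)
    refine ⟨⟨⟨fun x => theUnique fun u => ∀ p, β u p = R x p, fun x y => ?_⟩, fun c x => ?_⟩,
      fun x => rfl, fun _ => hspec⟩
    · exact huniq (x + y) _ _ (hspec _) fun p => by simp [hspec]
    · exact huniq (c • x) _ _ (hspec _) fun p => by simp [hspec]
  -- If some `d ≠ 0` solves the homogeneous relations, no solution is unique, `theUnique` takes its
  -- default value `0` for every `x`, and the zero map is linear.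
  · refine ⟨0, fun x => ?_, fun h => absurd h hinj⟩
    push Not at hinj
    obtain ⟨d, hd, hd0⟩ := hinj
    unfold theUnique
    rw [dif_neg]
    · rfl
    · rintro ⟨u, hu, hu'⟩
      exact hd0 (by simpa using hu' (u + d) fun p => by simp [hu, hd])

/-! ## Polynomial calculus -/

/-- The alternative `p = 0` is there for negative `l`: the zero polynomial has `totalDegree` equal
to `0`. -/
theorem mem_Pol {l : ℤ} {p : Poly3} : p ∈ Pol l ↔ p = 0 ∨ (p.totalDegree : ℤ) ≤ l := by
  unfold Pol
  split_ifs with h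
  · rw [mem_restrictTotalDegree]
    constructor
    · intro h'; right; omega
    · rintro (rfl | h')
      · simp
      · omega
  · rw [Submodule.mem_bot]
    constructor
    · exact Or.inl
    · rintro (h' | h')
      · exact h'
      · omega

theorem mem_VPol {l : ℤ} {w : VPoly3} : w ∈ VPol l ↔ ∀ i, w i ∈ Pol l := by
  simp [VPol, Submodule.mem_pi]

instance (l : ℤ) : FiniteDimensional ℝ (Pol l) := by
  by_cases h : 0 ≤ l
  · rw [show Pol l = restrictTotalDegree (Fin 3) ℝ l.toNat from if_pos h]
    infer_instance
  · rw [show Pol l = ⊥ from if_neg h]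
    infer_instance

instance (l : ℤ) : FiniteDimensional ℝ (VPol l) := by
  let f : VPol l →ₗ[ℝ] (Fin 3 → Pol l) :=
    { toFun := fun w i => ⟨w.1 i, mem_VPol.1 w.2 i⟩
      map_add' := fun _ _ => rfl
      map_smul' := fun _ _ => rfl }
  refine FiniteDimensional.of_injective f fun v w h => ?_
  ext1
  funext i
  exact congrArg Subtype.val (congrFun h i)

theorem Pol_mono {l l' : ℤ} (h : l ≤ l') : Pol l ≤ Pol l' := by
  intro p
  simp only [mem_Pol]
  rintro (h' | h')
  · exact Or.inl h'
  · exact Or.inr (h'.trans h)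

theorem mul_mem_Pol {l l' : ℤ} {p q : Poly3} (hp : p ∈ Pol l) (hq : q ∈ Pol l') :
    p * q ∈ Pol (l + l') := by
  rw [mem_Pol] at *
  rcases hp with rfl | hp
  · simp
  rcases hq with rfl | hq
  · simp
  right
  have := totalDegree_mul p q
  omega

theorem C_mul_mem_Pol {l : ℤ} {p : Poly3} (a : ℝ) (hp : p ∈ Pol l) : C a * p ∈ Pol l := by
  rw [← smul_eq_C_mul]
  exact Submodule.smul_mem _ _ hp

theorem C_mem_Pol {l : ℤ} (hl : 0 ≤ l) (a : ℝ) : (C a : Poly3) ∈ Pol l := by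
  rw [mem_Pol]
  right
  simpa using hl

theorem posV_mem_Pol (c : E3) (i : Fin 3) : posV c i ∈ Pol 1 := by
  unfold posV
  refine sub_mem ?_ (C_mem_Pol zero_le_one _)
  rw [mem_Pol]
  right
  simp

/-- This includes `l = 0`, where constants are sent to `Pol (-1) = ⊥`; degrees can thus be counted
in `ℤ` without separate cases. -/
theorem pderiv_mem_Pol {l : ℤ} {p : Poly3} (i : Fin 3) (hp : p ∈ Pol l) :
    pderiv i p ∈ Pol (l - 1) := by
  have h : p = ∑ m ∈ p.support, monomial m (coeff m p) := p.as_sum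
  rw [h, map_sum]
  refine sum_mem fun m hm => ?_
  rw [pderiv_monomial]
  rcases mem_Pol.1 hp with rfl | hp
  · simp at hm
  rcases Nat.eq_zero_or_pos (m i) with h0 | h0
  · simp [h0]
  rw [mem_Pol]
  right
  refine (Int.ofNat_le.2 (totalDegree_monomial_le _ _)).trans ?_
  have h1 : Finsupp.degree m ≤ p.totalDegree := le_totalDegree hm
  have h2 : m - Finsupp.single i 1 + Finsupp.single i 1 = m := by
    apply tsub_add_cancel_of_le
    exact Finsupp.single_le_iff.2 h0
  have h3 : Finsupp.degree m = Finsupp.degree (m - Finsupp.single i 1) + 1 := by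
    conv_lhs => rw [← h2]
    simp
  have h4 : ((m - Finsupp.single i 1).sum fun _ => id) =
    Finsupp.degree (m - Finsupp.single i 1) := rfl
  rw [h4]
  omega

/-- Values of polynomials as a linear map. -/
def evS : Poly3 →ₗ[ℝ] LocBdd ℝ where
  toFun p := ⟨evalS p, locBdd_of_continuous ((MvPolynomial.continuous_eval p).comp (by fun_prop))⟩
  map_add' p q := by ext x; simp [evalS]
  map_smul' c p := by ext x; simp [evalS]

/-- Values of polynomial fields as a linear map. -/
def evV : VPoly3 →ₗ[ℝ] LocBdd E3 where
  toFun w := ⟨evalV w, locBdd_of_continuous ((PiLp.continuous_toLp 2 _).comp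
    (continuous_pi fun i => (MvPolynomial.continuous_eval (w i)).comp (by fun_prop)))⟩
  map_add' p q := by ext x i; simp [evalV]
  map_smul' c p := by ext x i; simp [evalV]

theorem hasDerivAt_eval_line (p : Poly3) (c y : Fin 3 → ℝ) (t : ℝ) :
    HasDerivAt (fun t : ℝ => eval (c + t • y) p) (∑ i, y i * eval (c + t • y) (pderiv i p)) t := by
  induction p using MvPolynomial.induction_on with
  | C a => simpa using hasDerivAt_const t a
  | add p q hp hq =>
    have h := hp.add hq
    simp only [map_add, mul_add, Finset.sum_add_distrib] at h ⊢
    exact h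
  | mul_X p i hp =>
    have hX : HasDerivAt (fun t : ℝ => c i + t * y i) (y i) t := by
      simpa using ((hasDerivAt_id t).mul_const (y i)).const_add (c i)
    have h := hp.mul hX
    simp only [map_mul, eval_X, Pi.add_apply, Pi.smul_apply, smul_eq_mul]
    refine h.congr_deriv ?_
    simp only [pderiv_mul, pderiv_X, map_add, map_mul, eval_X, mul_add, Finset.sum_add_distrib,
      Finset.sum_mul]
    congr 1
    · rw [← Finset.sum_add_distrib]
      refine Finset.sum_congr rfl fun j _ => ?_
      simp only [Pi.add_apply, Pi.smul_apply, smul_eq_mul]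
      ring
    · rw [Finset.sum_eq_single i]
      · simp; ring
      · intro j _ hj
        simp [hj.symm]
      · simp

/-- The Euler operator `(x - c) · ∇`. -/
def euler (c : E3) : Poly3 →ₗ[ℝ] Poly3 where
  toFun p := ∑ i, posV c i * pderiv i p
  map_add' p q := by simp [mul_add, Finset.sum_add_distrib]
  map_smul' a p := by simp [Finset.smul_sum]

/-- The derivative of `t ↦ t * p (c + t y)` is `p + euler c p` evaluated at `c + t y`. If that is
zero, the function takes the same value at `t = 1` and at `t = 0`, where it is zero. -/
theorem eq_zero_of_add_euler_eq_zero {c : E3} {p : Poly3} (h : p + euler c p = 0) : p = 0 := by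
  have hd : ∀ y : Fin 3 → ℝ, ∀ t : ℝ,
      HasDerivAt (fun t : ℝ => t * eval (c.ofLp + t • y) p) 0 t := by
    intro y t
    refine ((hasDerivAt_id t).mul (hasDerivAt_eval_line p c.ofLp y t)).congr_deriv ?_
    have h' := congrArg (eval (c.ofLp + t • y)) h
    simp only [euler, LinearMap.coe_mk, AddHom.coe_mk, map_add, map_sum, map_mul, posV, map_sub,
      eval_X, eval_C, map_zero, Pi.add_apply, Pi.smul_apply, smul_eq_mul, add_sub_cancel_left,
      id, one_mul, Finset.mul_sum] at h' ⊢
    rw [← h']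
    congr 1
    exact Finset.sum_congr rfl fun i _ => by ring
  apply MvPolynomial.funext
  intro x
  have := is_const_of_deriv_eq_zero (fun t => (hd (x - c.ofLp) t).differentiableAt)
    (fun t => (hd (x - c.ofLp) t).deriv) 1 0
  simpa using this

theorem euler_mem_Pol {l : ℤ} {c : E3} {p : Poly3} (hp : p ∈ Pol l) : euler c p ∈ Pol l := by
  change ∑ i, posV c i * pderiv i p ∈ Pol l
  refine Submodule.sum_mem _ fun i _ => ?_
  simpa using mul_mem_Pol (posV_mem_Pol c i) (pderiv_mem_Pol i hp)

/-- The Euler operator preserves `Pol l`, which is finite-dimensional, so the injectivity of the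
identity plus the Euler operator gives its surjectivity. The two splittings of polynomial fields
below rest on this inversion. -/
theorem exists_add_euler_eq {l : ℤ} (c : E3) {p : Poly3} (hp : p ∈ Pol l) :
    ∃ u ∈ Pol l, u + euler c u = p := by
  let f : Pol l →ₗ[ℝ] Pol l :=
    (LinearMap.id + euler c).restrict fun q hq => add_mem hq (euler_mem_Pol hq)
  have hf : Function.Injective f := by
    rw [injective_iff_map_eq_zero]
    intro q hq
    ext1
    exact eq_zero_of_add_euler_eq_zero (congrArg Subtype.val hq)
  obtain ⟨u, hu⟩ := (LinearMap.injective_iff_surjective.1 hf) ⟨p, hp⟩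
  exact ⟨u, u.2, congrArg Subtype.val hu⟩

/-- `∇((x - c) · u) = u + ((x - c) · ∇) u + (x - c) × curl u`. -/
theorem gradP_dot_posV (c : E3) (u : VPoly3) :
    gradP (posV c ⬝ᵥ u) = u + (fun i => euler c (u i)) + posV c ⨯₃ curlP u := by
  funext i
  fin_cases i <;>
  · simp [gradP, dotProduct, Fin.sum_univ_three, posV, curlP, crossProduct, euler, pderiv_X]
    ring

theorem dot_posV_mem_Pol {l : ℤ} (c : E3) {u : VPoly3} (hu : u ∈ VPol l) :
    posV c ⬝ᵥ u ∈ Pol (l + 1) := by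
  refine Submodule.sum_mem _ fun i _ => ?_
  rw [add_comm]
  exact mul_mem_Pol (posV_mem_Pol c i) (mem_VPol.1 hu i)

theorem curlP_mem_VPol {l : ℤ} {u : VPoly3} (hu : u ∈ VPol l) : curlP u ∈ VPol (l - 1) := by
  rw [mem_VPol] at *
  intro i
  fin_cases i <;> exact sub_mem (pderiv_mem_Pol _ (hu _)) (pderiv_mem_Pol _ (hu _))

theorem gradP_mem_VPol {l : ℤ} {p : Poly3} (hp : p ∈ Pol l) : gradP p ∈ VPol (l - 1) :=
  mem_VPol.2 fun i => pderiv_mem_Pol i hp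

theorem cross_mem_VPol {l l' : ℤ} {u v : VPoly3} (hu : u ∈ VPol l) (hv : v ∈ VPol l') :
    u ⨯₃ v ∈ VPol (l + l') := by
  rw [mem_VPol] at *
  intro i
  fin_cases i <;> exact sub_mem (mul_mem_Pol (hu _) (hv _)) (mul_mem_Pol (hu _) (hv _))

theorem posV_mem_VPol (c : E3) : posV c ∈ VPol 1 := mem_VPol.2 (posV_mem_Pol c)

theorem constV_mem_VPol (a : E3) : constV a ∈ VPol 0 :=
  mem_VPol.2 fun i => C_mem_Pol le_rfl (a i)

theorem rotP_mem_VPol {l : ℤ} {p : Poly3} (n : E3) (hp : p ∈ Pol l) : rotP n p ∈ VPol (l - 1) := by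
  rw [← add_zero (l - 1)]
  exact cross_mem_VPol (gradP_mem_VPol hp) (constV_mem_VPol n)

theorem mulPos_mem_VPol {l : ℤ} {p : Poly3} (c : E3) (hp : p ∈ Pol l) :
    mulPos c p ∈ VPol (l + 1) :=
  mem_VPol.2 fun i => mul_mem_Pol hp (posV_mem_Pol c i)

theorem crossPos_mem_VPol {l : ℤ} {w : VPoly3} (c : E3) (hw : w ∈ VPol l) :
    crossPos c w ∈ VPol (l + 1) := by
  rw [add_comm]
  exact cross_mem_VPol (posV_mem_VPol c) hw

theorem curlP_gradP (p : Poly3) : curlP (gradP p) = 0 := by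
  have h : ∀ i j : Fin 3, pderiv i (pderiv j p) = pderiv j (pderiv i p) := fun i j => by
    have := congrArg (fun D : Derivation ℝ Poly3 Poly3 => D p)
      (show ⁅(pderiv i : Derivation ℝ Poly3 Poly3), pderiv j⁆ = 0 from
        MvPolynomial.derivation_ext fun k => by simp [Derivation.commutator_apply, pderiv_X,
          Pi.single_apply, apply_ite])
    simpa [Derivation.commutator_apply, sub_eq_zero] using this
  funext i
  fin_cases i
  · simp [curlP, gradP, h 1 2]
  · simp [curlP, gradP, h 2 0]
  · simp [curlP, gradP, h 0 1]

/-- A polynomial field is the sum of a gradient and of a field `(x - c) × z`. -/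
theorem exists_gradP_add_crossPos {l : ℤ} (c : E3) {w : VPoly3} (hw : w ∈ VPol l) :
    ∃ r ∈ Pol (l + 1), ∃ z ∈ VPol (l - 1), gradP r + crossPos c z = w := by
  -- With `u + euler c u = w` in each component, `gradP_dot_posV` reads `w = ∇((x - c) · u) - (x -
  -- c) × curl u`.
  choose! u hu hu' using fun i => exists_add_euler_eq c (mem_VPol.1 hw i)
  have hu : u ∈ VPol l := mem_VPol.2 hu
  refine ⟨posV c ⬝ᵥ u, dot_posV_mem_Pol c hu, -curlP u, neg_mem (curlP_mem_VPol hu), ?_⟩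
  rw [gradP_dot_posV, map_neg]
  funext i
  simp only [Pi.add_apply, Pi.neg_apply, crossPos, LinearMap.coe_mk, AddHom.coe_mk, hu',
    add_neg_cancel_right]

/-- A polynomial field orthogonal to a unit vector `n` coincides on the plane through `c` with
normal `n` with the sum of a vector curl and of a multiple of `x - c`. -/
theorem exists_rotP_add_mulPos {l : ℤ} (c : E3) {n : E3} (hn : ‖n‖ = 1) {w : VPoly3}
    (hw : w ∈ VPol l) (hwn : w ⬝ᵥ constV n = 0) :
    ∃ r ∈ Pol (l + 1), ∃ p ∈ Pol (l - 1), ∀ x ∈ planeAt c n,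
      evalV (rotP n r + mulPos c p) x = evalV w x := by
  -- The splitting is applied to `n × w`, since `(n × w) × n = w` for `w` orthogonal to `n`. Taking
  -- the cross product with `n` turns the gradient into a rot and `(x - c) × curl u` into `((x - c)
  -- · n) curl u - (curl u · n) (x - c)`, whose first term vanishes on the plane. Hence the
  -- coefficient `curl u · n`.
  have hz : constV n ⨯₃ w ∈ VPol l := by simpa using cross_mem_VPol (constV_mem_VPol n) hw
  choose! u hu hu' using fun i => exists_add_euler_eq c (mem_VPol.1 hz i)
  have hu : u ∈ VPol l := mem_VPol.2 hu
  have hcu : curlP u ⬝ᵥ constV n ∈ Pol (l - 1) :=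
    Submodule.sum_mem _ fun i _ => by
      rw [mul_comm]
      exact C_mul_mem_Pol _ (mem_VPol.1 (curlP_mem_VPol hu) i)
  refine ⟨posV c ⬝ᵥ u, dot_posV_mem_Pol c hu, curlP u ⬝ᵥ constV n, hcu, fun x hx => ?_⟩
  have hx' : (x.ofLp - c.ofLp) ⬝ᵥ n.ofLp = 0 := by
    simpa [planeAt, PiLp.inner_apply, dotProduct, mul_comm] using hx
  have hn' : n.ofLp ⬝ᵥ n.ofLp = 1 := by
    have := EuclideanSpace.real_norm_sq_eq n
    rw [hn] at this
    simpa [dotProduct, sq] using this.symm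
  have hwn' := congrArg (eval x.ofLp) hwn
  have hg : gradP (posV c ⬝ᵥ u) = constV n ⨯₃ w + posV c ⨯₃ curlP u := by
    rw [gradP_dot_posV]
    congr 1
    exact funext hu'
  simp only [rotP, LinearMap.coe_mk, AddHom.coe_mk, hg]
  generalize curlP u = k
  simp only [dotProduct, Fin.sum_univ_three, constV, Pi.sub_apply, map_add, map_mul, eval_C,
    map_zero] at hx' hn' hwn'
  ext i
  fin_cases i
  · simp [evalV, mulPos, posV, constV, crossProduct, dotProduct, Fin.sum_univ_three]
    linear_combination eval x.ofLp (w 0) * hn' - n 0 * hwn' + eval x.ofLp (k 0) * hx'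
  · simp [evalV, mulPos, posV, constV, crossProduct, dotProduct, Fin.sum_univ_three]
    linear_combination eval x.ofLp (w 1) * hn' - n 1 * hwn' + eval x.ofLp (k 1) * hx'
  · simp [evalV, mulPos, posV, constV, crossProduct, dotProduct, Fin.sum_univ_three]
    linear_combination eval x.ofLp (w 2) * hn' - n 2 * hwn' + eval x.ofLp (k 2) * hx'

theorem posV_dot_crossPos (c : E3) (z : VPoly3) : posV c ⬝ᵥ crossPos c z = 0 := by
  simp [crossPos]

/-- A relation `curl ((x - c) × z) + p (x - c) = 0` has `(x - c) × z = 0`. -/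
theorem crossPos_eq_zero_of_curlP_add_mulPos {c : E3} {z : VPoly3} {p : Poly3}
    (h : curlP (crossPos c z) + mulPos c p = 0) : crossPos c z = 0 := by
  have h1 : curlP (crossPos c z) = -mulPos c p := eq_neg_of_add_eq_zero_left h
  -- For `u = (x - c) × z` the left side is zero, and so is `(x - c) × curl u` because `curl u` is
  -- parallel to `x - c`. What remains is `u + euler c u = 0`.
  have h2 := gradP_dot_posV c (crossPos c z)
  have h3 : posV c ⨯₃ mulPos c p = 0 := by
    have : mulPos c p = p • posV c := by funext i; simp [mulPos]
    rw [this, map_smul, cross_self, smul_zero]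
  rw [posV_dot_crossPos, map_zero, h1, map_neg, h3, neg_zero, add_zero] at h2
  funext i
  exact eq_zero_of_add_euler_eq_zero (congrFun h2 i).symm

/-! ## Measures on mesh entities -/

theorem isometry_const_add_coe (c : E3) (W : Submodule ℝ E3) :
    Isometry fun w : W => c + (w : E3) :=
  (isometry_vadd E3 c).comp isometry_subtype_coe

/-- The map `w ↦ c + w` is an isometry, so on a translate of `W` the Hausdorff measure is the
Lebesgue measure of `W`. Faces and edges inherit finiteness from this, and faces also the positivity
of relatively open sets. -/
theorem euclideanHausdorffMeasure_image_const_add {W : Submodule ℝ E3} {d : ℕ}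
    (hd : Module.finrank ℝ W = d) (c : E3) (s : Set W) :
    Measure.euclideanHausdorffMeasure d ((fun w : W => c + (w : E3)) '' s) = volume s := by
  rw [(isometry_const_add_coe c W).euclideanHausdorffMeasure_image, ← hd,
    InnerProductSpace.euclideanHausdorffMeasure_eq_volume]

theorem euclideanHausdorffMeasure_lt_top {W : Submodule ℝ E3} {d : ℕ}
    (hd : Module.finrank ℝ W = d) {c : E3} {s : Set E3} (hs : Bornology.IsBounded s)
    (hsW : ∀ x ∈ s, x - c ∈ W) : Measure.euclideanHausdorffMeasure d s < ⊤ := by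
  have h : s = (fun w : W => c + (w : E3)) '' ((fun w : W => c + (w : E3)) ⁻¹' s) := by
    rw [Set.image_preimage_eq_of_subset]
    intro x hx
    exact ⟨⟨x - c, hsW x hx⟩, by simp⟩
  rw [h, euclideanHausdorffMeasure_image_const_add hd]
  refine Bornology.IsBounded.measure_lt_top ?_
  have hi := isometry_const_add_coe c W
  obtain ⟨C, hC⟩ := Metric.isBounded_iff.1 hs
  refine Metric.isBounded_iff.2 ⟨C, fun x hx y hy => ?_⟩
  rw [← hi.dist_eq]
  exact hC hx hy

/-- A continuous function that is nonzero at a point of `s` is nonzero on a relatively open piece of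
`s`. That piece corresponds to a nonempty open subset of `W`, which has positive Lebesgue measure.
-/
theorem eq_zero_of_ae_euclideanHausdorffMeasure {W : Submodule ℝ E3} {d : ℕ}
    (hd : Module.finrank ℝ W = d) {c : E3} {s U : Set E3} (hU : IsOpen U)
    (hsU : s = U ∩ {x | x - c ∈ W}) {G : Type*} [NormedAddCommGroup G] {f : E3 → G}
    (hf : Continuous f) (h0 : f =ᵐ[(Measure.euclideanHausdorffMeasure d).restrict s] 0) :
    ∀ x ∈ s, f x = 0 := by
  by_contra! hcon
  obtain ⟨x, hx, hfx⟩ := hcon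
  have hms : MeasurableSet s := by
    rw [hsU]
    refine hU.measurableSet.inter (IsClosed.measurableSet ?_)
    exact W.closed_of_finiteDimensional.preimage (f := fun x : E3 => x - c) (by fun_prop)
  have hU' : IsOpen (U ∩ {x | f x ≠ 0}) := hU.inter (isOpen_ne_fun hf continuous_const)
  have hN : Measure.euclideanHausdorffMeasure d {x | ¬ (x ∈ s → f x = 0)} = 0 := by
    have := (ae_restrict_iff' hms).1 h0
    exact this
  have hsub : (fun w : W => c + (w : E3)) '' ((fun w : W => c + (w : E3)) ⁻¹'
      (U ∩ {x | f x ≠ 0})) ⊆ {x | ¬ (x ∈ s → f x = 0)} := by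
    rintro _ ⟨w, ⟨hw, hw'⟩, rfl⟩
    simp only [Set.mem_ofPred_eq, Classical.not_imp]
    exact ⟨by rw [hsU]; exact ⟨hw, by simp⟩, hw'⟩
  have h1 := measure_mono_null hsub hN
  rw [euclideanHausdorffMeasure_image_const_add hd] at h1
  have h2 : IsOpen ((fun w : W => c + (w : E3)) ⁻¹' (U ∩ {x | f x ≠ 0})) :=
    hU'.preimage (by fun_prop)
  rw [h2.measure_eq_zero_iff (volume : Measure W)] at h1
  rw [hsU] at hx
  have : (⟨x - c, hx.2⟩ : W) ∈ (fun w : W => c + (w : E3)) ⁻¹' (U ∩ {x | f x ≠ 0}) := by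
    simpa using ⟨hx.1, hfx⟩
  rw [h1] at this
  exact this

theorem mem_planeAt_iff {c n x : E3} : x ∈ planeAt c n ↔ x - c ∈ (ℝ ∙ n)ᗮ := by
  rw [Submodule.mem_orthogonal_singleton_iff_inner_left]
  rfl

theorem isClosed_planeAt (c n : E3) : IsClosed (planeAt c n) :=
  isClosed_eq (by fun_prop) continuous_const

theorem boundedSupport_restrict {μ : Measure E3} {s : Set E3} (hs : Bornology.IsBounded s)
    (hμ : μ s < ⊤) : BoundedSupport (μ.restrict s) := by
  obtain ⟨R, hR⟩ := hs.subset_closedBall 0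
  exact
    { measure_univ_lt_top := by simpa using hμ
      ae_norm_le := ⟨R, ae_restrict_of_ae_restrict_of_subset hR
        (ae_restrict_of_forall_mem measurableSet_closedBall fun x hx => by simpa using hx)⟩ }

theorem ae_restrict_of_subset_isClosed {μ : Measure E3} {s K : Set E3} (hK : IsClosed K)
    (hs : s ⊆ K) {p : E3 → Prop} (hp : ∀ x ∈ K, p x) : ∀ᵐ x ∂μ.restrict s, p x :=
  ae_restrict_of_ae_restrict_of_subset hs (ae_restrict_of_forall_mem hK.measurableSet hp)

theorem evalS_continuous (p : Poly3) : Continuous (evalS p) :=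
  (MvPolynomial.continuous_eval p).comp (by fun_prop)

theorem evalV_continuous (w : VPoly3) : Continuous (evalV w) :=
  (PiLp.continuous_toLp 2 _).comp
    (continuous_pi fun i => (MvPolynomial.continuous_eval (w i)).comp (by fun_prop))

theorem eq_zero_of_evalS_eq_zero {p : Poly3} {U : Set E3} (hU : IsOpen U) (hne : U.Nonempty)
    (h : ∀ x ∈ U, evalS p x = 0) : p = 0 := by
  obtain ⟨c, hc⟩ := hne
  have hU' : IsOpen ((WithLp.toLp 2 : (Fin 3 → ℝ) → E3) ⁻¹' U) :=
    hU.preimage (PiLp.continuous_toLp 2 _)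
  obtain ⟨ε, hε, hball⟩ := Metric.isOpen_iff.1 hU' c.ofLp (by simpa using hc)
  refine MvPolynomial.funext_set (fun i => Metric.ball (c i) ε) (fun i => ?_) fun x hx => ?_
  · rw [Real.ball_eq_Ioo]
    exact Set.Ioo_infinite (by linarith)
  · rw [map_zero]
    refine h (WithLp.toLp 2 x) (hball ?_)
    rw [ball_pi _ hε]
    exact hx

theorem eq_zero_of_evalV_eq_zero {w : VPoly3} {U : Set E3} (hU : IsOpen U) (hne : U.Nonempty)
    (h : ∀ x ∈ U, evalV w x = 0) : w = 0 := by
  funext i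
  refine eq_zero_of_evalS_eq_zero hU hne fun x hx => ?_
  exact congrArg (fun v : E3 => v i) (h x hx)

theorem evalV_add (v w : VPoly3) (x : E3) : evalV (v + w) x = evalV v x + evalV w x := by
  ext i; simp [evalV]

namespace PolyMesh

variable (M : PolyMesh)

theorem finrank_orthogonal_normal (F : Fin M.nF) :
    Module.finrank ℝ (ℝ ∙ M.normal F : Submodule ℝ E3)ᗮ = 2 := by
  have : Fact (Module.finrank ℝ E3 = 2 + 1) := ⟨by simp⟩
  refine Submodule.finrank_orthogonal_span_singleton (n := 2) fun h => ?_
  have := M.normal_unit F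
  simp [h] at this

theorem face_subset_plane (F : Fin M.nF) : M.face F ⊆ planeAt (M.facePt F) (M.normal F) := by
  obtain ⟨U, -, h⟩ := M.face_planar F
  rw [h]
  exact Set.inter_subset_right

theorem closure_face_subset_plane (F : Fin M.nF) :
    closure (M.face F) ⊆ planeAt (M.facePt F) (M.normal F) :=
  closure_minimal (M.face_subset_plane F) (isClosed_planeAt _ _)

instance (T : Fin M.nT) : BoundedSupport (M.mT T) :=
  boundedSupport_restrict (M.cell_bounded T) (M.cell_bounded T).measure_lt_top

instance (F : Fin M.nF) : BoundedSupport (M.mF F) :=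
  boundedSupport_restrict (M.face_bounded F)
    (euclideanHausdorffMeasure_lt_top (M.finrank_orthogonal_normal F) (M.face_bounded F)
      fun _ hx => mem_planeAt_iff.1 (M.face_subset_plane F hx))

theorem vert_injective : Function.Injective M.vert := by
  intro V V' h
  by_contra hne
  have := M.entities_disjoint (i := Sum.inr (Sum.inr (Sum.inr V)))
    (j := Sum.inr (Sum.inr (Sum.inr V'))) (by simpa using hne)
  simp [Function.onFun, h] at this

theorem edgeVec_ne_zero (E : Fin M.nE) : M.vert (M.tgt E) - M.vert (M.src E) ≠ 0 :=
  sub_ne_zero.2 fun h => M.src_ne_tgt E (M.vert_injective h).symm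

instance (E : Fin M.nE) : BoundedSupport (M.mE E) := by
  have hb : Bornology.IsBounded (M.edge E) := by
    refine Bornology.IsBounded.subset ?_ (openSegment_subset_segment ℝ _ _)
    rw [← convexHull_pair]
    exact (isBounded_convexHull).2 (by simp)
  refine boundedSupport_restrict hb (euclideanHausdorffMeasure_lt_top
    (W := ℝ ∙ (M.vert (M.tgt E) - M.vert (M.src E))) (c := M.vert (M.src E))
    (finrank_span_singleton (M.edgeVec_ne_zero E)) hb fun x hx => ?_)
  unfold edge at hx
  rw [openSegment_eq_image'] at hx
  obtain ⟨θ, -, rfl⟩ := hx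
  rw [add_sub_cancel_left]
  exact Submodule.smul_mem _ _ (Submodule.mem_span_singleton_self _)

variable {M}

theorem eq_zero_of_ae_mT {T : Fin M.nT} {G : Type*} [NormedAddCommGroup G] {f : E3 → G}
    (hf : Continuous f) (h : f =ᵐ[M.mT T] 0) : ∀ x ∈ closure (M.cell T), f x = 0 := by
  have h1 : Set.EqOn f 0 (M.cell T) :=
    Measure.eqOn_open_of_ae_eq h (M.cell_open T) hf.continuousOn continuousOn_const
  exact h1.closure hf continuous_const

theorem eq_zero_of_ae_mF {F : Fin M.nF} {G : Type*} [NormedAddCommGroup G] {f : E3 → G}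
    (hf : Continuous f) (h : f =ᵐ[M.mF F] 0) : ∀ x ∈ closure (M.face F), f x = 0 := by
  obtain ⟨U, hU, hFU⟩ := M.face_planar F
  have h1 : Set.EqOn f 0 (M.face F) :=
    eq_zero_of_ae_euclideanHausdorffMeasure (M.finrank_orthogonal_normal F) hU
      (c := M.facePt F) (by
        rw [hFU]
        ext x
        simp [mem_planeAt_iff, Submodule.mem_orthogonal_singleton_iff_inner_left])
      hf h
  exact h1.closure hf continuous_const

theorem ae_mT {T : Fin M.nT} {p : E3 → Prop} (hp : ∀ x ∈ closure (M.cell T), p x) :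
    ∀ᵐ x ∂M.mT T, p x :=
  ae_restrict_of_subset_isClosed isClosed_closure subset_closure hp

theorem ae_mF {F : Fin M.nF} {p : E3 → Prop} (hp : ∀ x ∈ closure (M.face F), p x) :
    ∀ᵐ x ∂M.mF F, p x :=
  ae_restrict_of_subset_isClosed isClosed_closure subset_closure hp

/-- Edges of a face lie in its closure, so a relation between polynomials on the closed face also
holds inside the edge integrals. -/
theorem ae_mE_of_mem_edgesF {F : Fin M.nF} {E : Fin M.nE} (hE : E ∈ M.edgesF F)
    {p : E3 → Prop} (hp : ∀ x ∈ closure (M.face F), p x) : ∀ᵐ x ∂M.mE E, p x :=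
  ae_restrict_of_subset_isClosed isClosed_closure
    (by
      simp only [edgesF, Finset.mem_filter, Finset.mem_univ, true_and] at hE
      exact hE.trans Set.sdiff_subset) hp

/-! ## Polynomials that are constant along rays -/

theorem evalS_eq_of_ray {r : Poly3} {c x : E3}
    (h : ∀ t ∈ Set.Icc (0 : ℝ) 1, ∑ i, (x i - c i) * evalS (pderiv i r) (c + t • (x - c)) = 0) :
    evalS r x = evalS r c := by
  have hd := hasDerivAt_eval_line r c.ofLp (x.ofLp - c.ofLp)
  have := constant_of_has_deriv_right_zero (a := (0 : ℝ)) (b := 1)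
    (f := fun t : ℝ => eval (c.ofLp + t • (x.ofLp - c.ofLp)) r)
    (fun t _ => (hd t).continuousAt.continuousWithinAt)
    (fun t ht => by
      refine ((hd t).congr_deriv ?_).hasDerivWithinAt
      exact h t ⟨ht.1, ht.2.le⟩) 1 (by simp)
  simpa [evalS] using this

theorem ray_mem {S : Set E3} {c x : E3} (hS : StarConvex ℝ c S) (hx : x ∈ S) {t : ℝ}
    (ht : t ∈ Set.Icc (0 : ℝ) 1) : c + t • (x - c) ∈ S := by
  have := hS hx (sub_nonneg.2 ht.2) ht.1 (by simp)
  convert this using 1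
  module

theorem face_starConvex (F : Fin M.nF) : StarConvex ℝ (M.facePt F) (M.face F) := by
  obtain ⟨r, hr, h⟩ := M.face_star F
  exact h _ ⟨by simpa using hr, by simp [planeAt]⟩

theorem cell_starConvex (T : Fin M.nT) : StarConvex ℝ (M.cellPt T) (M.cell T) := by
  obtain ⟨r, hr, h⟩ := M.cell_star T
  exact h _ (by simpa using hr)

theorem dot_normal_self (F : Fin M.nF) : M.normal F 0 * M.normal F 0 +
    M.normal F 1 * M.normal F 1 + M.normal F 2 * M.normal F 2 = 1 := by
  have := EuclideanSpace.real_norm_sq_eq (M.normal F)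
  rw [M.normal_unit, Fin.sum_univ_three] at this
  linarith

theorem dot_of_mem_plane {c n x : E3} (hx : x ∈ planeAt c n) :
    (x 0 - c 0) * n 0 + (x 1 - c 1) * n 1 + (x 2 - c 2) * n 2 = 0 := by
  have : inner ℝ (x - c) n = 0 := hx
  simp only [PiLp.inner_apply, Fin.sum_univ_three] at this
  simp at this
  linarith

/-- The tangential derivatives of a polynomial that is constant on a face vanish there. -/
theorem rotP_eq_zero_of_const {F : Fin M.nF} {r : Poly3} {a : ℝ}
    (h : ∀ x ∈ M.face F, evalS r x = a) : ∀ x ∈ closure (M.face F),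
    evalV (rotP (M.normal F) r) x = 0 := by
  have key : Set.EqOn (evalV (rotP (M.normal F) r)) 0 (M.face F) := by
    intro x hx
    obtain ⟨U, hU, hFU⟩ := M.face_planar F
    have hder : ∀ v : E3, inner ℝ v (M.normal F) = 0 →
        ∑ i, v i * evalS (pderiv i r) x = 0 := by
      intro v hv
      have hd := hasDerivAt_eval_line r x.ofLp v.ofLp 0
      have hev : (fun t : ℝ => eval (x.ofLp + t • v.ofLp) r) =ᶠ[nhds 0] fun _ => a := by
        have hc : Continuous fun t : ℝ => x + t • v := by fun_prop
        have hx' : x ∈ U := by rw [hFU] at hx; exact hx.1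
        have := hc.continuousAt (x := 0) (hU.mem_nhds (by simpa using hx'))
        filter_upwards [this] with t ht
        refine h (x + t • v) ?_
        rw [hFU]
        refine ⟨ht, ?_⟩
        have hx2 : inner ℝ (x - M.facePt F) (M.normal F) = 0 := M.face_subset_plane F hx
        simp only [planeAt, Set.mem_ofPred_eq]
        rw [add_sub_right_comm, inner_add_left, hx2, inner_smul_left, hv]
        simp
      have h0 := (hd.congr_of_eventuallyEq hev.symm).unique (hasDerivAt_const 0 a)
      simpa [evalS] using h0
    have hn := dot_normal_self F
    set n := M.normal F
    set g : Fin 3 → ℝ := fun i => evalS (pderiv i r) x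
    -- The vectors `n × e_i` are tangent to the face, and the components of `∇r × n` are the
    -- derivatives of `r` along them.
    have h1 := hder !₂[0, n 2, -n 1] (by
      simp [PiLp.inner_apply, Fin.sum_univ_three]; ring)
    have h2 := hder !₂[-n 2, 0, n 0] (by
      simp [PiLp.inner_apply, Fin.sum_univ_three]; ring)
    have h3 := hder !₂[n 1, -n 0, 0] (by
      simp [PiLp.inner_apply, Fin.sum_univ_three]; ring)
    simp only [Fin.sum_univ_three, evalS] at h1 h2 h3
    simp at h1 h2 h3
    ext i
    fin_cases i
    · simp [evalV, rotP, gradP, constV, crossProduct]; linarith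
    · simp [evalV, rotP, gradP, constV, crossProduct]; linarith
    · simp [evalV, rotP, gradP, constV, crossProduct]; linarith
  exact key.closure (evalV_continuous _) continuous_const

theorem mF_ne_zero (F : Fin M.nF) : M.mF F ≠ 0 := by
  intro h
  have := eq_zero_of_ae_mF (M := M) (F := F) (f := fun _ => (1 : ℝ)) continuous_const
    (by rw [h]; exact ae_zero (α := E3) ▸ Filter.eventually_bot) (M.facePt F) (subset_closure (M.facePt_mem F))
  exact one_ne_zero this

theorem mT_ne_zero (T : Fin M.nT) : M.mT T ≠ 0 := by
  intro h
  have := eq_zero_of_ae_mT (M := M) (T := T) (f := fun _ => (1 : ℝ)) continuous_const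
    (by rw [h]; exact ae_zero (α := E3) ▸ Filter.eventually_bot) (M.cellPt T) (subset_closure (M.cellPt_mem T))
  exact one_ne_zero this

theorem const_eq_zero_of_integral {m : Measure E3} [BoundedSupport m] (hm : m ≠ 0) {f : E3 → ℝ}
    {a : ℝ} (hf : ∀ᵐ x ∂m, f x = a) (h : ∫ x, f x ∂m = 0) : a = 0 := by
  rw [integral_congr_ae hf, integral_const, smul_eq_mul, mul_eq_zero] at h
  refine h.resolve_left ?_
  rw [Measure.real, ENNReal.toReal_eq_zero_iff]
  simp [hm]

/-- The sum of vector curls and of multiples of `x - x_F` is direct on a face. -/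
theorem eq_zero_of_rotP_add_mulPos {F : Fin M.nF} {r p : Poly3}
    (h : ∀ x ∈ M.face F, evalV (rotP (M.normal F) r + mulPos (M.facePt F) p) x = 0)
    (h0 : ∫ x, evalS r x ∂M.mF F = 0) :
    (∀ x ∈ closure (M.face F), evalS r x = 0) ∧
      ∀ x ∈ closure (M.face F), evalV (mulPos (M.facePt F) p) x = 0 := by
  -- With `y = x - x_F`, the product of the relation with `n × y` kills the multiple of `y` and
  -- leaves minus the radial derivative of `r`, because `y` is orthogonal to `n`. The face is
  -- star-shaped about `x_F`, so `r` is constant on it, and its zero integral makes the constant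
  -- zero.
  have hconst : ∀ x ∈ M.face F, evalS r x = evalS r (M.facePt F) := by
    intro x hx
    refine evalS_eq_of_ray fun t ht => ?_
    have hz := h _ (ray_mem (face_starConvex F) hx ht)
    have hn := dot_normal_self F
    have hp := dot_of_mem_plane (M.face_subset_plane F hx)
    have e0 := congrArg (fun v : E3 => v 0) hz
    have e1 := congrArg (fun v : E3 => v 1) hz
    have e2 := congrArg (fun v : E3 => v 2) hz
    set c := M.facePt F
    set n := M.normal F
    simp [evalV, rotP, gradP, mulPos, posV, constV, crossProduct] at e0 e1 e2
    simp only [Fin.sum_univ_three, evalS]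
    set z := c + t • (x - c)
    have hz' : (z : E3).ofLp = c.ofLp + t • (x.ofLp - c.ofLp) := rfl
    rw [hz']
    set g0 := eval (c.ofLp + t • (x.ofLp - c.ofLp)) (pderiv 0 r)
    set g1 := eval (c.ofLp + t • (x.ofLp - c.ofLp)) (pderiv 1 r)
    set g2 := eval (c.ofLp + t • (x.ofLp - c.ofLp)) (pderiv 2 r)
    set q := eval (c.ofLp + t • (x.ofLp - c.ofLp)) p
    set y0 := x.ofLp 0 - c.ofLp 0
    set y1 := x.ofLp 1 - c.ofLp 1
    set y2 := x.ofLp 2 - c.ofLp 2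
    linear_combination (-(y0 * g0 + y1 * g1 + y2 * g2)) * hn
      + (n 0 * g0 + n 1 * g1 + n 2 * g2) * hp
      - (n 1 * y2 - n 2 * y1) * e0 - (n 2 * y0 - n 0 * y2) * e1 - (n 0 * y1 - n 1 * y0) * e2
  have hconst' : ∀ x ∈ closure (M.face F), evalS r x = evalS r (M.facePt F) :=
    Set.EqOn.closure (f := evalS r) (g := fun _ => evalS r (M.facePt F)) hconst
      (evalS_continuous r) continuous_const
  have ha := const_eq_zero_of_integral (mF_ne_zero F) (ae_mF hconst') h0
  refine ⟨fun x hx => by rw [hconst' x hx, ha], ?_⟩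
  refine Set.EqOn.closure (f := evalV (mulPos (M.facePt F) p)) (g := 0) (fun x hx => ?_)
    (evalV_continuous _) continuous_const
  have := h x hx
  rw [evalV_add, rotP_eq_zero_of_const hconst x (subset_closure hx), zero_add] at this
  exact this

/-- The sum of gradients and of fields `(x - x_T) × z` is direct on an element. -/
theorem eq_zero_of_gradP_add_crossPos {T : Fin M.nT} {r : Poly3} {z : VPoly3}
    (h : ∀ x ∈ M.cell T, evalV (gradP r + crossPos (M.cellPt T) z) x = 0)
    (h0 : ∫ x, evalS r x ∂M.mT T = 0) : r = 0 ∧ crossPos (M.cellPt T) z = 0 := by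
  -- The product with `x - x_T` kills `(x - x_T) × z` along the whole ray and leaves the radial
  -- derivative of `r`.
  have hconst : ∀ x ∈ M.cell T, evalS r x = evalS r (M.cellPt T) := by
    intro x hx
    refine evalS_eq_of_ray fun t ht => ?_
    have hz := h _ (ray_mem (cell_starConvex T) hx ht)
    have e0 := congrArg (fun v : E3 => v 0) hz
    have e1 := congrArg (fun v : E3 => v 1) hz
    have e2 := congrArg (fun v : E3 => v 2) hz
    set c := M.cellPt T
    simp [evalV, gradP, crossPos, posV, crossProduct] at e0 e1 e2
    simp only [Fin.sum_univ_three, evalS]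
    simp only [WithLp.ofLp_add, WithLp.ofLp_smul, WithLp.ofLp_sub] at *
    linear_combination (x.ofLp 0 - c.ofLp 0) * e0 + (x.ofLp 1 - c.ofLp 1) * e1
      + (x.ofLp 2 - c.ofLp 2) * e2
  have hconst' : ∀ x ∈ closure (M.cell T), evalS r x = evalS r (M.cellPt T) :=
    Set.EqOn.closure (f := evalS r) (g := fun _ => evalS r (M.cellPt T)) hconst
      (evalS_continuous r) continuous_const
  have ha := const_eq_zero_of_integral (mT_ne_zero T) (ae_mT hconst') h0
  have hne : (M.cell T).Nonempty := ⟨_, M.cellPt_mem T⟩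
  have hr : r = 0 := eq_zero_of_evalS_eq_zero (M.cell_open T) hne
    fun x hx => by rw [hconst x hx, ha]
  refine ⟨hr, eq_zero_of_evalV_eq_zero (M.cell_open T) hne fun x hx => ?_⟩
  have := h x hx
  rwa [hr, map_zero, zero_add] at this

end PolyMesh

/-! ## The boundary of the boundary of an element -/

open Filter Topology in
/-- The increment of a piecewise constant function is the sum of its jumps. -/
theorem sub_eq_sum_jumps {ι : Type*} (S : Finset ι) {a b : ℝ} (hab : a ≤ b) (α j : ι → ℝ)
    (hα : ∀ i ∈ S, α i ∈ Set.Ioo a b) (hinj : Set.InjOn α S) (f : ℝ → ℝ)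
    (h1 : ∀ x ∈ Set.Icc a b, (∀ i ∈ S, x ≠ α i) → ∀ᶠ y in 𝓝 x, f y = f x)
    (h2 : ∀ i ∈ S, ∃ l, (∀ᶠ y in 𝓝[<] α i, f y = l) ∧ ∀ᶠ y in 𝓝[>] α i, f y = l + j i) :
    f b - f a = ∑ i ∈ S, j i := by
  classical
  induction S using Finset.induction_on generalizing f with
  | empty =>
    have hd : ∀ x ∈ Set.Icc a b, HasDerivAt f 0 x := fun x hx =>
      (hasDerivAt_const x (f x)).congr_of_eventuallyEq (h1 x hx (by simp))
    have := constant_of_has_deriv_right_zero (a := a) (b := b) (f := f)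
      (fun x hx => (hd x hx).continuousAt.continuousWithinAt)
      (fun x hx => (hd x ⟨hx.1, hx.2.le⟩).hasDerivWithinAt) b ⟨hab, le_rfl⟩
    simp [this]
  | insert i S hi ih =>
    obtain ⟨l, hl, hr⟩ := h2 i (Finset.mem_insert_self _ _)
    -- Removing the jump at `α i`: everything to its right is shifted by `- j i`, and the value at
    -- `α i` itself is set to the left limit. Then `g` is locally constant there and has the same
    -- other jumps as `f`.
    let g : ℝ → ℝ := fun y => if y < α i then f y else if y = α i then l else f y - j i
    have hgl : ∀ y < α i, g y = f y := fun y hy => if_pos hy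
    have hgr : ∀ y, α i < y → g y = f y - j i := fun y hy => by
      simp only [g]
      rw [if_neg hy.le.not_gt, if_neg hy.ne']
    have hgm : g (α i) = l := by simp [g]
    have key := ih (fun k hk => hα k (Finset.mem_insert_of_mem hk))
      (hinj.mono (by simp)) g ?_ ?_
    · have hi' := hα i (Finset.mem_insert_self _ _)
      rw [hgl a hi'.1, hgr b hi'.2] at key
      rw [Finset.sum_insert hi]
      linarith
    · intro x hx hxS
      rcases lt_trichotomy x (α i) with h | h | h
      · filter_upwards [h1 x hx (by simpa using ⟨h.ne, hxS⟩), Iio_mem_nhds h] with y hy hy'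
        rw [hgl y hy', hgl x h, hy]
      · rw [h, hgm, ← nhdsLT_sup_nhdsGE, ← Set.Ioi_insert, nhdsWithin_insert, eventually_sup,
          eventually_sup]
        refine ⟨?_, hgm, ?_⟩
        · filter_upwards [hl, self_mem_nhdsWithin] with y hy hy'
          rw [hgl y hy', hy]
        · filter_upwards [hr, self_mem_nhdsWithin] with y hy hy'
          rw [hgr y hy', hy]
          ring
      · filter_upwards [h1 x hx (by simpa using ⟨h.ne', hxS⟩), Ioi_mem_nhds h] with y hy hy'
        rw [hgr y hy', hgr x h, hy]
    · intro k hk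
      obtain ⟨l', hl', hr'⟩ := h2 k (Finset.mem_insert_of_mem hk)
      have hne : α k ≠ α i := fun h => by
        rw [hinj (by simp [hk]) (by simp) h] at hk
        exact hi hk
      rcases hne.lt_or_gt with h | h
      · have hmem := Iio_mem_nhds h
        refine ⟨l', ?_, ?_⟩
        · filter_upwards [hl', mem_nhdsWithin_of_mem_nhds hmem] with y hy hy'
          rw [hgl y hy', hy]
        · filter_upwards [hr', mem_nhdsWithin_of_mem_nhds hmem] with y hy hy'
          rw [hgl y hy', hy]
      · have hmem := Ioi_mem_nhds h
        refine ⟨l' - j i, ?_, ?_⟩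
        · filter_upwards [hl', mem_nhdsWithin_of_mem_nhds hmem] with y hy hy'
          rw [hgr y hy', hy]
        · filter_upwards [hr', mem_nhdsWithin_of_mem_nhds hmem] with y hy hy'
          rw [hgr y hy', hy]
          ring

/-! ### Cross products -/

theorem inner_eq_sum (x y : E3) : (inner ℝ x y : ℝ) = x 0 * y 0 + x 1 * y 1 + x 2 * y 2 := by
  simp only [PiLp.inner_apply, Fin.sum_univ_three]
  simp
  ring

theorem cross_apply (x y : E3) : cross x y = !₂[x 1 * y 2 - x 2 * y 1, x 2 * y 0 - x 0 * y 2,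
    x 0 * y 1 - x 1 * y 0] := by
  simp [cross, crossProduct]

theorem inner_self_cross (x y : E3) : inner ℝ x (cross x y) = 0 := by
  simp [inner_eq_sum, cross_apply]; ring

theorem inner_self_cross' (x y : E3) : inner ℝ y (cross x y) = 0 := by
  simp [inner_eq_sum, cross_apply]; ring

theorem inner_cross_cross (a b c d : E3) : (inner ℝ (cross a b) (cross c d) : ℝ) =
    inner ℝ a c * inner ℝ b d - inner ℝ a d * inner ℝ b c := by
  simp [inner_eq_sum, cross_apply]; ring

theorem cross_cross_right (a b c : E3) :
    cross a (cross b c) = (inner ℝ a c : ℝ) • b - (inner ℝ a b : ℝ) • c := by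
  ext i
  fin_cases i <;> simp [inner_eq_sum, cross_apply] <;> ring

theorem cross_smul_right (a b : E3) (c : ℝ) : cross a (c • b) = c • cross a b := by
  simp [cross]

theorem cross_neg_comm (a b : E3) : -cross a b = cross b a := by
  ext i
  fin_cases i <;> simp [cross_apply] <;> ring

theorem cross_add_right (a b c : E3) : cross a (b + c) = cross a b + cross a c := by
  simp [cross]

theorem norm_cross_eq_one {a b : E3} (ha : ‖a‖ = 1) (hb : ‖b‖ = 1) (hab : inner ℝ a b = 0) :
    ‖cross a b‖ = 1 := by
  have h := inner_cross_cross a b a b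
  rw [real_inner_self_eq_norm_sq, real_inner_self_eq_norm_sq, real_inner_self_eq_norm_sq, ha, hb,
    hab] at h
  rw [← sq_eq_sq₀ (norm_nonneg _) zero_le_one, h]
  norm_num

theorem eq_of_orthonormal_frame {t u d : E3} (ht : ‖t‖ = 1) (hu : ‖u‖ = 1) (htu : inner ℝ t u = 0)
    (htd : inner ℝ t d = 0) :
    d = (inner ℝ u d : ℝ) • u + (inner ℝ (cross t u) d : ℝ) • cross t u := by
  have hv := norm_cross_eq_one ht hu htu
  have hut : inner ℝ u t = 0 := by rw [real_inner_comm, htu]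
  have htv := inner_self_cross t u
  have huv := inner_self_cross' t u
  have hvt : inner ℝ (cross t u) t = 0 := by rw [real_inner_comm, htv]
  have hvu : inner ℝ (cross t u) u = 0 := by rw [real_inner_comm, huv]
  have hon : Orthonormal ℝ ![t, u, cross t u] := by
    refine ⟨fun i => ?_, fun i j hij => ?_⟩
    · fin_cases i
      exacts [ht, hu, hv]
    · fin_cases i <;> fin_cases j
      exacts [absurd rfl hij, htu, htv, hut, absurd rfl hij, huv, hvt, hvu, absurd rfl hij]
  have hsp : Submodule.span ℝ (Set.range ![t, u, cross t u]) = ⊤ :=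
    hon.linearIndependent.span_eq_top_of_card_eq_finrank' (by simp)
  have := (OrthonormalBasis.mk hon hsp.ge).sum_repr' d
  simp only [OrthonormalBasis.coe_mk, Fin.sum_univ_three] at this
  simp [htd] at this
  exact this.symm

theorem exists_angle {x y : ℝ} (h : x ^ 2 + y ^ 2 = 1) :
    ∃ α ∈ Set.Ioc (-Real.pi) Real.pi, Real.cos α = x ∧ Real.sin α = y := by
  have hn : ‖(⟨x, y⟩ : ℂ)‖ = 1 := by
    rw [← sq_eq_sq₀ (norm_nonneg _) zero_le_one, ← Complex.normSq_eq_norm_sq, Complex.normSq_mk]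
    linarith
  refine ⟨Complex.arg ⟨x, y⟩, Complex.arg_mem_Ioc _, ?_, ?_⟩
  · have := Complex.norm_mul_cos_arg ⟨x, y⟩
    rwa [hn, one_mul] at this
  · have := Complex.norm_mul_sin_arg ⟨x, y⟩
    rwa [hn, one_mul] at this

theorem PointsOut.smul {S : Set E3} {x n : E3} (h : PointsOut S x n) {c : ℝ} (hc : 0 < c) :
    PointsOut S x (c • n) := by
  obtain ⟨ε, hε, h⟩ := h
  refine ⟨ε / c, by positivity, fun s hs => ?_⟩
  have := h (s * c) ⟨mul_pos hs.1 hc, (lt_div_iff₀ hc).1 hs.2⟩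
  rwa [mul_smul] at this

/-! ### Incidence and sides of mesh entities -/

namespace PolyMesh

variable {M : PolyMesh}

theorem mem_facesT {T : Fin M.nT} {F : Fin M.nF} :
    F ∈ M.facesT T ↔ M.face F ⊆ frontier (M.cell T) := by
  simp [facesT]

theorem mem_edgesF {F : Fin M.nF} {E : Fin M.nE} :
    E ∈ M.edgesF F ↔ M.edge E ⊆ closure (M.face F) \ M.face F := by
  simp [edgesF]

theorem closure_edge (E : Fin M.nE) :
    closure (M.edge E) = insert (M.vert (M.src E)) (insert (M.vert (M.tgt E)) (M.edge E)) := by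
  rw [edge, closure_openSegment, insert_endpoints_openSegment]

theorem disjoint_face_edge (F : Fin M.nF) (E : Fin M.nE) : Disjoint (M.face F) (M.edge E) :=
  M.entities_disjoint (i := Sum.inr (Sum.inl F)) (j := Sum.inr (Sum.inr (Sum.inl E))) (by simp)

theorem vert_notMem_face (F : Fin M.nF) (V : Fin M.nV) : M.vert V ∉ M.face F := by
  have := M.entities_disjoint (i := Sum.inr (Sum.inl F)) (j := Sum.inr (Sum.inr (Sum.inr V)))
    (by simp)
  simpa [Function.onFun] using this

theorem vert_notMem_edge (E : Fin M.nE) (V : Fin M.nV) : M.vert V ∉ M.edge E := by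
  have := M.entities_disjoint (i := Sum.inr (Sum.inr (Sum.inl E)))
    (j := Sum.inr (Sum.inr (Sum.inr V))) (by simp)
  exact fun h => Set.disjoint_left.1 this h rfl

theorem eq_of_mem_edge {E E' : Fin M.nE} {x : E3} (hx : x ∈ M.edge E) (hx' : x ∈ M.edge E') :
    E = E' := by
  by_contra hne
  have := M.entities_disjoint (i := Sum.inr (Sum.inr (Sum.inl E)))
    (j := Sum.inr (Sum.inr (Sum.inl E'))) (by simpa using hne)
  exact Set.disjoint_left.1 this hx hx'

theorem eq_of_mem_face {F F' : Fin M.nF} {x : E3} (hx : x ∈ M.face F) (hx' : x ∈ M.face F') :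
    F = F' := by
  by_contra hne
  have := M.entities_disjoint (i := Sum.inr (Sum.inl F)) (j := Sum.inr (Sum.inl F'))
    (by simpa using hne)
  exact Set.disjoint_left.1 this hx hx'

theorem eq_of_mem_closure_edge {E E' : Fin M.nE} {x : E3} (hx : x ∈ M.edge E)
    (hx' : x ∈ closure (M.edge E')) : E' = E := by
  rw [closure_edge] at hx'
  rcases hx' with rfl | rfl | hx'
  · exact absurd hx (vert_notMem_edge _ _)
  · exact absurd hx (vert_notMem_edge _ _)
  · exact eq_of_mem_edge hx' hx

theorem exists_edge_of_mem_closure_face {F : Fin M.nF} {x : E3} (hx : x ∈ closure (M.face F))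
    (hx' : x ∉ M.face F) : ∃ E ∈ M.edgesF F, x ∈ closure (M.edge E) := by
  have : x ∈ closure (M.face F) \ M.face F := ⟨hx, hx'⟩
  rw [M.face_boundary F] at this
  simp only [Set.mem_iUnion] at this
  obtain ⟨E, hE, h⟩ := this
  exact ⟨E, mem_edgesF.2 hE, h⟩

/-- Mesh conformity: a boundary point of a face lies on one of its closed edges, and by disjointness
an open edge meets no closed edge but its own. A face touching an open edge in one point therefore
has the whole edge on its boundary. -/
theorem mem_edgesF_of_mem_closure_face {F : Fin M.nF} {E : Fin M.nE} {x : E3} (hx : x ∈ M.edge E)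
    (hx' : x ∈ closure (M.face F)) : E ∈ M.edgesF F := by
  obtain ⟨E', hE', h⟩ := exists_edge_of_mem_closure_face hx'
    fun h => Set.disjoint_left.1 (disjoint_face_edge F E) h hx
  rwa [eq_of_mem_closure_edge hx h] at hE'

/-- Taking the closure of a face adds only points of edges and vertices, and these are disjoint from
every face. -/
theorem eq_of_mem_closure_face {F F' : Fin M.nF} {x : E3} (hx : x ∈ M.face F)
    (hx' : x ∈ closure (M.face F')) : F' = F := by
  by_contra hne
  obtain ⟨E, -, h⟩ := exists_edge_of_mem_closure_face hx' fun h => hne (eq_of_mem_face h hx)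
  rw [closure_edge] at h
  rcases h with rfl | rfl | h
  · exact vert_notMem_face _ _ hx
  · exact vert_notMem_face _ _ hx
  · exact Set.disjoint_left.1 (disjoint_face_edge F E) hx h

theorem exists_face_of_mem_frontier {T : Fin M.nT} {x : E3} (hx : x ∈ frontier (M.cell T)) :
    ∃ F ∈ M.facesT T, x ∈ closure (M.face F) := by
  rw [M.cell_boundary T] at hx
  simp only [Set.mem_iUnion] at hx
  obtain ⟨F, hF, h⟩ := hx
  exact ⟨F, mem_facesT.2 hF, h⟩

theorem oTF_eq (T : Fin M.nT) (F : Fin M.nF) : M.oTF T F = 1 ∨ M.oTF T F = -1 := by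
  unfold oTF
  split_ifs <;> simp

theorem oFE_eq (F : Fin M.nF) (E : Fin M.nE) : M.oFE F E = 1 ∨ M.oFE F E = -1 := by
  unfold oFE
  split_ifs <;> simp

theorem pointsOut_cell {T : Fin M.nT} {F : Fin M.nF} (hF : F ∈ M.facesT T) {x : E3}
    (hx : x ∈ M.face F) : PointsOut (M.cell T) x (M.oTF T F • M.normal F) := by
  unfold oTF
  split_ifs with h
  · simpa using h x hx
  · rcases M.cell_one_sided T F (mem_facesT.1 hF) with h' | h'
    · exact absurd h' h
    · simpa using h' x hx

/-- The mesh axiom uses the unnormalised edge vector whereas `oFE` uses the unit tangent; a positive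
rescaling reconciles them. -/
theorem pointsOut_face {F : Fin M.nF} {E : Fin M.nE} (hE : E ∈ M.edgesF F) {x : E3}
    (hx : x ∈ M.edge E) : PointsOut (M.face F) x (M.oFE F E • M.normalFE F E) := by
  have hpos : 0 < ‖M.vert (M.tgt E) - M.vert (M.src E)‖⁻¹ :=
    inv_pos.2 (norm_pos_iff.2 (M.edgeVec_ne_zero E))
  have heq : M.normalFE F E = ‖M.vert (M.tgt E) - M.vert (M.src E)‖⁻¹ •
      cross (M.normal F) (M.vert (M.tgt E) - M.vert (M.src E)) := by
    rw [normalFE, tangent, cross_smul_right]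
  unfold oFE
  split_ifs with h
  · simpa using h x hx
  · rcases M.face_one_sided F E (mem_edgesF.1 hE) with h' | h'
    · refine absurd (fun y hy => ?_) h
      rw [heq]
      exact (h' y hy).smul hpos
    · rw [heq, neg_one_smul, ← smul_neg]
      exact (h' x hx).smul hpos

theorem norm_tangent (E : Fin M.nE) : ‖M.tangent E‖ = 1 := by
  rw [tangent, norm_smul, norm_inv, norm_norm]
  exact inv_mul_cancel₀ (norm_ne_zero_iff.2 (M.edgeVec_ne_zero E))

theorem inner_normal_tangent {F : Fin M.nF} {E : Fin M.nE} (hE : E ∈ M.edgesF F) :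
    inner ℝ (M.normal F) (M.tangent E) = 0 := by
  have hsub : closure (M.edge E) ⊆ planeAt (M.facePt F) (M.normal F) :=
    (closure_minimal ((mem_edgesF.1 hE).trans Set.sdiff_subset) isClosed_closure).trans
      (M.closure_face_subset_plane F)
  have h1 := hsub (show M.vert (M.src E) ∈ _ by rw [closure_edge]; simp)
  have h2 := hsub (show M.vert (M.tgt E) ∈ _ by rw [closure_edge]; simp)
  rw [mem_planeAt_iff] at h1 h2
  have h3 := Submodule.smul_mem _ ‖M.vert (M.tgt E) - M.vert (M.src E)‖⁻¹ (sub_mem h2 h1)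
  rw [sub_sub_sub_cancel_right, Submodule.mem_orthogonal_singleton_iff_inner_right] at h3
  exact h3

/-- Close to a point of a face, an element is one of the two sides of the face. -/
theorem exists_ball_sides {T : Fin M.nT} {F : Fin M.nF} (hF : F ∈ M.facesT T) {p : E3}
    (hp : p ∈ M.face F) : ∃ δ > 0, ∀ x ∈ Metric.ball p δ,
      (M.oTF T F * inner ℝ (x - p) (M.normal F) < 0 → x ∈ M.cell T) ∧
      (0 < M.oTF T F * inner ℝ (x - p) (M.normal F) → x ∉ M.cell T) := by
  set n := M.oTF T F • M.normal F with hn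
  have hin : ∀ x : E3, M.oTF T F * inner ℝ (x - p) (M.normal F) = inner ℝ (x - p) n := by
    intro x
    rw [hn, inner_smul_right]
  have hnn : (inner ℝ n n : ℝ) = 1 := by
    rw [hn, inner_smul_left, inner_smul_right, real_inner_self_eq_norm_sq, M.normal_unit]
    rcases oTF_eq T F with h | h <;> simp [h]
  -- The closures of the other faces form a closed set that misses `p`. In a ball avoiding it, the
  -- frontier of the element lies in the plane of `F`.
  have hC : IsClosed (⋃ F' ∈ {F' | F' ≠ F}, closure (M.face F')) :=
    Set.Finite.isClosed_biUnion (Set.toFinite _) fun _ _ => isClosed_closure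
  have hpC : p ∈ (⋃ F' ∈ {F' | F' ≠ F}, closure (M.face F'))ᶜ := by
    simp only [Set.mem_compl_iff, Set.mem_iUnion, not_exists]
    exact fun F' hF' h => hF' (eq_of_mem_closure_face hp h)
  obtain ⟨δ, hδ, hball⟩ := Metric.isOpen_iff.1 hC.isOpen_compl p hpC
  have hpl : ∀ x ∈ frontier (M.cell T), x ∈ Metric.ball p δ → inner ℝ (x - p) n = 0 := by
    intro x hx hxb
    obtain ⟨F', -, hxF'⟩ := exists_face_of_mem_frontier hx
    have : F' = F := by
      by_contra hne
      exact hball hxb (Set.mem_biUnion (show F' ∈ {F' | F' ≠ F} from hne) hxF')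
    subst this
    have h1 := M.closure_face_subset_plane _ hxF'
    have h2 := M.face_subset_plane _ hp
    rw [mem_planeAt_iff] at h1 h2
    have h3 := sub_mem h1 h2
    rw [sub_sub_sub_cancel_right, Submodule.mem_orthogonal_singleton_iff_inner_left] at h3
    rw [hn, inner_smul_right, h3, mul_zero]
  -- A convex set that misses the frontier is connected, hence entirely inside or entirely outside
  -- the element. This applies to both open half balls.
  have hside : ∀ H : Set E3, Convex ℝ H → (∀ x ∈ H, x ∉ frontier (M.cell T)) → ∀ x ∈ H, ∀ y ∈ H,
      x ∈ M.cell T → y ∈ M.cell T := by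
    intro H hH hfr x hx y hy hxT
    have hcl := hH.isPreconnected.subset_left_of_subset_union (M.cell_open T)
      (isClosed_closure (s := M.cell T)).isOpen_compl
      (Set.disjoint_left.2 fun z hz hz' => hz' (subset_closure hz)) ?_ ⟨x, hx, hxT⟩
    · exact hcl hy
    · intro z hz
      by_cases hzT : z ∈ M.cell T
      · exact Or.inl hzT
      · refine Or.inr fun hz' => hfr z hz ?_
        rw [(M.cell_open T).frontier_eq]
        exact ⟨hz', hzT⟩
  have hcvx : ∀ c : ℝ, Convex ℝ (Metric.ball p δ ∩ {x | 0 < c * inner ℝ (x - p) n}) := by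
    intro c
    refine (convex_ball p δ).inter ?_
    have : {x : E3 | 0 < c * inner ℝ (x - p) n} =
        {x | c * inner ℝ n p < (c • (innerSL ℝ n : E3 →L[ℝ] ℝ)) x} := by
      ext x
      simp [real_inner_comm n, inner_sub_right, mul_sub]
    rw [this]
    exact convex_halfSpace_gt (LinearMap.isLinear (c • (innerSL ℝ n : E3 →L[ℝ] ℝ)).toLinearMap) _
  have hfr : ∀ c : ℝ, ∀ x ∈ Metric.ball p δ ∩ {x | 0 < c * inner ℝ (x - p) n},
      x ∉ frontier (M.cell T) := by
    rintro c x ⟨hx, hx'⟩ hxf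
    simp [hpl x hxf hx] at hx'
  obtain ⟨ε, hε, hout⟩ := pointsOut_cell hF hp
  obtain ⟨s, hs0, hs⟩ : ∃ s : ℝ, 0 < s ∧ s < min ε δ := exists_between (lt_min hε hδ)
  have hnorm : ‖n‖ = 1 := by
    rw [real_inner_self_eq_norm_sq] at hnn
    exact (sq_eq_sq₀ (norm_nonneg n) zero_le_one).1 (by rw [hnn, one_pow])
  have hs' := hout s ⟨hs0, hs.trans_le (min_le_left _ _)⟩
  have hsδ : s < δ := hs.trans_le (min_le_right _ _)
  -- The points `p - s n` and `p + s n` supplied by `PointsOut` decide which half ball is inside.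
  have hm : p - s • n ∈ Metric.ball p δ ∩ {x | 0 < (-1 : ℝ) * inner ℝ (x - p) n} := by
    refine ⟨by simpa [norm_smul, hnorm, abs_of_pos hs0] using hsδ, ?_⟩
    simp [inner_smul_left, hs0, hnorm]
  have hm' : p + s • n ∈ Metric.ball p δ ∩ {x | 0 < (1 : ℝ) * inner ℝ (x - p) n} := by
    refine ⟨by simpa [norm_smul, hnorm, abs_of_pos hs0] using hsδ, ?_⟩
    simp [inner_smul_left, hs0, hnorm]
  refine ⟨δ, hδ, fun x hx => ⟨fun h => ?_, fun h hxT => ?_⟩⟩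
  · rw [hin] at h
    exact hside _ (hcvx (-1)) (hfr (-1)) _ hm x ⟨hx, by simpa using h⟩ hs'.1
  · rw [hin] at h
    exact hs'.2 (hside _ (hcvx 1) (hfr 1) x ⟨hx, by simpa using h⟩ _ hm' hxT)

end PolyMesh

/-! ### Circulation around an edge -/

namespace PolyMesh

variable {M : PolyMesh}

/-- The unit vector orthogonal to an edge, in the plane of a face, that points into the face. -/
def inward (M : PolyMesh) (F : Fin M.nF) (E : Fin M.nE) : E3 := -(M.oFE F E • M.normalFE F E)

theorem oFE_mul_self (F : Fin M.nF) (E : Fin M.nE) : M.oFE F E * M.oFE F E = 1 := by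
  rcases oFE_eq F E with h | h <;> simp [h]

theorem norm_inward {F : Fin M.nF} {E : Fin M.nE} (hE : E ∈ M.edgesF F) :
    ‖M.inward F E‖ = 1 := by
  rw [inward, norm_neg, norm_smul, normalFE, norm_cross_eq_one (M.normal_unit F)
    (norm_tangent E) (inner_normal_tangent hE)]
  rcases oFE_eq F E with h | h <;> simp [h]

theorem inner_tangent_inward (F : Fin M.nF) (E : Fin M.nE) :
    inner ℝ (M.tangent E) (M.inward F E) = 0 := by
  rw [inward, inner_neg_right, inner_smul_right, normalFE, inner_self_cross', mul_zero, neg_zero]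

/-- In the frame of the tangent and the inward direction, the sign `oFE` records the direction of
rotation about the edge in which the normal of the face points. -/
theorem normal_eq_cross_inward {F : Fin M.nF} {E : Fin M.nE} (hE : E ∈ M.edgesF F) :
    M.normal F = -(M.oFE F E • cross (M.tangent E) (M.inward F E)) := by
  have h : M.inward F E = (-M.oFE F E) • M.normalFE F E := by rw [inward, neg_smul]
  rw [h, cross_smul_right, normalFE, cross_cross_right,
    real_inner_comm (M.normal F), inner_normal_tangent hE, real_inner_self_eq_norm_sq,
    norm_tangent, smul_smul, mul_neg, oFE_mul_self]
  simp

open Filter Topology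

theorem eventually_mem_face {F : Fin M.nF} {E : Fin M.nE} (hE : E ∈ M.edgesF F) {x : E3}
    (hx : x ∈ M.edge E) : ∀ᶠ s : ℝ in 𝓝[>] 0,
      x + s • M.inward F E ∈ M.face F ∧ x - s • M.inward F E ∉ M.face F := by
  obtain ⟨ε, hε, h⟩ := pointsOut_face hE hx
  filter_upwards [Ioo_mem_nhdsGT hε] with s hs
  have := h s hs
  rw [inward, smul_neg, sub_neg_eq_add, ← sub_eq_add_neg]
  exact this

/-- Two faces with the same inward direction at a point of the edge would share the points of a
short segment, while distinct faces are disjoint. Faces around an edge are thus separated by their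
angles. -/
theorem inward_injOn {F F' : Fin M.nF} {E : Fin M.nE} (hE : E ∈ M.edgesF F)
    (hE' : E ∈ M.edgesF F') (h : M.inward F E = M.inward F' E) {x : E3} (hx : x ∈ M.edge E) :
    F = F' := by
  obtain ⟨s, hs, hs'⟩ := ((eventually_mem_face hE hx).and (eventually_mem_face hE' hx)).exists
  rw [← h] at hs'
  exact eq_of_mem_face hs.1 hs'.1

theorem exists_mem_edge (E : Fin M.nE) : ∃ x, x ∈ M.edge E :=
  ⟨_, 2⁻¹, 2⁻¹, by norm_num, by norm_num, by norm_num, rfl⟩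

theorem inner_tangent_of_mem_closure_edge {E : Fin M.nE} {x y : E3} (hx : x ∈ closure (M.edge E))
    (hy : y ∈ closure (M.edge E)) : ∃ c : ℝ, y - x = c • M.tangent E := by
  have key : ∀ z ∈ closure (M.edge E), ∃ c : ℝ, z - M.vert (M.src E) = c • M.tangent E := by
    intro z hz
    rw [edge, closure_openSegment, segment_eq_image'] at hz
    obtain ⟨θ, -, rfl⟩ := hz
    refine ⟨θ * ‖M.vert (M.tgt E) - M.vert (M.src E)‖, ?_⟩
    rw [tangent, smul_smul, mul_assoc, mul_inv_cancel₀
      (norm_ne_zero_iff.2 (M.edgeVec_ne_zero E))]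
    simp
  obtain ⟨c, hc⟩ := key x hx
  obtain ⟨c', hc'⟩ := key y hy
  exact ⟨c' - c, by rw [sub_smul, ← hc, ← hc']; abel⟩

/-- The boundary of the boundary of an element is zero. -/
theorem sum_oTF_mul_oFE (T : Fin M.nT) (E : Fin M.nE) :
    ∑ F ∈ (M.facesT T).filter (fun F => E ∈ M.edgesF F), M.oTF T F * M.oFE F E = 0 := by
  classical
  set S := (M.facesT T).filter (fun F => E ∈ M.edgesF F) with hS
  have hST : ∀ F ∈ S, F ∈ M.facesT T := fun F hF => (Finset.mem_filter.1 hF).1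
  have hSE : ∀ F ∈ S, E ∈ M.edgesF F := fun F hF => (Finset.mem_filter.1 hF).2
  rcases S.eq_empty_or_nonempty with hS0 | ⟨F₀, hF₀⟩
  · rw [hS0, Finset.sum_empty]
  -- A point is moved once around the edge on a small circle orthogonal to it, and the indicator
  -- function of the element is followed. It jumps only where the circle crosses a face of `S`, by
  -- `oTF * oFE`, and the circle is closed, so the jumps add up to zero. Here `u`, `v` span the
  -- plane of the circle, with `u` pointing into one of the faces.
  set t := M.tangent E
  have ht : ‖t‖ = 1 := norm_tangent E
  set u := M.inward F₀ E
  have hu : ‖u‖ = 1 := norm_inward (hSE F₀ hF₀)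
  have htu : inner ℝ t u = 0 := inner_tangent_inward F₀ E
  set v := cross t u with hv
  have hvn : ‖v‖ = 1 := norm_cross_eq_one ht hu htu
  have htv : inner ℝ t v = 0 := inner_self_cross t u
  have huv : inner ℝ u v = 0 := inner_self_cross' t u
  have hctv : cross t v = -u := by
    rw [hv, cross_cross_right, htu, real_inner_self_eq_norm_sq, ht]
    simp
  let e : ℝ → E3 := fun θ => Real.cos θ • u + Real.sin θ • v
  have he_inner : ∀ θ x y, inner ℝ (e θ) (x • u + y • v) = Real.cos θ * x + Real.sin θ * y := by
    intro θ x y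
    simp only [e, inner_add_left, inner_add_right, inner_smul_left, inner_smul_right, huv,
      real_inner_comm u v ▸ huv, real_inner_self_eq_norm_sq, hu, hvn]
    simp
    ring
  have he_norm : ∀ θ, ‖e θ‖ = 1 := by
    intro θ
    rw [← sq_eq_sq₀ (norm_nonneg _) zero_le_one, ← real_inner_self_eq_norm_sq]
    rw [he_inner]
    nlinarith [Real.sin_sq_add_cos_sq θ]
  have het : ∀ θ, inner ℝ t (e θ) = 0 := by
    intro θ
    simp [e, inner_add_right, inner_smul_right, htu, htv]
  have hang : ∀ F ∈ S, ∃ α ∈ Set.Ioc (-Real.pi) Real.pi, M.inward F E = e α := by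
    intro F hF
    have hd := eq_of_orthonormal_frame ht hu htu (inner_tangent_inward F E)
    have hn : ‖M.inward F E‖ ^ 2 = 1 := by rw [norm_inward (hSE F hF), one_pow]
    rw [hd, ← real_inner_self_eq_norm_sq] at hn
    simp only [inner_add_left, inner_add_right, inner_smul_left, inner_smul_right,
      real_inner_self_eq_norm_sq] at hn
    rw [hu, ← hv, hvn, huv, real_inner_comm u v, huv] at hn
    simp only [RCLike.conj_to_real] at hn
    obtain ⟨α, hα, hc, hs⟩ := exists_angle (x := inner ℝ u (M.inward F E))
      (y := inner ℝ v (M.inward F E)) (by linarith)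
    exact ⟨α, hα, by rw [hd]; simp only [e, hc, hs]; rfl⟩
  choose! α hα hαe using hang
  obtain ⟨x₀, hx₀⟩ := exists_mem_edge (M := M) E
  have hinj : Set.InjOn α S := by
    intro F hF F' hF' h
    exact inward_injOn (hSE F hF) (hSE F' hF') (by rw [hαe F hF, hαe F' hF', h]) hx₀
  -- The starting angle is slightly larger than `-π`, so that every crossing lies strictly inside
  -- one period and none sits at its ends.
  obtain ⟨a, ha1, ha2⟩ : ∃ a : ℝ, -Real.pi < a ∧ ∀ F ∈ S, a < α F := by
    have h : ∀ᶠ a : ℝ in 𝓝[>] (-Real.pi), ∀ F ∈ S, a < α F :=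
      (Finset.eventually_all S).2 fun F hF =>
        mem_nhdsWithin_of_mem_nhds (Iio_mem_nhds (hα F hF).1)
    obtain ⟨a, ha, ha'⟩ := (h.and self_mem_nhdsWithin).exists
    exact ⟨a, ha', ha⟩
  have hαI : ∀ F ∈ S, α F ∈ Set.Ioo a (a + 2 * Real.pi) := fun F hF =>
    ⟨ha2 F hF, by linarith [(hα F hF).2]⟩
  -- The radius is small enough for the circle to meet only closed faces and closed edges that
  -- contain `x₀`, and for each face of `S` to contain its own crossing point but not the opposite
  -- point.
  obtain ⟨ρ, hρ, hρF, hρE, hρS⟩ : ∃ ρ : ℝ, 0 < ρ ∧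
      (∀ F : Fin M.nF, x₀ ∉ closure (M.face F) → ∀ x, dist x x₀ = ρ → x ∉ closure (M.face F)) ∧
      (∀ E' : Fin M.nE, x₀ ∉ closure (M.edge E') → ∀ x, dist x x₀ = ρ →
        x ∉ closure (M.edge E')) ∧
      ∀ F ∈ S, x₀ + ρ • M.inward F E ∈ M.face F ∧ x₀ - ρ • M.inward F E ∉ M.face F := by
    have hcl : ∀ K : Set E3, IsClosed K → ∀ᶠ ρ : ℝ in 𝓝[>] 0, x₀ ∉ K →
        ∀ x, dist x x₀ = ρ → x ∉ K := by
      intro K hK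
      by_cases hxK : x₀ ∈ K
      · exact Eventually.of_forall fun _ h => absurd hxK h
      · obtain ⟨ε, hε, hb⟩ := Metric.isOpen_iff.1 hK.isOpen_compl x₀ hxK
        filter_upwards [Ioo_mem_nhdsGT hε] with s hs _ x hx
        exact hb (by rw [Metric.mem_ball, hx]; exact hs.2)
    have h1 := eventually_all.2 fun F : Fin M.nF => hcl (closure (M.face F)) isClosed_closure
    have h2 := eventually_all.2 fun E' : Fin M.nE => hcl (closure (M.edge E')) isClosed_closure
    have h3 := (Finset.eventually_all S).2 fun F hF => eventually_mem_face (hSE F hF) hx₀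
    obtain ⟨ρ, ⟨⟨h1, h2⟩, h3⟩, h4⟩ := (((h1.and h2).and h3).and self_mem_nhdsWithin).exists
    exact ⟨ρ, h4, h1, h2, h3⟩
  let c : ℝ → E3 := fun θ => x₀ + ρ • e θ
  have hc : Continuous c := by
    simp only [c, e]
    fun_prop
  have hdist : ∀ θ, dist (c θ) x₀ = ρ := by
    intro θ
    simp [c, norm_smul, he_norm, abs_of_pos hρ]
  -- A frontier point of the circle lies on a closed face `F` through `x₀`, which belongs to `S`.
  -- Being in the plane of `F`, it is at the angle `α F` or at the opposite one.
  have hfr : ∀ θ ∈ Set.Icc a (a + 2 * Real.pi), (∀ F ∈ S, θ ≠ α F) →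
      c θ ∉ frontier (M.cell T) := by
    intro θ hθ hθS hfr
    obtain ⟨F, hFT, hcF⟩ := exists_face_of_mem_frontier hfr
    have hxF : x₀ ∈ closure (M.face F) := by
      by_contra hx
      exact hρF F hx _ (hdist θ) hcF
    have hEF := mem_edgesF_of_mem_closure_face hx₀ hxF
    have hFS : F ∈ S := Finset.mem_filter.2 ⟨hFT, hEF⟩
    have hen : inner ℝ (e θ) (M.normal F) = 0 := by
      have h1 := M.closure_face_subset_plane _ hcF
      have h2 := M.closure_face_subset_plane _ hxF
      rw [mem_planeAt_iff] at h1 h2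
      have h3 := sub_mem h1 h2
      rw [sub_sub_sub_cancel_right, Submodule.mem_orthogonal_singleton_iff_inner_left] at h3
      simp only [c, add_sub_cancel_left, inner_smul_left] at h3
      exact (mul_eq_zero.1 h3).resolve_left hρ.ne'
    rw [normal_eq_cross_inward hEF, hαe F hFS, inner_neg_right, inner_smul_right, neg_eq_zero]
      at hen
    have hen := (mul_eq_zero.1 hen).resolve_left fun h => by
      have := oFE_mul_self F E
      simp [h] at this
    have hct : cross t (e (α F)) = (-Real.sin (α F)) • u + Real.cos (α F) • v := by
      simp only [e]
      rw [cross_add_right, cross_smul_right, cross_smul_right, hctv, ← hv]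
      module
    rw [hct, he_inner] at hen
    have hsin : Real.sin (θ - α F) = 0 := by
      rw [Real.sin_sub]
      linarith
    have hαF := hαI F hFS
    rcases Real.sin_eq_zero_iff_cos_eq.1 hsin with h1 | h1
    · rw [Real.cos_eq_one_iff_of_lt_of_lt (by linarith [hθ.1, hαF.2]) (by linarith [hθ.2, hαF.1])]
        at h1
      exact hθS F hFS (sub_eq_zero.1 h1)
    -- The opposite point is not in `F`, so it would be on a closed edge of `F`. By the choice of
    -- the radius that edge contains `x₀`, hence is `E`; but a point at distance `ρ > 0` from `x₀`
    -- orthogonally to `E` is not on `E`.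
    · have h2 : e θ = -M.inward F E := by
        rw [hαe F hFS, show θ = (θ - α F) + α F by ring]
        simp only [e]
        rw [Real.cos_add, Real.sin_add, h1, hsin]
        module
      have hcF' : c θ ∉ M.face F := by
        have : c θ = x₀ - ρ • M.inward F E := by simp only [c, h2]; module
        rw [this]
        exact (hρS F hFS).2
      obtain ⟨E', hE', hcE'⟩ := exists_edge_of_mem_closure_face hcF hcF'
      have hxE' : x₀ ∈ closure (M.edge E') := by
        by_contra hx
        exact hρE E' hx _ (hdist θ) hcE'
      obtain rfl := eq_of_mem_closure_edge hx₀ hxE'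
      obtain ⟨b, hb⟩ := inner_tangent_of_mem_closure_edge hxE' hcE'
      have h3 : inner ℝ t (c θ - x₀) = 0 := by
        simp [c, inner_smul_right, het]
      rw [hb, inner_smul_right, real_inner_self_eq_norm_sq, ht] at h3
      have h4 := hdist θ
      rw [dist_eq_norm, hb] at h4
      have : b = 0 := by linarith
      rw [this, zero_smul, norm_zero] at h4
      exact hρ.ne h4
  let f : ℝ → ℝ := fun θ => if c θ ∈ M.cell T then 1 else 0
  have hfin : ∀ θ, c θ ∈ M.cell T → f θ = 1 := fun θ h => if_pos h
  have hfout : ∀ θ, c θ ∉ M.cell T → f θ = 0 := fun θ h => if_neg h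
  have hper : f (a + 2 * Real.pi) - f a = 0 := by
    simp [f, c, e]
  rw [← hper]
  refine (sub_eq_sum_jumps S (by linarith [Real.pi_pos]) α _ hαI hinj f ?_ ?_).symm
  · intro θ hθ hθS
    by_cases hin : c θ ∈ M.cell T
    · filter_upwards [hc.continuousAt ((M.cell_open T).mem_nhds hin)] with y hy
      rw [hfin y hy, hfin θ hin]
    · have hcl : c θ ∈ (closure (M.cell T))ᶜ := fun h => hfr θ hθ hθS (by
        rw [(M.cell_open T).frontier_eq]
        exact ⟨h, hin⟩)
      filter_upwards [hc.continuousAt (isClosed_closure.isOpen_compl.mem_nhds hcl)] with y hy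
      rw [hfout y fun h => hy (subset_closure h), hfout θ hin]
  · intro F hF
    have hp : c (α F) ∈ M.face F := by
      simp only [c, ← hαe F hF]
      exact (hρS F hF).1
    obtain ⟨δ, hδ, hside⟩ := exists_ball_sides (hST F hF) hp
    have hnear : ∀ᶠ θ in 𝓝 (α F), c θ ∈ Metric.ball (c (α F)) δ :=
      hc.continuousAt (Metric.ball_mem_nhds _ hδ)
    have hct : cross t (e (α F)) = (-Real.sin (α F)) • u + Real.cos (α F) • v := by
      simp only [e]
      rw [cross_add_right, cross_smul_right, cross_smul_right, hctv, ← hv]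
      module
    have hval : ∀ θ, inner ℝ (c θ - c (α F)) (M.normal F) =
        -(M.oFE F E * ρ * Real.sin (θ - α F)) := by
      intro θ
      have : c θ - c (α F) = ρ • (e θ - e (α F)) := by simp only [c]; module
      rw [this, normal_eq_cross_inward (hSE F hF), hαe F hF, inner_neg_right, inner_smul_right,
        inner_smul_left, inner_sub_left, hct, he_inner, he_inner, Real.sin_sub]
      simp only [RCLike.conj_to_real]
      ring
    have hgt : ∀ᶠ θ in 𝓝[>] α F, 0 < Real.sin (θ - α F) := by
      filter_upwards [Ioo_mem_nhdsGT (show α F < α F + Real.pi by linarith [Real.pi_pos])]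
        with θ hθ
      exact Real.sin_pos_of_pos_of_lt_pi (by linarith [hθ.1]) (by linarith [hθ.2])
    have hlt : ∀ᶠ θ in 𝓝[<] α F, Real.sin (θ - α F) < 0 := by
      filter_upwards [Ioo_mem_nhdsLT (show α F - Real.pi < α F by linarith [Real.pi_pos])]
        with θ hθ
      exact Real.sin_neg_of_neg_of_neg_pi_lt (by linarith [hθ.2]) (by linarith [hθ.1])
    have hor : M.oTF T F * M.oFE F E = 1 ∨ M.oTF T F * M.oFE F E = -1 := by
      rcases oTF_eq T F with h | h <;> rcases oFE_eq F E with h' | h' <;> simp [h, h']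
    have hval' : ∀ θ, M.oTF T F * inner ℝ (c θ - c (α F)) (M.normal F) =
        -(M.oTF T F * M.oFE F E) * (ρ * Real.sin (θ - α F)) := by
      intro θ
      rw [hval]
      ring
    -- By `hval'` the signed distance to the outer side of the face is minus the product of the
    -- orientations times `ρ sin (θ - α F)`. With product `1` the circle enters the element as `θ`
    -- increases and the jump is `1`; with product `-1` it leaves and the jump is `-1`.
    rcases hor with h | h
    · refine ⟨0, ?_, ?_⟩
      · filter_upwards [hlt, mem_nhdsWithin_of_mem_nhds hnear] with θ hθ hθ'
        refine hfout θ ((hside _ hθ').2 ?_)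
        rw [hval', h]
        linarith [mul_neg_of_pos_of_neg hρ hθ]
      · filter_upwards [hgt, mem_nhdsWithin_of_mem_nhds hnear] with θ hθ hθ'
        rw [hfin θ ((hside _ hθ').1 ?_), h, zero_add]
        rw [hval', h]
        linarith [mul_pos hρ hθ]
    · refine ⟨1, ?_, ?_⟩
      · filter_upwards [hlt, mem_nhdsWithin_of_mem_nhds hnear] with θ hθ hθ'
        refine hfin θ ((hside _ hθ').1 ?_)
        rw [hval', h]
        linarith [mul_neg_of_pos_of_neg hρ hθ]
      · filter_upwards [hgt, mem_nhdsWithin_of_mem_nhds hnear] with θ hθ hθ'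
        rw [hfout θ ((hside _ hθ').2 ?_), h, add_neg_cancel]
        rw [hval', h]
        linarith [mul_pos hρ hθ]

theorem sum_oTF_mul_sum_oFE (T : Fin M.nT) (a : Fin M.nE → ℝ) :
    ∑ F ∈ M.facesT T, M.oTF T F * ∑ E ∈ M.edgesF F, M.oFE F E * a E = 0 := by
  classical
  have h : ∀ F, ∑ E ∈ M.edgesF F, M.oFE F E * a E =
      ∑ E, if E ∈ M.edgesF F then M.oFE F E * a E else 0 := fun F => by
    rw [Finset.sum_ite_mem, Finset.univ_inter]
  simp only [h, Finset.mul_sum]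
  rw [Finset.sum_comm]
  refine Finset.sum_eq_zero fun E _ => ?_
  have := sum_oTF_mul_oFE T E
  rw [Finset.sum_filter] at this
  have h2 := congrArg (· * a E) this
  simp only [Finset.sum_mul, zero_mul] at h2
  refine Eq.trans (Finset.sum_congr rfl fun F _ => ?_) h2
  split_ifs <;> ring

end PolyMesh

/-! ## Spaces of restricted polynomials -/

/-- Submodules of the space of locally bounded functions. -/
class LocBddSub {G : Type*} [NormedAddCommGroup G] [NormedSpace ℝ G]
    (V : Submodule ℝ (E3 → G)) : Prop where
  le : V ≤ LocBdd G

/-- The inclusion in the space of locally bounded functions. -/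
def toLB {G : Type*} [NormedAddCommGroup G] [NormedSpace ℝ G] {V : Submodule ℝ (E3 → G)}
    [LocBddSub V] : V →ₗ[ℝ] LocBdd G := Submodule.inclusion LocBddSub.le

theorem coe_toLB {G : Type*} [NormedAddCommGroup G] [NormedSpace ℝ G] {V : Submodule ℝ (E3 → G)}
    [LocBddSub V] (u : V) : (toLB u).1 = u.1 := rfl

theorem restrS_mem_locBdd (P : Set E3) (p : Poly3) : restrS P p ∈ LocBdd ℝ :=
  locBdd_indicator (locBdd_of_continuous (evalS_continuous p)) isClosed_closure

theorem restrV_mem_locBdd (P : Set E3) (w : VPoly3) : restrV P w ∈ LocBdd E3 :=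
  locBdd_indicator (locBdd_of_continuous (evalV_continuous w)) isClosed_closure

theorem locBddSub_map_restrV (P : Set E3) {X : Type*} [AddCommGroup X] [Module ℝ X]
    (f : X →ₗ[ℝ] VPoly3) (V : Submodule ℝ X) : LocBddSub (V.map (restrV P ∘ₗ f)) where
  le := by
    rintro _ ⟨x, -, rfl⟩
    exact restrV_mem_locBdd P (f x)

theorem finiteDimensional_map {X Y : Type*} [AddCommGroup X] [Module ℝ X] [AddCommGroup Y]
    [Module ℝ Y] (f : X →ₗ[ℝ] Y) (V : Submodule ℝ X) [FiniteDimensional ℝ V] :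
    FiniteDimensional ℝ (V.map f) := inferInstance

section Instances

variable (P : Set E3) (n : E3) (l : ℤ) (M : PolyMesh) (F : Fin M.nF) (T : Fin M.nT)

instance : LocBddSub (PolS P l) where
  le := by
    rintro _ ⟨p, -, rfl⟩
    exact restrS_mem_locBdd P p

instance : LocBddSub (PolV P l) where
  le := by
    rintro _ ⟨p, -, rfl⟩
    exact restrV_mem_locBdd P p

theorem PolTan_le : PolTan P n l ≤ PolV P l := fun _ hf => hf.1

instance : LocBddSub (PolTan P n l) where
  le := (PolTan_le P n l).trans LocBddSub.le

instance : LocBddSub (M.vPolF F l) := inferInstanceAs (LocBddSub (PolTan _ _ _))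

instance : LocBddSub (M.RF F l) := locBddSub_map_restrV _ _ _
instance : LocBddSub (M.RcF F l) := locBddSub_map_restrV _ _ _
instance : LocBddSub (M.RT T l) := locBddSub_map_restrV _ _ _
instance : LocBddSub (M.RcT T l) := locBddSub_map_restrV _ _ _
instance : LocBddSub (M.GT T l) := locBddSub_map_restrV _ _ _
instance : LocBddSub (M.GcT T l) := locBddSub_map_restrV _ _ _

instance : FiniteDimensional ℝ (PolS P l) :=
  inferInstanceAs (FiniteDimensional ℝ ((Pol l).map (restrS P)))

instance : FiniteDimensional ℝ (PolV P l) :=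
  inferInstanceAs (FiniteDimensional ℝ ((VPol l).map (restrV P)))

instance : FiniteDimensional ℝ (PolTan P n l) :=
  Submodule.finiteDimensional_of_le (PolTan_le P n l)

instance : FiniteDimensional ℝ (M.vPolF F l) :=
  inferInstanceAs (FiniteDimensional ℝ (PolTan _ _ _))

instance : FiniteDimensional ℝ (M.GT T l) := finiteDimensional_map _ _

instance : FiniteDimensional ℝ (M.GcT T l) := finiteDimensional_map _ _

end Instances

theorem restrS_eq_zero {P : Set E3} {p : Poly3} (h : ∀ x ∈ closure P, evalS p x = 0) :
    restrS P p = 0 := by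
  funext x
  by_cases hx : x ∈ closure P
  · simp [restrS, hx, h x hx]
  · simp [restrS, hx]

theorem restrV_eq_zero {P : Set E3} {w : VPoly3} (h : ∀ x ∈ closure P, evalV w x = 0) :
    restrV P w = 0 := by
  funext x
  by_cases hx : x ∈ closure P
  · simp [restrV, hx, h x hx]
  · simp [restrV, hx]

theorem restrV_congr {P : Set E3} {v w : VPoly3} (h : ∀ x ∈ closure P, evalV v x = evalV w x) :
    restrV P v = restrV P w :=
  Set.indicator_congr h

theorem restrS_apply {P : Set E3} (p : Poly3) {x : E3} (hx : x ∈ closure P) :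
    restrS P p x = evalS p x := Set.indicator_of_mem hx _

theorem restrV_apply {P : Set E3} (w : VPoly3) {x : E3} (hx : x ∈ closure P) :
    restrV P w x = evalV w x := Set.indicator_of_mem hx _

theorem ip_eq_zero_of_forall_closure {G : Type*} [NormedAddCommGroup G] [InnerProductSpace ℝ G]
    {M : PolyMesh} {F : Fin M.nF} {E : Fin M.nE} (hE : E ∈ M.edgesF F) (f : LocBdd G)
    {g : LocBdd G} (hg : ∀ x ∈ closure (M.face F), g.1 x = 0) : ip (M.mE E) f g = 0 :=
  ip_eq_zero_of_ae_right f (PolyMesh.ae_mE_of_mem_edgesF hE hg)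

/-! ## Projections -/

/-- Linearity needs nothing about `V`: a test function orthogonal to all of `V` is orthogonal to
itself, hence null, which is compatibility. The orthogonality relation needs in addition that only
`0` in `V` is null. -/
theorem exists_l2proj {G : Type*} [NormedAddCommGroup G] [InnerProductSpace ℝ G] (m : Measure E3)
    [BoundedSupport m] (V : Submodule ℝ (E3 → G)) [LocBddSub V] [FiniteDimensional ℝ V] :
    ∃ L : LocBdd G →ₗ[ℝ] V, (∀ f : LocBdd G, l2proj m V f.1 = L f) ∧
      ((∀ u : V, u.1 =ᵐ[m] 0 → u = 0) →
        ∀ f (w : V), ip m (toLB (L f)) (toLB w) = ip m f (toLB w)) := by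
  obtain ⟨L, hL, hL'⟩ := exists_linearMap_theUnique ((ip m).compl₁₂ (toLB (V := V)) toLB)
    ((ip m).compl₁₂ LinearMap.id (toLB (V := V)))
    (fun p hp f => ip_eq_zero_of_ae_right _ (ae_eq_zero_of_ip_self m _ (hp p)))
    (fun f u => ∀ w : V, ∫ x, inner ℝ ((u : E3 → G) x) ((w : E3 → G) x) ∂m =
      ∫ x, inner ℝ (f.1 x) ((w : E3 → G) x) ∂m)
    (fun _ _ => Iff.rfl)
  refine ⟨L, hL, fun h => hL' fun u hu => h u ?_⟩
  exact ae_eq_zero_of_ip_self m _ (hu u)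

/-- The `L²`-orthogonal projection as a linear map. -/
def l2projL {G : Type*} [NormedAddCommGroup G] [InnerProductSpace ℝ G] (m : Measure E3)
    [BoundedSupport m] (V : Submodule ℝ (E3 → G)) [LocBddSub V] [FiniteDimensional ℝ V] :
    LocBdd G →ₗ[ℝ] V :=
  (exists_l2proj m V).choose

theorem l2proj_eq {G : Type*} [NormedAddCommGroup G] [InnerProductSpace ℝ G] (m : Measure E3)
    [BoundedSupport m] (V : Submodule ℝ (E3 → G)) [LocBddSub V] [FiniteDimensional ℝ V]
    (f : LocBdd G) : l2proj m V f.1 = l2projL m V f :=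
  (exists_l2proj m V).choose_spec.1 f

theorem ip_l2projL {G : Type*} [NormedAddCommGroup G] [InnerProductSpace ℝ G] (m : Measure E3)
    [BoundedSupport m] (V : Submodule ℝ (E3 → G)) [LocBddSub V] [FiniteDimensional ℝ V]
    (h : ∀ u : V, u.1 =ᵐ[m] 0 → u = 0) (f : LocBdd G) (w : V) :
    ip m (toLB (l2projL m V f)) (toLB w) = ip m f (toLB w) :=
  (exists_l2proj m V).choose_spec.2 h f w

/-- The integral as a linear form. -/
def intL (m : Measure E3) [BoundedSupport m] : LocBdd ℝ →ₗ[ℝ] ℝ where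
  toFun f := ∫ x, f.1 x ∂m
  map_add' f g := integral_add (integrable_of_locBdd f.2 m) (integrable_of_locBdd g.2 m)
  map_smul' c _ := integral_const_mul c _

/-- The polynomials of `Pol l` with zero mean value. -/
def PolZero (m : Measure E3) [BoundedSupport m] (l : ℤ) : Submodule ℝ Poly3 :=
  Pol l ⊓ LinearMap.ker (intL m ∘ₗ evS)

theorem mem_PolZero {m : Measure E3} [BoundedSupport m] {l : ℤ} {r : Poly3} :
    r ∈ PolZero m l ↔ r ∈ Pol l ∧ ∫ x, evalS r x ∂m = 0 := Iff.rfl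

theorem exists_sub_C_mem_PolZero {m : Measure E3} [BoundedSupport m] (hm : m ≠ 0) {l : ℤ}
    (hl : 0 ≤ l) {r : Poly3} (hr : r ∈ Pol l) : ∃ a : ℝ, r - C a ∈ PolZero m l := by
  have h1 : m.real Set.univ ≠ 0 := by simp [Measure.real, ENNReal.toReal_eq_zero_iff, hm]
  refine ⟨(∫ x, evalS r x ∂m) / m.real Set.univ, mem_PolZero.2 ⟨sub_mem hr (C_mem_Pol hl _), ?_⟩⟩
  have h2 : ∀ x, evalS (r - C ((∫ x, evalS r x ∂m) / m.real Set.univ)) x =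
      evalS r x - (∫ x, evalS r x ∂m) / m.real Set.univ := fun x => by simp [evalS]
  simp only [h2]
  have h3 : Integrable (evalS r) m := integrable_of_locBdd (evS r).2 m
  rw [integral_sub h3 (integrable_const _), integral_const,
    smul_eq_mul, mul_div_cancel₀ _ h1, sub_self]

/-- Cross product with a constant field. -/
def crossConst (n : E3) : VPoly3 →ₗ[ℝ] VPoly3 where
  toFun w := w ⨯₃ constV n
  map_add' p q := by simp
  map_smul' a p := by
    ext1 i; fin_cases i <;> simp [crossProduct]

theorem evalV_crossConst (n : E3) (w : VPoly3) (x : E3) :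
    evalV (crossConst n w) x = cross (evalV w x) n := by
  ext i
  fin_cases i <;> simp [evalV, crossConst, cross, crossProduct, constV]

namespace Discretisation

variable {D : Discretisation}

/-! ### Components of discrete vectors -/

/-- Component `v_F`. -/
def curlCompF (F : Fin D.nF) : D.XCurl →ₗ[ℝ] D.RF F (D.k - 1) where
  toFun v := v.2.2.1 F
  map_add' _ _ := rfl
  map_smul' _ _ := rfl

/-- Component `v_E`. -/
def curlCompE (E : Fin D.nE) : D.XCurl →ₗ[ℝ] PolS (D.edge E) D.k where
  toFun v := v.2.2.2.2 E
  map_add' _ _ := rfl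
  map_smul' _ _ := rfl

/-- Component `v_T`. -/
def curlCompT (T : Fin D.nT) : D.XCurl →ₗ[ℝ] D.RT T (D.k - 1) where
  toFun v := v.1 T
  map_add' _ _ := rfl
  map_smul' _ _ := rfl

/-- Restriction to a face. -/
def curlOnF (F : Fin D.nF) : D.XCurl →ₗ[ℝ] D.XCurlF F where
  toFun v := XCurl.onF v F
  map_add' _ _ := rfl
  map_smul' _ _ := rfl

/-- Restriction to an element. -/
def curlOnT (T : Fin D.nT) : D.XCurl →ₗ[ℝ] D.XCurlT T where
  toFun v := XCurl.onT v T
  map_add' _ _ := rfl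
  map_smul' _ _ := rfl

/-- Component `w_T`. -/
def divCompT (T : Fin D.nT) : D.XDiv →ₗ[ℝ] D.GT T (D.k - 1) where
  toFun w := w.1 T
  map_add' _ _ := rfl
  map_smul' _ _ := rfl

/-- Component `w_T^c`. -/
def divCompTc (T : Fin D.nT) : D.XDiv →ₗ[ℝ] D.GcT T D.k where
  toFun w := w.2.1 T
  map_add' _ _ := rfl
  map_smul' _ _ := rfl

/-- Component `w_F`. -/
def divCompF (F : Fin D.nF) : D.XDiv →ₗ[ℝ] PolS (D.face F) D.k where
  toFun w := w.2.2 F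
  map_add' _ _ := rfl
  map_smul' _ _ := rfl

end Discretisation

namespace Serendipity

open Discretisation PolyMesh

variable {D : Discretisation} (S : Serendipity D)

/-! ## Reconstructions as linear maps -/

/-- Test polynomials have three variables, so some of them vanish on the face without being zero.
The relations are compatible because the right side sees only values on the closed face: a rot
involves tangential derivatives alone, and the edges are in the closure. -/
theorem exists_faceCurl (F : Fin D.nF) : ∃ L : D.XCurl →ₗ[ℝ] PolS (D.face F) D.k,
    (∀ v, faceCurl v F = L v) ∧ ∀ v, ∀ r ∈ Pol D.k,
      ip (D.mF F) (toLB (L v)) (evS r) =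
        ip (D.mF F) (toLB (v.2.2.1 F)) (evV (rotP (D.normal F) r))
        - ∑ E ∈ D.edgesF F, D.oFE F E * ip (D.mE E) (toLB (v.2.2.2.2 E)) (evS r) := by
  have hself : ∀ p : Poly3, ∀ hp : p ∈ Pol D.k,
      ip (D.mF F) (toLB (⟨restrS (D.face F) p, p, hp, rfl⟩ : PolS (D.face F) D.k)) (evS p) = 0 →
      ∀ x ∈ closure (D.face F), evalS p x = 0 := by
    intro p hp h
    refine eq_zero_of_ae_mF (evalS_continuous p) (ae_eq_zero_of_ip_self (D.mF F) (evS p) ?_)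
    rw [← h]
    exact ip_congr_ae (ae_mF fun x hx => (restrS_apply p hx).symm) Filter.EventuallyEq.rfl
  obtain ⟨L, hL, hL'⟩ := exists_linearMap_theUnique
    ((ip (D.mF F)).compl₁₂ (toLB (V := PolS (D.face F) D.k)) (evS ∘ₗ (Pol D.k).subtype))
    ((ip (D.mF F)).compl₁₂ (toLB ∘ₗ curlCompF F)
        (evV ∘ₗ rotP (D.normal F) ∘ₗ (Pol D.k).subtype)
      - ∑ E ∈ D.edgesF F, D.oFE F E • (ip (D.mE E)).compl₁₂ (toLB ∘ₗ curlCompE E)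
        (evS ∘ₗ (Pol D.k).subtype))
    (fun ⟨p, hp⟩ h v => by
      have h0 := hself p hp (h _)
      simp only [LinearMap.sub_apply, LinearMap.sum_apply, LinearMap.smul_apply,
        LinearMap.compl₁₂_apply, LinearMap.comp_apply, Submodule.subtype_apply]
      rw [ip_eq_zero_of_ae_right _ (ae_mF (rotP_eq_zero_of_const fun x hx =>
        h0 x (subset_closure hx))), zero_sub, neg_eq_zero]
      refine Finset.sum_eq_zero fun E hE => ?_
      rw [ip_eq_zero_of_forall_closure hE _ h0, smul_zero])
    (fun v u => ∀ r ∈ Pol D.k,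
      ∫ x, u.1 x * evalS r x ∂D.mF F =
      ∫ x, inner ℝ ((v.2.2.1 F).1 x) (evalV (rotP (D.normal F) r) x) ∂D.mF F
      - ∑ E ∈ D.edgesF F, D.oFE F E * ∫ x, (v.2.2.2.2 E).1 x * evalS r x ∂D.mE E)
    (fun v u => by
      rw [Subtype.forall]
      refine forall₂_congr fun r hr => ?_
      simp only [LinearMap.sub_apply, LinearMap.sum_apply, LinearMap.smul_apply, smul_eq_mul,
        LinearMap.compl₁₂_apply, LinearMap.comp_apply, Submodule.subtype_apply, ip_apply_real]
      rfl)
  refine ⟨L, hL, fun v r hr => ?_⟩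
  have h := hL' ?_ v ⟨r, hr⟩
  · simp only [LinearMap.sub_apply, LinearMap.sum_apply, LinearMap.smul_apply, smul_eq_mul,
      LinearMap.compl₁₂_apply, LinearMap.comp_apply, Submodule.subtype_apply] at h
    exact h
  · rintro ⟨_, p, hp, rfl⟩ hu
    exact Subtype.ext (restrS_eq_zero (hself p hp (hu ⟨p, hp⟩)))

/-- The face curl as a linear map. -/
def faceCurlL (F : Fin D.nF) : D.XCurl →ₗ[ℝ] PolS (D.face F) D.k := (exists_faceCurl F).choose

theorem faceCurl_eq (v : D.XCurl) (F : Fin D.nF) : faceCurl v F = faceCurlL F v :=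
  (exists_faceCurl F).choose_spec.1 v

theorem ip_faceCurlL (v : D.XCurl) (F : Fin D.nF) {r : Poly3} (hr : r ∈ Pol D.k) :
    ip (D.mF F) (toLB (faceCurlL F v)) (evS r) =
      ip (D.mF F) (toLB (v.2.2.1 F)) (evV (rotP (D.normal F) r))
      - ∑ E ∈ D.edgesF F, D.oFE F E * ip (D.mE E) (toLB (v.2.2.2.2 E)) (evS r) :=
  (exists_faceCurl F).choose_spec.2 v r hr

end Serendipity

/-! ### Nondegeneracy of integral products and tangential polynomial fields -/

namespace PolyMesh

variable {M : PolyMesh}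

theorem evalV_eq_zero_of_ip_mF {F : Fin M.nF} {w : VPoly3} {f g : LocBdd E3}
    (hf : ∀ x ∈ closure (M.face F), f.1 x = evalV w x)
    (hg : ∀ x ∈ closure (M.face F), g.1 x = evalV w x) (h : ip (M.mF F) f g = 0) :
    ∀ x ∈ closure (M.face F), evalV w x = 0 := by
  refine eq_zero_of_ae_mF (evalV_continuous w) (ae_eq_zero_of_ip_self (M.mF F) (evV w) ?_)
  rw [← h]
  exact ip_congr_ae (ae_mF fun x hx => (hf x hx).symm) (ae_mF fun x hx => (hg x hx).symm)

theorem eq_zero_of_ip_mT {T : Fin M.nT} {w : VPoly3} {f g : LocBdd E3}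
    (hf : ∀ x ∈ closure (M.cell T), f.1 x = evalV w x)
    (hg : ∀ x ∈ closure (M.cell T), g.1 x = evalV w x) (h : ip (M.mT T) f g = 0) : w = 0 := by
  have hz := eq_zero_of_ae_mT (evalV_continuous w) (ae_eq_zero_of_ip_self (M.mT T) (evV w) (by
    rw [← h]
    exact ip_congr_ae (ae_mT fun x hx => (hf x hx).symm) (ae_mT fun x hx => (hg x hx).symm)))
  exact eq_zero_of_evalV_eq_zero (M.cell_open T) ⟨_, M.cellPt_mem T⟩
    fun x hx => hz x (subset_closure hx)

theorem eq_zero_of_ip_mT_real {T : Fin M.nT} {p : Poly3} {f g : LocBdd ℝ}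
    (hf : ∀ x ∈ closure (M.cell T), f.1 x = evalS p x)
    (hg : ∀ x ∈ closure (M.cell T), g.1 x = evalS p x) (h : ip (M.mT T) f g = 0) : p = 0 := by
  have hz := eq_zero_of_ae_mT (evalS_continuous p) (ae_eq_zero_of_ip_self (M.mT T) (evS p) (by
    rw [← h]
    exact ip_congr_ae (ae_mT fun x hx => (hf x hx).symm) (ae_mT fun x hx => (hg x hx).symm)))
  exact eq_zero_of_evalS_eq_zero (M.cell_open T) ⟨_, M.cellPt_mem T⟩
    fun x hx => hz x (subset_closure hx)

theorem eq_zero_of_ae_mT_PolV {T : Fin M.nT} {l : ℤ} {f : E3 → E3} (hf : f ∈ PolV (M.cell T) l)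
    (h : f =ᵐ[M.mT T] 0) : f = 0 := by
  obtain ⟨w, -, rfl⟩ := hf
  refine restrV_eq_zero (eq_zero_of_ae_mT (evalV_continuous w) ?_)
  filter_upwards [h, ae_mT fun x hx => restrV_apply w hx] with x hx hx'
  rw [← hx', hx]

theorem GT_le (T : Fin M.nT) (l : ℤ) : M.GT T l ≤ PolV (M.cell T) l := by
  rintro _ ⟨p, hp, rfl⟩
  exact ⟨gradP p, by simpa using gradP_mem_VPol hp, rfl⟩

theorem GcT_le (T : Fin M.nT) (l : ℤ) : M.GcT T l ≤ PolV (M.cell T) l := by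
  rintro _ ⟨p, hp, rfl⟩
  exact ⟨crossPos (M.cellPt T) p, by simpa using crossPos_mem_VPol _ hp, rfl⟩

theorem evalV_rotP_inner (n : E3) (r : Poly3) (x : E3) :
    inner ℝ (evalV (rotP n r) x) n = 0 := by
  have h : evalV (rotP n r) x = cross (evalV (gradP r) x) n := evalV_crossConst n (gradP r) x
  rw [h, real_inner_comm, inner_self_cross']

theorem evalV_mulPos (c : E3) (p : Poly3) (x : E3) :
    evalV (mulPos c p) x = evalS p x • (x - c) := by
  ext i
  simp [evalV, evalS, mulPos, posV]

/-- The tangential fields of a face that are sums of vector curls and of multiples of `x - x_F`. -/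
theorem restrV_rotP_add_mulPos_mem (F : Fin M.nF) {l : ℤ} {r p : Poly3} (hr : r ∈ Pol (l + 1))
    (hp : p ∈ Pol (l - 1)) :
    restrV (M.face F) (rotP (M.normal F) r + mulPos (M.facePt F) p) ∈ M.vPolF F l := by
  refine ⟨⟨_, add_mem (by simpa using rotP_mem_VPol _ hr) (by simpa using mulPos_mem_VPol _ hp),
    rfl⟩, fun x => ?_⟩
  by_cases hx : x ∈ closure (M.face F)
  · rw [restrV_apply _ hx, evalV_add, inner_add_left, evalV_rotP_inner, evalV_mulPos,
      inner_smul_left, show inner ℝ (x - M.facePt F) (M.normal F) = 0 from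
      M.closure_face_subset_plane F hx]
    simp
  · simp [restrV, hx]

/-- Tangential polynomial fields on a face are sums of vector curls and of multiples of
`x - x_F`. -/
theorem exists_rotP_add_mulPos_of_mem {F : Fin M.nF} {l : ℤ} (hl : 0 ≤ l) {f : E3 → E3}
    (hf : f ∈ M.vPolF F l) : ∃ r ∈ PolZero (M.mF F) (l + 1), ∃ p ∈ Pol (l - 1),
      f = restrV (M.face F) (rotP (M.normal F) r + mulPos (M.facePt F) p) := by
  obtain ⟨⟨w, hw, rfl⟩, hwn⟩ := hf
  set n := M.normal F
  -- The field `w` is orthogonal to `n` on the closed face only, whereas the splitting asks for an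
  -- identity of polynomials. Its tangential part `w'` has that property and agrees with `w` on the
  -- face.
  let w' : VPoly3 := fun i => w i - C (n i) * (w ⬝ᵥ constV n)
  have hww : w ⬝ᵥ constV n ∈ Pol l :=
    Submodule.sum_mem _ fun i _ => by
      rw [mul_comm]
      exact C_mul_mem_Pol _ (mem_VPol.1 hw i)
  have hw' : w' ∈ VPol l :=
    mem_VPol.2 fun i => sub_mem (mem_VPol.1 hw i) (C_mul_mem_Pol _ hww)
  have hw'n : w' ⬝ᵥ constV n = 0 := by
    have hn : (C (n 0) : Poly3) * C (n 0) + C (n 1) * C (n 1) + C (n 2) * C (n 2) = 1 := by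
      rw [← C_mul, ← C_mul, ← C_mul, ← C_add, ← C_add, dot_normal_self F, C_1]
    simp only [w', dotProduct, Fin.sum_univ_three, constV]
    linear_combination (-(w 0 * C (n 0) + w 1 * C (n 1) + w 2 * C (n 2))) * hn
  have heq : ∀ x ∈ closure (M.face F), evalV w x = evalV w' x := by
    intro x hx
    have h := hwn x
    rw [restrV_apply w hx, inner_eq_sum] at h
    ext i
    simp only [evalV, w', map_sub, map_mul, eval_C, dotProduct, Fin.sum_univ_three, map_add,
      constV] at h ⊢
    rw [h]
    ring
  obtain ⟨r, hr, p, hp, hrp⟩ := exists_rotP_add_mulPos (M.facePt F) (M.normal_unit F) hw' hw'n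
  -- A rot does not see constants, so the mean value of `r` can be removed.
  obtain ⟨a, ha⟩ := exists_sub_C_mem_PolZero (mF_ne_zero F) (by omega) hr
  refine ⟨r - C a, ha, p, hp, restrV_congr fun x hx => ?_⟩
  have hC : rotP (M.normal F) (C a) = 0 := by
    have : gradP (C a : Poly3) = 0 := by
      funext i
      simp [gradP]
    simp [rotP, this]
  rw [map_sub, hC, sub_zero, heq x hx, hrp x (M.closure_face_subset_plane F hx)]

end PolyMesh

/-! ### Trace, curl and divergence reconstructions, and the potential of a discrete curl -/

namespace Serendipity

open Discretisation PolyMesh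

variable {D : Discretisation} (S : Serendipity D)

/-- On a face the rots and the multiples of `x - x_F` are in direct sum, which gives compatibility,
and together they exhaust the tangential polynomial fields, which gives uniqueness. -/
theorem exists_trFt (F : Fin D.nF) : ∃ L : D.XCurl →ₗ[ℝ] D.vPolF F D.k,
    (∀ v, S.trFt v F = L v) ∧ ∀ v, ∀ r ∈ PolZero (D.mF F) (D.k + 1),
      ip (D.mF F) (toLB (L v)) (evV (rotP (D.normal F) r)) =
        ip (D.mF F) (toLB (faceCurlL F v)) (evS r)
        + ∑ E ∈ D.edgesF F, D.oFE F E * ip (D.mE E) (toLB (v.2.2.2.2 E)) (evS r) := by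
  let P := PolZero (D.mF F) (D.k + 1)
  let sub : P × D.RcF F D.k →ₗ[ℝ] Poly3 := P.subtype ∘ₗ LinearMap.fst ℝ _ _
  let tau : P × D.RcF F D.k →ₗ[ℝ] LocBdd E3 := toLB ∘ₗ LinearMap.snd ℝ _ _
  obtain ⟨L, hL, hL'⟩ := exists_linearMap_theUnique
    ((ip (D.mF F)).compl₁₂ (toLB (V := D.vPolF F D.k)) (evV ∘ₗ rotP (D.normal F) ∘ₗ sub + tau))
    ((ip (D.mF F)).compl₁₂ (toLB ∘ₗ faceCurlL F) (evS ∘ₗ sub)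
      + ∑ E ∈ D.edgesF F, D.oFE F E • (ip (D.mE E)).compl₁₂ (toLB ∘ₗ curlCompE E) (evS ∘ₗ sub)
      + (ip (D.mF F)).compl₁₂ (toLB ∘ₗ S.curlF F ∘ₗ curlOnF F) tau)
    (by
      rintro ⟨⟨r, hr⟩, ⟨f, hf⟩⟩ h v
      obtain ⟨p, hp, hpf⟩ := id hf
      change restrV (D.face F) (mulPos (D.facePt F) p) = f at hpf
      have hu := h ⟨_, restrV_rotP_add_mulPos_mem F hr.1 hp⟩
      have hz := evalV_eq_zero_of_ip_mF (fun x hx => restrV_apply _ hx) (fun x hx => by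
        rw [evalV_add, ← restrV_apply (mulPos _ p) hx, hpf]; rfl) hu
      obtain ⟨hr0, hp0⟩ := eq_zero_of_rotP_add_mulPos (fun x hx => hz x (subset_closure hx))
        (mem_PolZero.1 hr).2
      simp only [LinearMap.add_apply, LinearMap.sum_apply, LinearMap.smul_apply,
        LinearMap.compl₁₂_apply, LinearMap.comp_apply]
      have h1 : tau (⟨r, hr⟩, ⟨f, hf⟩) = 0 := Subtype.ext (hpf.symm.trans (restrV_eq_zero hp0))
      rw [h1, map_zero, add_zero, ip_eq_zero_of_ae_right _ (ae_mF hr0), zero_add]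
      refine Finset.sum_eq_zero fun E hE => ?_
      rw [ip_eq_zero_of_forall_closure hE _ hr0, smul_zero])
    (fun v u => ∀ r ∈ Pol (D.k + 1), ∫ x, evalS r x ∂D.mF F = 0 → ∀ τ : D.RcF F D.k,
      ∫ x, inner ℝ (u.1 x) (evalV (rotP (D.normal F) r) x + τ.1 x) ∂D.mF F =
        ∫ x, (faceCurl v F).1 x * evalS r x ∂D.mF F
        + ∑ E ∈ D.edgesF F, D.oFE F E * ∫ x, (v.2.2.2.2 E).1 x * evalS r x ∂D.mE E
        + ∫ x, inner ℝ ((S.curlF F (XCurl.onF v F)).1 x) (τ.1 x) ∂D.mF F)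
    (fun v u => by
      simp only [LinearMap.add_apply, LinearMap.sum_apply, LinearMap.smul_apply, smul_eq_mul,
        LinearMap.compl₁₂_apply, LinearMap.comp_apply, ip_apply_real, faceCurl_eq]
      exact ⟨fun h p => h p.1.1 p.1.2.1 p.1.2.2 p.2, fun h r hr hr0 τ => h (⟨r, hr, hr0⟩, τ)⟩)
  refine ⟨L, hL, fun v r hr => ?_⟩
  have h := hL' ?_ v (⟨r, hr⟩, 0)
  · have h0 : tau (⟨r, hr⟩, 0) = 0 := map_zero toLB
    simp only [LinearMap.add_apply, LinearMap.sum_apply, LinearMap.smul_apply, smul_eq_mul,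
      LinearMap.compl₁₂_apply, LinearMap.comp_apply, h0, map_zero, add_zero] at h
    exact h
  · rintro ⟨f, hf⟩ hu
    obtain ⟨r, hr, p, hp, rfl⟩ := exists_rotP_add_mulPos_of_mem (by positivity) hf
    have hz := evalV_eq_zero_of_ip_mF (fun x hx => restrV_apply _ hx) (fun x hx => by
        rw [evalV_add, ← restrV_apply (mulPos _ p) hx]; rfl)
        (hu (⟨r, hr⟩, ⟨restrV (D.face F) (mulPos (D.facePt F) p), p, hp, rfl⟩))
    exact Subtype.ext (restrV_eq_zero hz)

/-- The tangential reconstruction on faces as a linear map. -/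
def trFtL (F : Fin D.nF) : D.XCurl →ₗ[ℝ] D.vPolF F D.k := (S.exists_trFt F).choose

theorem trFt_eq (v : D.XCurl) (F : Fin D.nF) : S.trFt v F = S.trFtL F v :=
  (S.exists_trFt F).choose_spec.1 v

/-- The relation between the tangential reconstruction and the face curl. -/
theorem ip_trFtL (v : D.XCurl) (F : Fin D.nF) {r : Poly3} (hr : r ∈ Pol (D.k + 1)) :
    ip (D.mF F) (toLB (S.trFtL F v)) (evV (rotP (D.normal F) r)) =
      ip (D.mF F) (toLB (faceCurlL F v)) (evS r)
      + ∑ E ∈ D.edgesF F, D.oFE F E * ip (D.mE E) (toLB (v.2.2.2.2 E)) (evS r) := by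
  obtain ⟨a, ha⟩ := exists_sub_C_mem_PolZero (mF_ne_zero F) (by positivity) hr
  have h1 := (S.exists_trFt F).choose_spec.2 v _ ha
  -- The reconstruction is tested only with `r` of zero mean value. For constant `r` both sides
  -- vanish: the left because the rot is zero, the right by the definition of the face curl tested
  -- with that constant. Hence the relation for all `r`.
  have h2 := ip_faceCurlL v F (C_mem_Pol (show (0 : ℤ) ≤ D.k by positivity) a)
  have hC : rotP (D.normal F) (C a) = 0 := by
    have : gradP (C a : Poly3) = 0 := by
      funext i
      simp [gradP]
    simp [rotP, this]
  simp only [map_sub, hC, mul_sub, Finset.sum_sub_distrib, map_zero, sub_zero] at h1 h2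
  change ip (D.mF F) (toLB ((S.exists_trFt F).choose v)) _ = _
  rw [h1, h2]
  ring

theorem exists_cellCurl (T : Fin D.nT) : ∃ L : D.XCurl →ₗ[ℝ] PolV (D.cell T) D.k,
    (∀ v, S.cellCurl v T = L v) ∧ ∀ v, ∀ w ∈ VPol D.k,
      ip (D.mT T) (toLB (L v)) (evV w) =
        ip (D.mT T) (toLB (v.1 T)) (evV (curlP w))
        + ∑ F ∈ D.facesT T, D.oTF T F *
          ip (D.mF F) (toLB (S.trFtL F v)) (evV (crossConst (D.normal F) w)) := by
  obtain ⟨L, hL, hL'⟩ := exists_linearMap_theUnique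
    ((ip (D.mT T)).compl₁₂ (toLB (V := PolV (D.cell T) D.k)) (evV ∘ₗ (VPol D.k).subtype))
    ((ip (D.mT T)).compl₁₂ (toLB ∘ₗ curlCompT T) (evV ∘ₗ curlP ∘ₗ (VPol D.k).subtype)
      + ∑ F ∈ D.facesT T, D.oTF T F • (ip (D.mF F)).compl₁₂ (toLB ∘ₗ S.trFtL F)
        (evV ∘ₗ crossConst (D.normal F) ∘ₗ (VPol D.k).subtype))
    (by
      rintro ⟨w, hw⟩ h v
      obtain rfl := eq_zero_of_ip_mT (fun x hx => restrV_apply _ hx) (fun x _ => rfl)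
        (h ⟨restrV (D.cell T) w, w, hw, rfl⟩)
      exact map_zero _)
    (fun v u => ∀ w ∈ VPol D.k,
      ∫ x, inner ℝ (u.1 x) (evalV w x) ∂D.mT T =
        ∫ x, inner ℝ ((v.1 T).1 x) (evalV (curlP w) x) ∂D.mT T
        + ∑ F ∈ D.facesT T, D.oTF T F *
          ∫ x, inner ℝ ((S.trFt v F).1 x) (cross (evalV w x) (D.normal F)) ∂D.mF F)
    (fun v u => by
      rw [Subtype.forall]
      refine forall₂_congr fun w hw => ?_
      simp only [LinearMap.add_apply, LinearMap.sum_apply, LinearMap.smul_apply, smul_eq_mul,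
        LinearMap.compl₁₂_apply, LinearMap.comp_apply, trFt_eq, ← evalV_crossConst]
      rfl)
  refine ⟨L, hL, fun v w hw => ?_⟩
  have h := hL' ?_ v ⟨w, hw⟩
  · simp only [LinearMap.add_apply, LinearMap.sum_apply, LinearMap.smul_apply, smul_eq_mul,
      LinearMap.compl₁₂_apply, LinearMap.comp_apply] at h
    exact h
  · rintro ⟨_, w, hw, rfl⟩ hu
    obtain rfl := eq_zero_of_ip_mT (fun x hx => restrV_apply _ hx) (fun x _ => rfl) (hu ⟨w, hw⟩)
    exact Subtype.ext (map_zero _)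

/-- The element curl as a linear map. -/
def cellCurlL (T : Fin D.nT) : D.XCurl →ₗ[ℝ] PolV (D.cell T) D.k := (S.exists_cellCurl T).choose

theorem cellCurl_eq (v : D.XCurl) (T : Fin D.nT) : S.cellCurl v T = S.cellCurlL T v :=
  (S.exists_cellCurl T).choose_spec.1 v

theorem ip_cellCurlL (v : D.XCurl) (T : Fin D.nT) {w : VPoly3} (hw : w ∈ VPol D.k) :
    ip (D.mT T) (toLB (S.cellCurlL T v)) (evV w) =
      ip (D.mT T) (toLB (v.1 T)) (evV (curlP w))
      + ∑ F ∈ D.facesT T, D.oTF T F *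
        ip (D.mF F) (toLB (S.trFtL F v)) (evV (crossConst (D.normal F) w)) :=
  (S.exists_cellCurl T).choose_spec.2 v w hw

/-- Only linearity is needed of this potential, so only compatibility is checked. The field `z` need
not be determined by `(x - x_T) × z`, but that product is what enters the right side, and it
vanishes whenever the test field does. -/
theorem exists_potCurl (T : Fin D.nT) : ∃ L : D.XCurl →ₗ[ℝ] PolV (D.cell T) D.k,
    ∀ v, S.potCurl v T = L v := by
  let P := VPol D.k
  let w : P × D.RcT T D.k →ₗ[ℝ] VPoly3 :=
    crossPos (D.cellPt T) ∘ₗ P.subtype ∘ₗ LinearMap.fst ℝ _ _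
  let tau : P × D.RcT T D.k →ₗ[ℝ] LocBdd E3 := toLB ∘ₗ LinearMap.snd ℝ _ _
  obtain ⟨L, hL, -⟩ := exists_linearMap_theUnique
    ((ip (D.mT T)).compl₁₂ (toLB (V := PolV (D.cell T) D.k)) (evV ∘ₗ curlP ∘ₗ w + tau))
    ((ip (D.mT T)).compl₁₂ (toLB ∘ₗ S.cellCurlL T) (evV ∘ₗ w)
      - ∑ F ∈ D.facesT T, D.oTF T F • (ip (D.mF F)).compl₁₂ (toLB ∘ₗ S.trFtL F)
          (evV ∘ₗ crossConst (D.normal F) ∘ₗ w)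
      + (ip (D.mT T)).compl₁₂ (toLB ∘ₗ S.curlT T ∘ₗ curlOnT T) tau)
    (by
      rintro ⟨⟨z, hz⟩, ⟨f, hf⟩⟩ h v
      obtain ⟨p, hp, hpf⟩ := id hf
      change restrV (D.cell T) (mulPos (D.cellPt T) p) = f at hpf
      have hmem : curlP (crossPos (D.cellPt T) z) + mulPos (D.cellPt T) p ∈ VPol D.k :=
        add_mem (by simpa using curlP_mem_VPol (crossPos_mem_VPol (D.cellPt T) hz))
          (by simpa using mulPos_mem_VPol (D.cellPt T) hp)
      have h0 := eq_zero_of_ip_mT (fun x hx => restrV_apply _ hx) (fun x hx => by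
        rw [evalV_add, ← restrV_apply (mulPos _ p) hx, hpf]; rfl) (h ⟨_, _, hmem, rfl⟩)
      have hw := crossPos_eq_zero_of_curlP_add_mulPos h0
      rw [hw, map_zero, zero_add] at h0
      have h1 : tau (⟨z, hz⟩, ⟨f, hf⟩) = 0 := Subtype.ext (hpf.symm.trans (by rw [h0, map_zero]; rfl))
      have h2 : w (⟨z, hz⟩, ⟨f, hf⟩) = 0 := hw
      simp only [LinearMap.add_apply, LinearMap.sub_apply, LinearMap.sum_apply,
        LinearMap.smul_apply, LinearMap.compl₁₂_apply, LinearMap.comp_apply, h1, h2, map_zero,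
        smul_zero, Finset.sum_const_zero, sub_zero, add_zero])
    (fun v u => ∀ z ∈ VPol D.k, ∀ w, w = crossPos (D.cellPt T) z → ∀ τ : D.RcT T D.k,
      ∫ x, inner ℝ (u.1 x) (evalV (curlP w) x + τ.1 x) ∂D.mT T =
        ∫ x, inner ℝ ((S.cellCurl v T).1 x) (evalV w x) ∂D.mT T
        - ∑ F ∈ D.facesT T, D.oTF T F *
          ∫ x, inner ℝ ((S.trFt v F).1 x) (cross (evalV w x) (D.normal F)) ∂D.mF F
        + ∫ x, inner ℝ ((S.curlT T (XCurl.onT v T)).1 x) (τ.1 x) ∂D.mT T)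
    (fun v u => by
      simp only [LinearMap.add_apply, LinearMap.sub_apply, LinearMap.sum_apply,
        LinearMap.smul_apply, smul_eq_mul, LinearMap.compl₁₂_apply, LinearMap.comp_apply,
        trFt_eq, cellCurl_eq, ← evalV_crossConst]
      exact ⟨fun h p => h p.1.1 p.1.2 _ rfl p.2, fun h z hz w hw τ => hw ▸ h (⟨z, hz⟩, τ)⟩)
  exact ⟨L, hL⟩

/-- The vector potential reconstruction on the curl space as a linear map. -/
def potCurlL (T : Fin D.nT) : D.XCurl →ₗ[ℝ] PolV (D.cell T) D.k := (S.exists_potCurl T).choose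

theorem potCurl_eq (v : D.XCurl) (T : Fin D.nT) : S.potCurl v T = S.potCurlL T v :=
  (S.exists_potCurl T).choose_spec v

theorem exists_cellDiv (T : Fin D.nT) : ∃ L : D.XDiv →ₗ[ℝ] PolS (D.cell T) D.k,
    (∀ w, cellDiv w T = L w) ∧ ∀ w, ∀ q ∈ Pol D.k,
      ip (D.mT T) (toLB (L w)) (evS q) =
        -ip (D.mT T) (toLB (w.1 T)) (evV (gradP q))
        + ∑ F ∈ D.facesT T, D.oTF T F * ip (D.mF F) (toLB (w.2.2 F)) (evS q) := by
  obtain ⟨L, hL, hL'⟩ := exists_linearMap_theUnique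
    ((ip (D.mT T)).compl₁₂ (toLB (V := PolS (D.cell T) D.k)) (evS ∘ₗ (Pol D.k).subtype))
    (-(ip (D.mT T)).compl₁₂ (toLB ∘ₗ divCompT T) (evV ∘ₗ gradP ∘ₗ (Pol D.k).subtype)
      + ∑ F ∈ D.facesT T, D.oTF T F • (ip (D.mF F)).compl₁₂ (toLB ∘ₗ divCompF F)
        (evS ∘ₗ (Pol D.k).subtype))
    (by
      rintro ⟨q, hq⟩ h v
      obtain rfl := eq_zero_of_ip_mT_real (fun x hx => restrS_apply _ hx) (fun x _ => rfl)
        (h ⟨restrS (D.cell T) q, q, hq, rfl⟩)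
      exact map_zero _)
    (fun w u => ∀ q ∈ Pol D.k,
      ∫ x, u.1 x * evalS q x ∂D.mT T =
        -(∫ x, inner ℝ ((w.1 T).1 x) (evalV (gradP q) x) ∂D.mT T)
        + ∑ F ∈ D.facesT T, D.oTF T F * ∫ x, (w.2.2 F).1 x * evalS q x ∂D.mF F)
    (fun v u => by
      rw [Subtype.forall]
      refine forall₂_congr fun w hw => ?_
      simp only [LinearMap.add_apply, LinearMap.neg_apply, LinearMap.sum_apply,
        LinearMap.smul_apply, smul_eq_mul, LinearMap.compl₁₂_apply, LinearMap.comp_apply,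
        ip_apply_real]
      rfl)
  refine ⟨L, hL, fun v q hq => ?_⟩
  have h := hL' ?_ v ⟨q, hq⟩
  · simp only [LinearMap.add_apply, LinearMap.neg_apply, LinearMap.sum_apply,
      LinearMap.smul_apply, smul_eq_mul, LinearMap.compl₁₂_apply, LinearMap.comp_apply] at h
    exact h
  · rintro ⟨_, q, hq, rfl⟩ hu
    obtain rfl := eq_zero_of_ip_mT_real (fun x hx => restrS_apply _ hx) (fun x _ => rfl)
      (hu ⟨q, hq⟩)
    exact Subtype.ext (map_zero _)

/-- The element divergence as a linear map. -/
def cellDivL (T : Fin D.nT) : D.XDiv →ₗ[ℝ] PolS (D.cell T) D.k := (exists_cellDiv T).choose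

theorem cellDiv_eq (w : D.XDiv) (T : Fin D.nT) : cellDiv w T = cellDivL T w :=
  (exists_cellDiv T).choose_spec.1 w

theorem ip_cellDivL (w : D.XDiv) (T : Fin D.nT) {q : Poly3} (hq : q ∈ Pol D.k) :
    ip (D.mT T) (toLB (cellDivL T w)) (evS q) =
      -ip (D.mT T) (toLB (w.1 T)) (evV (gradP q))
      + ∑ F ∈ D.facesT T, D.oTF T F * ip (D.mF F) (toLB (w.2.2 F)) (evS q) :=
  (exists_cellDiv T).choose_spec.2 w q hq

/-- The second claim is a recognition criterion: gradients and fields `(x - x_T) × z` span all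
polynomial fields on the element, so whatever satisfies the defining relations is the potential. -/
theorem exists_potDiv (T : Fin D.nT) : ∃ L : D.XDiv →ₗ[ℝ] PolV (D.cell T) D.k,
    (∀ w, potDiv w T = L w) ∧ ∀ w (u : PolV (D.cell T) D.k),
      (∀ r ∈ PolZero (D.mT T) (D.k + 1), ∀ τ : D.GcT T D.k,
        ip (D.mT T) (toLB u) (evV (gradP r) + toLB τ) =
          -ip (D.mT T) (toLB (cellDivL T w)) (evS r)
          + ∑ F ∈ D.facesT T, D.oTF T F * ip (D.mF F) (toLB (w.2.2 F)) (evS r)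
          + ip (D.mT T) (toLB (w.2.1 T)) (toLB τ)) → L w = u := by
  let P := PolZero (D.mT T) (D.k + 1)
  let sub : P × D.GcT T D.k →ₗ[ℝ] Poly3 := P.subtype ∘ₗ LinearMap.fst ℝ _ _
  let tau : P × D.GcT T D.k →ₗ[ℝ] LocBdd E3 := toLB ∘ₗ LinearMap.snd ℝ _ _
  obtain ⟨L, hL, hL'⟩ := exists_linearMap_theUnique
    ((ip (D.mT T)).compl₁₂ (toLB (V := PolV (D.cell T) D.k)) (evV ∘ₗ gradP ∘ₗ sub + tau))
    (-(ip (D.mT T)).compl₁₂ (toLB ∘ₗ cellDivL T) (evS ∘ₗ sub)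
      + ∑ F ∈ D.facesT T, D.oTF T F • (ip (D.mF F)).compl₁₂ (toLB ∘ₗ divCompF F) (evS ∘ₗ sub)
      + (ip (D.mT T)).compl₁₂ (toLB ∘ₗ divCompTc T) tau)
    (by
      rintro ⟨⟨r, hr⟩, ⟨f, hf⟩⟩ h w
      obtain ⟨z, hz, hzf⟩ := id hf
      change restrV (D.cell T) (crossPos (D.cellPt T) z) = f at hzf
      have hmem : gradP r + crossPos (D.cellPt T) z ∈ VPol D.k :=
        add_mem (by simpa using gradP_mem_VPol hr.1)
          (by simpa using crossPos_mem_VPol (D.cellPt T) hz)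
      have h0 := eq_zero_of_ip_mT (fun x hx => restrV_apply _ hx) (fun x hx => by
        rw [evalV_add, ← restrV_apply (crossPos _ z) hx, hzf]; rfl) (h ⟨_, _, hmem, rfl⟩)
      obtain ⟨rfl, hz0⟩ := eq_zero_of_gradP_add_crossPos (T := T)
        (fun x _ => by rw [h0]; ext i; simp [evalV]) (mem_PolZero.1 hr).2
      have h1 : tau (⟨0, hr⟩, ⟨f, hf⟩) = 0 :=
        Subtype.ext (hzf.symm.trans (by rw [hz0, map_zero]; rfl))
      have h2 : sub (⟨0, hr⟩, ⟨f, hf⟩) = 0 := rfl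
      simp only [LinearMap.add_apply, LinearMap.neg_apply, LinearMap.sum_apply,
        LinearMap.smul_apply, LinearMap.compl₁₂_apply, LinearMap.comp_apply, h1, h2, map_zero,
        smul_zero, Finset.sum_const_zero, neg_zero, add_zero])
    (fun w u => ∀ r ∈ Pol (D.k + 1), ∫ x, evalS r x ∂D.mT T = 0 → ∀ τ : D.GcT T D.k,
      ∫ x, inner ℝ (u.1 x) (evalV (gradP r) x + τ.1 x) ∂D.mT T =
        -(∫ x, (cellDiv w T).1 x * evalS r x ∂D.mT T)
        + ∑ F ∈ D.facesT T, D.oTF T F * ∫ x, (w.2.2 F).1 x * evalS r x ∂D.mF F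
        + ∫ x, inner ℝ ((w.2.1 T).1 x) (τ.1 x) ∂D.mT T)
    (fun v u => by
      simp only [LinearMap.add_apply, LinearMap.neg_apply, LinearMap.sum_apply,
        LinearMap.smul_apply, smul_eq_mul, LinearMap.compl₁₂_apply, LinearMap.comp_apply,
        ip_apply_real, cellDiv_eq]
      exact ⟨fun h p => h p.1.1 p.1.2.1 p.1.2.2 p.2, fun h r hr hr0 τ => h (⟨r, hr, hr0⟩, τ)⟩)
  have huniq : ∀ u : PolV (D.cell T) D.k, (∀ p, (ip (D.mT T)).compl₁₂
      (toLB (V := PolV (D.cell T) D.k)) (evV ∘ₗ gradP ∘ₗ sub + tau) u p = 0) → u = 0 := by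
    rintro ⟨_, w, hw, rfl⟩ hu
    obtain ⟨r, hr, z, hz, rfl⟩ := exists_gradP_add_crossPos (D.cellPt T) hw
    obtain ⟨a, ha⟩ := exists_sub_C_mem_PolZero (mT_ne_zero T) (by positivity) hr
    have hg : gradP (r - C a) = gradP r := by
      funext i
      simp [gradP]
    have h0 := eq_zero_of_ip_mT (fun x hx => restrV_apply _ hx) (fun x hx => by
        rw [evalV_add, ← restrV_apply (crossPos _ z) hx, ← hg]; rfl)
        (hu (⟨_, ha⟩, ⟨restrV (D.cell T) (crossPos (D.cellPt T) z), z, hz, rfl⟩))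
    exact Subtype.ext ((congrArg (restrV (D.cell T)) h0).trans (map_zero _))
  refine ⟨L, hL, fun w u hu => ?_⟩
  rw [← sub_eq_zero]
  refine huniq _ fun p => ?_
  rw [map_sub, LinearMap.sub_apply, hL' huniq, sub_eq_zero]
  simp only [LinearMap.add_apply, LinearMap.neg_apply, LinearMap.sum_apply,
    LinearMap.smul_apply, smul_eq_mul, LinearMap.compl₁₂_apply, LinearMap.comp_apply]
  exact (hu p.1.1 p.1.2 p.2).symm

/-- The vector potential reconstruction on the divergence space as a linear map. -/
def potDivL (T : Fin D.nT) : D.XDiv →ₗ[ℝ] PolV (D.cell T) D.k := (exists_potDiv T).choose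

theorem potDiv_eq (w : D.XDiv) (T : Fin D.nT) : potDiv w T = potDivL T w :=
  (exists_potDiv T).choose_spec.1 w

/-- The discrete curl as a linear map. -/
def uCL : D.XCurl →ₗ[ℝ] D.XDiv :=
  (LinearMap.pi fun T => l2projL (D.mT T) (D.GT T (D.k - 1)) ∘ₗ toLB ∘ₗ S.cellCurlL T).prod
    ((LinearMap.pi fun T => l2projL (D.mT T) (D.GcT T D.k) ∘ₗ toLB ∘ₗ S.cellCurlL T).prod
      (LinearMap.pi fun F => faceCurlL F))

theorem uC_eq (v : D.XCurl) : S.uC v = S.uCL v := by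
  have h1 := fun T => l2proj_eq (D.mT T) (D.GT T (D.k - 1)) (toLB (S.cellCurlL T v))
  have h2 := fun T => l2proj_eq (D.mT T) (D.GcT T D.k) (toLB (S.cellCurlL T v))
  simp only [coe_toLB] at h1 h2
  simp only [uC, cellCurl_eq, faceCurl_eq, h1, h2]
  rfl

/-- The element reconstruction of a discrete curl is the element curl. -/
theorem potDivL_uCL (v : D.XCurl) (T : Fin D.nT) : potDivL T (S.uCL v) = S.cellCurlL T v := by
  -- Testing the element curl with `∇r` removes the volume term, as `curl ∇r = 0`. On each face the
  -- trace relation turns the rest into the face curl plus edge terms, and the latter cancel over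
  -- the boundary of the element.
  have hflux : ∀ r ∈ Pol (D.k + 1), ip (D.mT T) (toLB (S.cellCurlL T v)) (evV (gradP r)) =
      ∑ F ∈ D.facesT T, D.oTF T F * ip (D.mF F) (toLB (faceCurlL F v)) (evS r) := by
    intro r hr
    rw [ip_cellCurlL S v T (by simpa using gradP_mem_VPol hr), curlP_gradP, map_zero, map_zero,
      zero_add]
    have h1 : ∀ F, ip (D.mF F) (toLB (S.trFtL F v)) (evV (crossConst (D.normal F) (gradP r))) =
        ip (D.mF F) (toLB (faceCurlL F v)) (evS r)
        + ∑ E ∈ D.edgesF F, D.oFE F E * ip (D.mE E) (toLB (v.2.2.2.2 E)) (evS r) :=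
      fun F => S.ip_trFtL v F hr
    simp only [h1, mul_add, Finset.sum_add_distrib]
    rw [sum_oTF_mul_sum_oFE T fun E => ip (D.mE E) (toLB (v.2.2.2.2 E)) (evS r), add_zero]
  -- In the discrete divergence the projection on `GT T (k - 1)` is invisible to gradients of degree
  -- `k` polynomials, so the flux identity makes the volume and face terms cancel.
  have hdiv : cellDivL T (S.uCL v) = 0 := by
    obtain ⟨p, hp, hpe⟩ := (cellDivL T (S.uCL v)).2
    have hz : ip (D.mT T) (toLB (cellDivL T (S.uCL v))) (evS p) = 0 := by
      rw [ip_cellDivL _ T hp]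
      have h2 := ip_l2projL (D.mT T) (D.GT T (D.k - 1))
        (fun u hu => Subtype.ext (eq_zero_of_ae_mT_PolV (GT_le T _ u.2) hu))
        (toLB (S.cellCurlL T v)) ⟨restrV (D.cell T) (gradP p), p, by simpa using hp, rfl⟩
      have h3 : ∀ f, ip (D.mT T) f (toLB (⟨restrV (D.cell T) (gradP p), p, by simpa using hp, rfl⟩ :
          D.GT T (D.k - 1))) = ip (D.mT T) f (evV (gradP p)) := fun f =>
        ip_congr_ae Filter.EventuallyEq.rfl (ae_mT fun x hx => restrV_apply _ hx)
      rw [h3, h3] at h2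
      change -ip (D.mT T) (toLB (l2projL (D.mT T) (D.GT T (D.k - 1)) (toLB (S.cellCurlL T v))))
        (evV (gradP p)) + _ = 0
      rw [h2, hflux p (Pol_mono (by omega) hp)]
      exact neg_add_cancel _
    have hp0 := eq_zero_of_ip_mT_real (p := p) (f := toLB (cellDivL T (S.uCL v)))
      (fun x hx => by rw [coe_toLB, ← hpe]; exact restrS_apply p hx) (fun x _ => rfl) hz
    exact Subtype.ext (by rw [← hpe, hp0]; exact map_zero _)
  -- The element curl satisfies the relations of the potential: the gradient part is the flux
  -- identity with zero divergence, and the complementary part is the projection on `GcT T k`.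
  refine (exists_potDiv T).choose_spec.2 _ _ fun r hr τ => ?_
  rw [hdiv, map_add, hflux r hr.1, map_zero, map_zero, LinearMap.zero_apply, neg_zero, zero_add]
  congr 1
  exact (ip_l2projL (D.mT T) (D.GcT T D.k)
    (fun u hu => Subtype.ext (eq_zero_of_ae_mT_PolV (GcT_le T _ u.2) hu)) _ τ).symm

end Serendipity

/-! ## Positive semidefinite forms -/

/-- The function `f` is a symmetric positive semidefinite bilinear form. -/
def IsPSDForm {X : Type*} [AddCommGroup X] [Module ℝ X] (f : X → X → ℝ) : Prop :=
  ∃ β : X →ₗ[ℝ] X →ₗ[ℝ] ℝ, (∀ x y, f x y = β x y) ∧ (∀ x y, β x y = β y x) ∧ ∀ x, 0 ≤ β x x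

namespace IsPSDForm

variable {X Y : Type*} [AddCommGroup X] [Module ℝ X] [AddCommGroup Y] [Module ℝ Y]

theorem add {f g : X → X → ℝ} (hf : IsPSDForm f) (hg : IsPSDForm g) :
    IsPSDForm fun x y => f x y + g x y := by
  obtain ⟨β, h1, h2, h3⟩ := hf
  obtain ⟨γ, h1', h2', h3'⟩ := hg
  exact ⟨β + γ, fun x y => by simp [h1, h1'],
    fun x y => by rw [LinearMap.add_apply, LinearMap.add_apply, h2, h2', LinearMap.add_apply,
      LinearMap.add_apply], fun x => add_nonneg (h3 x) (h3' x)⟩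

theorem const_mul {f : X → X → ℝ} (hf : IsPSDForm f) {c : ℝ} (hc : 0 ≤ c) :
    IsPSDForm fun x y => c * f x y := by
  obtain ⟨β, h1, h2, h3⟩ := hf
  exact ⟨c • β, fun x y => by simp [h1], fun x y => by simp [h2 x y],
    fun x => mul_nonneg hc (h3 x)⟩

theorem zero : IsPSDForm fun _ _ : X => (0 : ℝ) :=
  ⟨0, fun _ _ => rfl, fun _ _ => rfl, fun _ => le_rfl⟩

theorem sum {κ : Type*} (s : Finset κ) {f : κ → X → X → ℝ} (hf : ∀ k, IsPSDForm (f k)) :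
    IsPSDForm fun x y => ∑ k ∈ s, f k x y := by
  classical
  induction s using Finset.induction_on with
  | empty => simpa using zero
  | insert k s hk ih =>
    simp only [Finset.sum_insert hk]
    exact (hf k).add ih

theorem comp {f : Y → Y → ℝ} (hf : IsPSDForm f) (A : X →ₗ[ℝ] Y) :
    IsPSDForm fun x y => f (A x) (A y) := by
  obtain ⟨β, h1, h2, h3⟩ := hf
  exact ⟨β.compl₁₂ A A, fun x y => h1 _ _, fun x y => h2 _ _, fun x => h3 _⟩

theorem ip {G : Type*} [NormedAddCommGroup G] [InnerProductSpace ℝ G] (m : Measure E3)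
    [BoundedSupport m] (A : X →ₗ[ℝ] LocBdd G) : IsPSDForm fun x y => YM.ip m (A x) (A y) :=
  IsPSDForm.comp ⟨YM.ip m, fun _ _ => rfl, ip_comm m, ip_self_nonneg m⟩ A

/-- The Gram matrix of `B` in the basis is positive semidefinite, hence a sum of rank-one matrices
with entries `N K I * N K J`. The tensored form at `x` is then the sum over `K` of `β` at `∑ I, N K
I • x I`. -/
theorem tens {ι : Type*} [Fintype ι] {𝔤 : Type*} [LieRing 𝔤] [LieAlgebra ℝ 𝔤]
    (b : Module.Basis ι ℝ 𝔤) (B : LinearMap.BilinForm ℝ 𝔤) (hB_symm : ∀ x y : 𝔤, B x y = B y x)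
    (hB_pos : ∀ x : 𝔤, x ≠ 0 → 0 < B x x) {f : X → X → ℝ} (hf : IsPSDForm f) :
    IsPSDForm (tens b B f) := by
  classical
  obtain ⟨β, h1, h2, h3⟩ := hf
  let M : Matrix ι ι ℝ := Matrix.of fun I J => B (b I) (b J)
  have hM : M.PosSemidef := by
    refine Matrix.PosSemidef.of_dotProduct_mulVec_nonneg ?_ fun c => ?_
    · ext I J
      simp [M, hB_symm (b J)]
    · have : star c ⬝ᵥ (M *ᵥ c) = B (∑ I, c I • b I) (∑ J, c J • b J) := by
        simp only [dotProduct, Matrix.mulVec, M, Matrix.of_apply, map_sum, LinearMap.sum_apply,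
          map_smul, LinearMap.smul_apply, smul_eq_mul, Pi.star_apply, star_trivial]
        refine Finset.sum_congr rfl fun I _ => congrArg _ <| Finset.sum_congr rfl fun J _ => ?_
        rw [hB_symm, mul_comm]
      rw [this]
      by_cases h0 : ∑ I, c I • b I = 0
      · simp [h0]
      · exact (hB_pos _ h0).le
  obtain ⟨r, N, hN⟩ := Matrix.posSemidef_iff_eq_sum_vecMulVec.1 hM
  have hMN : ∀ I J, B (b I) (b J) = ∑ K, N K I * N K J := fun I J => by
    have := congrFun (congrFun hN I) J
    simpa [M, Matrix.sum_apply, Matrix.vecMulVec_apply] using this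
  refine ⟨∑ I, ∑ J, B (b I) (b J) • β.compl₁₂ (LinearMap.proj I) (LinearMap.proj J),
    fun x y => ?_, fun x y => ?_, fun x => ?_⟩
  · simp [YM.tens, h1, LinearMap.sum_apply, mul_comm]
  · simp only [LinearMap.sum_apply, LinearMap.smul_apply, LinearMap.compl₁₂_apply,
      LinearMap.proj_apply]
    rw [Finset.sum_comm]
    refine Finset.sum_congr rfl fun I _ => Finset.sum_congr rfl fun J _ => ?_
    rw [h2, hB_symm]
  · have : (∑ I, ∑ J, B (b I) (b J) • β.compl₁₂ (LinearMap.proj I) (LinearMap.proj J)) x x =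
        ∑ K, β (∑ I, N K I • x I) (∑ I, N K I • x I) := by
      have hK : ∀ K, β (∑ I, N K I • x I) (∑ I, N K I • x I) =
          ∑ I, ∑ J, N K I * N K J * β (x I) (x J) := fun K => by
        simp only [map_sum, LinearMap.sum_apply, map_smul, LinearMap.smul_apply, smul_eq_mul,
          Finset.mul_sum]
        rw [Finset.sum_comm]
        refine Finset.sum_congr rfl fun I _ => Finset.sum_congr rfl fun J _ => ?_
        ring
      simp only [hK, LinearMap.sum_apply, LinearMap.smul_apply, LinearMap.compl₁₂_apply,
        LinearMap.proj_apply, hMN, smul_eq_mul]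
      conv_rhs => rw [Finset.sum_comm]
      refine Finset.sum_congr rfl fun I _ => ?_
      conv_rhs => rw [Finset.sum_comm]
      refine Finset.sum_congr rfl fun J _ => ?_
      rw [Finset.sum_mul]
    rw [this]
    exact Finset.sum_nonneg fun K _ => h3 _

end IsPSDForm

/-! ## Operations on locally bounded fields -/

/-- Composition with a continuous linear map. -/
def postComp {G G' : Type*} [NormedAddCommGroup G] [NormedSpace ℝ G] [NormedAddCommGroup G']
    [NormedSpace ℝ G'] (φ : G →L[ℝ] G') : LocBdd G →ₗ[ℝ] LocBdd G' where
  toFun f := ⟨fun x => φ (f.1 x), φ.continuous.comp_stronglyMeasurable f.2.1, fun R => by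
    obtain ⟨C, hC⟩ := f.2.2 R
    exact ⟨‖φ‖ * C, fun x hx => (φ.le_opNorm _).trans (by gcongr; exact hC x hx)⟩⟩
  map_add' f g := by ext x; simp
  map_smul' c f := by ext x; simp

/-- The cross product as a bilinear map. -/
def crossL : E3 →ₗ[ℝ] E3 →ₗ[ℝ] E3 :=
  LinearMap.mk₂ ℝ cross (fun a b c => by simp [cross]) (fun a b c => by simp [cross])
    (fun a b c => by simp [cross]) (fun a b c => by simp [cross])

/-- The pointwise cross product of locally bounded fields. -/
def crossLB : LocBdd E3 →ₗ[ℝ] LocBdd E3 →ₗ[ℝ] LocBdd E3 :=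
  LinearMap.mk₂ ℝ (fun f g => ⟨fun x => cross (f.1 x) (g.1 x),
      -- The bound `‖a × b‖ ≤ ‖a‖ ‖b‖` comes from Lagrange's identity `‖a × b‖² = ‖a‖² ‖b‖² - (a ·
      -- b)²`.
      locBdd_comp₂ cross (by unfold cross; simp only [crossProduct]; fun_prop) 1 (fun a b => by
        rw [one_mul]
        refine abs_le_of_sq_le_sq' ?_ (by positivity) |>.2
        rw [← real_inner_self_eq_norm_sq, inner_cross_cross, real_inner_self_eq_norm_sq,
          real_inner_self_eq_norm_sq, real_inner_comm b a]
        nlinarith [sq_nonneg (inner ℝ a b)]) zero_le_one f.2 g.2⟩)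
    (fun f f' g => by ext1; funext x; exact LinearMap.map_add₂ crossL _ _ _)
    (fun c f g => by ext1; funext x; exact LinearMap.map_smul₂ crossL _ _ _)
    (fun f g g' => by ext1; funext x; exact map_add (crossL _) _ _)
    (fun c f g => by ext1; funext x; exact map_smul (crossL _) _ _)

/-- The pointwise product with a locally bounded function. -/
def smulLB (q : LocBdd ℝ) : LocBdd E3 →ₗ[ℝ] LocBdd E3 where
  toFun f := ⟨fun x => q.1 x • f.1 x, locBdd_smul q.2 f.2⟩
  map_add' f g := by ext1; funext x; exact smul_add _ _ _
  map_smul' c f := by ext1; funext x; exact smul_comm (q.1 x) c (f.1 x)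

theorem crossLB_neg_comm (f g : LocBdd E3) : -crossLB f g = crossLB g f := by
  ext1
  funext x
  exact cross_neg_comm _ _

theorem ip_smulLB_comm (m : Measure E3) [BoundedSupport m] (q : LocBdd ℝ) (f g : LocBdd E3) :
    ip m f (smulLB q g) = ip m g (smulLB q f) := by
  rw [ip_apply, ip_apply]
  congr 1 with x
  simp only [smulLB, LinearMap.coe_mk, AddHom.coe_mk, inner_smul_right, real_inner_comm]

/-- The tangential trace as a continuous linear map. -/
def tanTraceL (n : E3) : E3 →L[ℝ] E3 :=
  LinearMap.toContinuousLinearMap (crossL n ∘ₗ crossL.flip n)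

/-! ### Positivity of the discrete products -/

namespace Serendipity

open Discretisation PolyMesh

variable {D : Discretisation} (S : Serendipity D)

theorem isPSDForm_ipCurl : IsPSDForm S.ipCurl := by
  have h : S.ipCurl = fun w v => ∑ T, (ip (D.mT T) ((toLB ∘ₗ S.potCurlL T) w)
        ((toLB ∘ₗ S.potCurlL T) v) +
      (∑ F ∈ D.facesT T, D.hF F * ip (D.mF F)
        ((postComp (tanTraceL (D.normal F)) ∘ₗ toLB ∘ₗ S.potCurlL T - toLB ∘ₗ S.trFtL F) w)
        ((postComp (tanTraceL (D.normal F)) ∘ₗ toLB ∘ₗ S.potCurlL T - toLB ∘ₗ S.trFtL F) v)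
      + ∑ E ∈ D.edgesT T, D.hE E ^ 2 * ip (D.mE E)
        ((postComp (innerSL ℝ (D.tangent E)) ∘ₗ toLB ∘ₗ S.potCurlL T - toLB ∘ₗ curlCompE E) w)
        ((postComp (innerSL ℝ (D.tangent E)) ∘ₗ toLB ∘ₗ S.potCurlL T
          - toLB ∘ₗ curlCompE E) v))) := by
    funext w v
    simp only [ipCurl, sCurl, potCurl_eq, trFt_eq, ip_apply_real,
      real_inner_comm (D.tangent _)]
    rfl
  rw [h]
  refine IsPSDForm.sum _ fun T => (IsPSDForm.ip _ _).add ((IsPSDForm.sum _ fun F => ?_).add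
    (IsPSDForm.sum _ fun E => ?_))
  · exact (IsPSDForm.ip _ _).const_mul Metric.diam_nonneg
  · exact (IsPSDForm.ip _ _).const_mul (sq_nonneg _)

theorem isPSDForm_sDiv (T : Fin D.nT) : IsPSDForm fun w v : D.XDiv => sDiv w v T := by
  have h : (fun w v : D.XDiv => sDiv w v T) = fun w v =>
      ∑ F ∈ D.facesT T, D.hF F * ip (D.mF F)
        ((postComp (innerSL ℝ (D.normal F)) ∘ₗ toLB ∘ₗ potDivL T - toLB ∘ₗ divCompF F) w)
        ((postComp (innerSL ℝ (D.normal F)) ∘ₗ toLB ∘ₗ potDivL T - toLB ∘ₗ divCompF F) v) := by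
    funext w v
    simp only [sDiv, potDiv_eq, ip_apply_real, real_inner_comm (D.normal _)]
    rfl
  rw [h]
  exact IsPSDForm.sum _ fun F => (IsPSDForm.ip _ _).const_mul Metric.diam_nonneg

theorem isPSDForm_sDivGlob : IsPSDForm (sDivGlob (D := D)) :=
  IsPSDForm.sum _ fun T => isPSDForm_sDiv T

theorem isPSDForm_ipDiv : IsPSDForm (ipDiv (D := D)) := by
  have h : ipDiv (D := D) = fun w v => ∑ T, (ip (D.mT T) ((toLB ∘ₗ potDivL T) w)
        ((toLB ∘ₗ potDivL T) v) + sDiv w v T) := by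
    funext w v
    simp only [ipDiv, potDiv_eq]
    rfl
  rw [h]
  exact IsPSDForm.sum _ fun T => (IsPSDForm.ip _ _).add (isPSDForm_sDiv T)

end Serendipity

/-! ### Brackets of Lie algebra-valued fields -/

section LieValued

open Discretisation

variable {D : Discretisation} (S : Serendipity D) {ι : Type*} [Fintype ι]
  {𝔤 : Type*} [LieRing 𝔤] [LieAlgebra ℝ 𝔤] (b : Module.Basis ι ℝ 𝔤) (B : LinearMap.BilinForm ℝ 𝔤)

/-- Piecewise locally bounded fields. -/
abbrev PwLB (D : Discretisation) : Type := Fin D.nT → LocBdd E3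

/-- The `L²`-product of piecewise locally bounded fields. -/
def l2LB (f g : PwLB D) : ℝ := ∑ T, ip (D.mT T) (f T) (g T)

theorem isPSDForm_l2LB : IsPSDForm (l2LB (D := D)) :=
  IsPSDForm.sum _ fun T => IsPSDForm.ip (D.mT T) 
    (LinearMap.proj (φ := fun _ => LocBdd E3) T : PwLB D →ₗ[ℝ] LocBdd E3)

theorem tens_l2Dom (f g : ι → PwLB D) :
    tens b B l2Dom (fun I T => (f I T).1) (fun I T => (g I T).1) = tens b B l2LB f g := rfl

theorem strConst_skew {ι : Type*} (b : Module.Basis ι ℝ 𝔤) (I J K : ι) : strConst b I J K = -strConst b J I K := by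
  rw [strConst, strConst, ← lie_skew, map_neg, Finsupp.neg_apply]

/-- The bracket of fields. -/
def bktLB : (ι → LocBdd E3) →ₗ[ℝ] (ι → LocBdd E3) →ₗ[ℝ] (ι → LocBdd E3) :=
  LinearMap.mk₂ ℝ (fun v w K => ∑ I, ∑ J, strConst b I J K • crossLB (v I) (w J))
    (fun v v' w => by
      funext K
      simp [Finset.sum_add_distrib])
    (fun c v w => by
      funext K
      simp [Finset.smul_sum, smul_comm c])
    (fun v w w' => by
      funext K
      simp [Finset.sum_add_distrib])
    (fun c v w => by
      funext K
      simp [Finset.smul_sum, smul_comm c])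

/-- The Lie bracket and the cross product are both antisymmetric, and the two signs cancel. The
discrete chain rule for the quadratic term of the magnetic field depends on this symmetry. -/
theorem bktLB_comm (v w : ι → LocBdd E3) : bktLB b v w = bktLB b w v := by
  funext K
  simp only [bktLB, LinearMap.mk₂_apply]
  rw [Finset.sum_comm]
  refine Finset.sum_congr rfl fun I _ => Finset.sum_congr rfl fun J _ => ?_
  rw [strConst_skew, ← crossLB_neg_comm, smul_neg, neg_smul, neg_neg]

theorem coe_bktLB (v w : ι → LocBdd E3) (K : ι) :
    (bktLB b v w K).1 = fun x => bktPt b (fun I => (v I).1 x) (fun I => (w I).1 x) K := by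
  funext x
  simp [bktLB, bktPt, crossLB, Finset.sum_apply]

end LieValued

/-! ## Abstract energy estimates -/

namespace IsPSDForm

variable {X Y : Type*} [AddCommGroup X] [Module ℝ X] [AddCommGroup Y] [Module ℝ Y]

theorem symm {f : X → X → ℝ} (hf : IsPSDForm f) (x y : X) : f x y = f y x := by
  obtain ⟨β, h1, h2, -⟩ := hf
  rw [h1, h1, h2]

theorem add_left {f : X → X → ℝ} (hf : IsPSDForm f) (x x' y : X) :
    f (x + x') y = f x y + f x' y := by
  obtain ⟨β, h1, -, -⟩ := hf
  simp [h1]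

theorem smul_left {f : X → X → ℝ} (hf : IsPSDForm f) (c : ℝ) (x y : X) :
    f (c • x) y = c * f x y := by
  obtain ⟨β, h1, -, -⟩ := hf
  simp [h1]

theorem sub_left {f : X → X → ℝ} (hf : IsPSDForm f) (x x' y : X) :
    f (x - x') y = f x y - f x' y := by
  obtain ⟨β, h1, -, -⟩ := hf
  simp [h1]

theorem add_right {f : X → X → ℝ} (hf : IsPSDForm f) (x y y' : X) :
    f x (y + y') = f x y + f x y' := by
  rw [hf.symm, hf.add_left, hf.symm y, hf.symm y']

theorem smul_right {f : X → X → ℝ} (hf : IsPSDForm f) (c : ℝ) (x y : X) :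
    f x (c • y) = c * f x y := by
  rw [hf.symm, hf.smul_left, hf.symm y]

theorem sub_right {f : X → X → ℝ} (hf : IsPSDForm f) (x y y' : X) :
    f x (y - y') = f x y - f x y' := by
  rw [hf.symm, hf.sub_left, hf.symm y, hf.symm y']

theorem map_neg_smul_sub_right {f : Y → Y → ℝ} (hf : IsPSDForm f) (C : X →ₗ[ℝ] Y) (y : Y)
    (a a' : X) (τ : ℝ) : f y (C (-(τ • (a' - a)))) = -(τ * f y (C a' - C a)) := by
  rw [map_neg, map_smul, map_sub, ← neg_smul, hf.smul_right, neg_mul]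

/-- The difference of the two sides is `f (y - x) (y - x) / 2`. This is the numerical dissipation of
the implicit scheme. -/
theorem half_sub_half_le {f : X → X → ℝ} (hf : IsPSDForm f) (x y : X) :
    1 / 2 * f y y - 1 / 2 * f x x ≤ f y (y - x) := by
  obtain ⟨β, h1, h2, h3⟩ := hf
  have := h3 (y - x)
  simp only [map_sub, LinearMap.sub_apply, h2 x y] at this
  simp only [h1, map_sub]
  linarith

/-- The work of the nonlinear terms along the increment of the potential. -/
theorem work_eq {f : Y → Y → ℝ} (hf : IsPSDForm f) (C : X →ₗ[ℝ] Y) (br : X →ₗ[ℝ] X →ₗ[ℝ] Y)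
    (hbr : ∀ x y, br x y = br y x) (a a' : X) (τ : ℝ) :
    f (C a') (C (-(τ • (a' - a)))) + (f (C a') (br ((1 / 2 : ℝ) • (a + a')) (-(τ • (a' - a))))
      + f ((1 / 2 : ℝ) • br a' a')
          (C (-(τ • (a' - a))) + br ((1 / 2 : ℝ) • (a + a')) (-(τ • (a' - a))))) =
    -(τ * f (C a' + (1 / 2 : ℝ) • br a' a')
      (C a' + (1 / 2 : ℝ) • br a' a' - (C a + (1 / 2 : ℝ) • br a a))) := by
  -- Since `br` is symmetric, `br ((a + a') / 2) (a' - a) = br a' a' / 2 - br a a / 2`: evaluating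
  -- at the midpoint makes the chain rule exact.
  have h : C (-(τ • (a' - a))) + br ((1 / 2 : ℝ) • (a + a')) (-(τ • (a' - a))) =
      (-τ) • (C a' + (1 / 2 : ℝ) • br a' a' - (C a + (1 / 2 : ℝ) • br a a)) := by
    simp only [map_neg, map_smul, map_sub, map_add, LinearMap.smul_apply, LinearMap.add_apply,
      hbr a a']
    module
  rw [← add_assoc, ← hf.add_right, h, ← hf.add_left, hf.smul_right]
  ring

end IsPSDForm

section LieValued

open Discretisation

variable {D : Discretisation} (S : Serendipity D) {ι : Type*}
  {𝔤 : Type*} [LieRing 𝔤] [LieAlgebra ℝ 𝔤] (b : Module.Basis ι ℝ 𝔤) (B : LinearMap.BilinForm ℝ 𝔤)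

/-! ## Linearity of the Lie algebra-valued operators -/

/-- The components of the potential on an element, as locally bounded fields. -/
def potCellL (T : Fin D.nT) : (ι → D.XCurl) →ₗ[ℝ] (ι → LocBdd E3) :=
  (toLB ∘ₗ S.potCurlL T).compLeft ι

/-- The components of the tangential trace on a face, as locally bounded fields. -/
def potFaceL (F : Fin D.nF) : (ι → D.XCurl) →ₗ[ℝ] (ι → LocBdd E3) :=
  (toLB ∘ₗ S.trFtL F).compLeft ι

/-- Linear version of `gPcurl`. -/
def gPcurlL : (ι → D.XCurl) →ₗ[ℝ] (ι → PwLB D) :=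
  (LinearMap.pi fun T => toLB ∘ₗ S.potCurlL T).compLeft ι

/-- Linear version of `gCpw`. -/
def gCpwL : (ι → D.XCurl) →ₗ[ℝ] (ι → PwLB D) :=
  (LinearMap.pi fun T => toLB ∘ₗ S.cellCurlL T).compLeft ι

/-- Linear version of `gC`. -/
def gCL : (ι → D.XCurl) →ₗ[ℝ] (ι → D.XDiv) := S.uCL.compLeft ι

theorem gPcurl_eq (v : ι → D.XCurl) : gPcurl S v = fun I T => (gPcurlL S v I T).1 := by
  funext I T
  simp only [gPcurl, S.potCurl_eq]
  rfl

theorem gCpw_eq (v : ι → D.XCurl) : gCpw S v = fun I T => (gCpwL S v I T).1 := by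
  funext I T
  simp only [gCpw, S.cellCurl_eq]
  rfl

theorem gC_eq (v : ι → D.XCurl) : gC S v = gCL S v := by
  funext I
  exact S.uC_eq (v I)

variable [Fintype ι]

/-- The bracket of piecewise locally bounded fields. -/
def bktVL : (ι → PwLB D) →ₗ[ℝ] (ι → PwLB D) →ₗ[ℝ] (ι → PwLB D) :=
  LinearMap.mk₂ ℝ (fun v w K T => bktLB b (fun I => v I T) (fun I => w I T) K)
    (fun v v' w => by
      funext K T
      exact congrFun (LinearMap.map_add₂ (bktLB b) (fun I => v I T) (fun I => v' I T) _) K)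
    (fun c v w => by
      funext K T
      exact congrFun (LinearMap.map_smul₂ (bktLB b) c (fun I => v I T) _) K)
    (fun v w w' => by
      funext K T
      exact congrFun (map_add (bktLB b _) (fun I => w I T) (fun I => w' I T)) K)
    (fun c v w => by
      funext K T
      exact congrFun (map_smul (bktLB b _) c (fun I => w I T)) K)

theorem bktVL_comm (v w : ι → PwLB D) : bktVL b v w = bktVL b w v := by
  funext K T
  exact congrFun (bktLB_comm b _ _) K

theorem bktV_coe (v w : ι → PwLB D) :
    bktV b (fun I T => (v I T).1) (fun I T => (w I T).1) = fun K T => (bktVL b v w K T).1 := by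
  funext K T
  exact (coe_bktLB b _ _ K).symm

/-- Linear version of `bktDiv`. -/
def bktDivL : (ι → D.XCurl) →ₗ[ℝ] (ι → D.XCurl) →ₗ[ℝ] (ι → D.XDiv) :=
  LinearMap.mk₂ ℝ (fun v w K =>
    (fun T => l2projL (D.mT T) (D.GT T (D.k - 1)) (bktLB b (potCellL S T v) (potCellL S T w) K),
     fun T => l2projL (D.mT T) (D.GcT T D.k) (bktLB b (potCellL S T v) (potCellL S T w) K),
     fun F => l2projL (D.mF F) (PolS (D.face F) D.k) (postComp (innerSL ℝ (D.normal F))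
      (bktLB b (potFaceL S F v) (potFaceL S F w) K))))
    (fun v v' w => by
      funext K
      refine Prod.ext ?_ (Prod.ext ?_ ?_) <;> funext P <;>
        simp [map_add, LinearMap.add_apply, Pi.add_apply])
    (fun c v w => by
      funext K
      refine Prod.ext ?_ (Prod.ext ?_ ?_) <;> funext P <;>
        simp [map_smul, LinearMap.smul_apply, Pi.smul_apply])
    (fun v w w' => by
      funext K
      refine Prod.ext ?_ (Prod.ext ?_ ?_) <;> funext P <;>
        simp [map_add, Pi.add_apply])
    (fun c v w => by
      funext K
      refine Prod.ext ?_ (Prod.ext ?_ ?_) <;> funext P <;>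
        simp [map_smul, Pi.smul_apply])

theorem bktDivL_comm (v w : ι → D.XCurl) : bktDivL S b v w = bktDivL S b w v := by
  funext K
  simp only [bktDivL, LinearMap.mk₂_apply, bktLB_comm b (potCellL S _ v) (potCellL S _ w),
    bktLB_comm b (potFaceL S _ v) (potFaceL S _ w)]

theorem bktDiv_eq (v w : ι → D.XCurl) : bktDiv S b v w = bktDivL S b v w := by
  have hT : ∀ K T, (fun x => bktPt b (fun I => (S.potCurl (v I) T).1 x)
      (fun I => (S.potCurl (w I) T).1 x) K) =
      (bktLB b (potCellL S T v) (potCellL S T w) K).1 := fun K T => by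
    rw [coe_bktLB]
    simp only [S.potCurl_eq]
    rfl
  have hF : ∀ K F, (fun x => inner ℝ (bktPt b (fun I => (S.trFt (v I) F).1 x)
      (fun I => (S.trFt (w I) F).1 x) K) (D.normal F)) =
      (postComp (innerSL ℝ (D.normal F))
        (bktLB b (potFaceL S F v) (potFaceL S F w) K)).1 := fun K F => by
    have h : (postComp (innerSL ℝ (D.normal F))
        (bktLB b (potFaceL S F v) (potFaceL S F w) K)).1 = fun x =>
        inner ℝ (D.normal F) ((bktLB b (potFaceL S F v) (potFaceL S F w) K).1 x) := rfl
    rw [h, coe_bktLB]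
    simp only [S.trFt_eq, real_inner_comm (D.normal F)]
    rfl
  funext K
  simp only [bktDiv, hT, hF, l2proj_eq]
  rfl

/-- The bracket with a scalar field, as a linear map. -/
def bktSL (q : ι → Fin D.nT → LocBdd ℝ) : (ι → PwLB D) →ₗ[ℝ] (ι → PwLB D) where
  toFun v K T := ∑ I, ∑ J, strConst b I J K • smulLB (q J T) (v I T)
  map_add' v w := by
    funext K T
    simp [Finset.sum_add_distrib]
  map_smul' c v := by
    funext K T
    simp [Finset.smul_sum, smul_comm c]

theorem bktS_coe (v : ι → PwLB D) (q : ι → Fin D.nT → LocBdd ℝ) :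
    bktS b (fun I T => (v I T).1) (fun I T => (q I T).1) =
      fun K T => (bktSL b q v K T).1 := by
  funext K T x
  simp [bktS, bktSL, smulLB, Finset.sum_apply]

/-! ## Ad-invariance -/

theorem sum_strConst_mul (P I J : ι) :
    ∑ K, strConst b I J K * B (b P) (b K) = B (b P) ⁅b I, b J⁆ := by
  calc _ = B (b P) (∑ K, b.repr ⁅b I, b J⁆ K • b K) := by simp only [strConst, map_sum, map_smul,
          smul_eq_mul]
    _ = _ := by rw [b.sum_repr]

variable {B}

/-- Ad-invariance restated for the trilinear form `B x ⁅y, z⁆`: it changes sign when its first two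
arguments are exchanged. -/
theorem adInvariant_skew (hB_symm : ∀ x y : 𝔤, B x y = B y x)
    (hB_inv : ∀ x y z : 𝔤, B ⁅x, y⁆ z = -B y ⁅x, z⁆) (x y z : 𝔤) :
    B x ⁅y, z⁆ = -B y ⁅x, z⁆ := by
  rw [← lie_skew, map_neg, hB_symm y, ← lie_skew x z, map_neg, LinearMap.neg_apply, hB_inv,
    neg_neg]

/-- The structure constants are reabsorbed into brackets of basis vectors, so that ad-invariance can
be applied term by term. -/
theorem tens_l2LB_bktSL (q : ι → Fin D.nT → LocBdd ℝ) (f g : ι → PwLB D) :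
    tens b B l2LB f (bktSL b q g) =
      ∑ P, ∑ I, ∑ J, (∑ T, ip (D.mT T) (f P T) (smulLB (q J T) (g I T))) *
        B (b P) ⁅b I, b J⁆ := by
  refine Finset.sum_congr rfl fun P _ => ?_
  have hK : ∀ K, l2LB (f P) (bktSL b q g K) = ∑ I, ∑ J, strConst b I J K *
      ∑ T, ip (D.mT T) (f P T) (smulLB (q J T) (g I T)) := fun K => by
    simp only [l2LB, bktSL, LinearMap.coe_mk, AddHom.coe_mk, map_sum, map_smul, smul_eq_mul,
      Finset.mul_sum]
    rw [Finset.sum_comm]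
    exact Finset.sum_congr rfl fun I _ => Finset.sum_comm
  simp only [hK, Finset.sum_mul, ← sum_strConst_mul]
  rw [Finset.sum_comm]
  refine Finset.sum_congr rfl fun I _ => ?_
  rw [Finset.sum_comm]
  refine Finset.sum_congr rfl fun J _ => ?_
  rw [← Finset.sum_mul, Finset.mul_sum]
  exact Finset.sum_congr rfl fun K _ => by ring

/-- Multiplication by a scalar function is self-adjoint for the `L²` product, and the bracket with a
fixed Lie algebra element is skew-adjoint for `B`. Bracketing with `q` is therefore skew-adjoint. -/
theorem tens_bktSL_skew (hB_symm : ∀ x y : 𝔤, B x y = B y x)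
    (hB_inv : ∀ x y z : 𝔤, B ⁅x, y⁆ z = -B y ⁅x, z⁆) (q : ι → Fin D.nT → LocBdd ℝ)
    (f g : ι → PwLB D) :
    tens b B l2LB f (bktSL b q g) = -tens b B l2LB g (bktSL b q f) := by
  rw [tens_l2LB_bktSL, tens_l2LB_bktSL, Finset.sum_comm]
  simp only [← Finset.sum_neg_distrib]
  refine Finset.sum_congr rfl fun I _ => Finset.sum_congr rfl fun P _ =>
    Finset.sum_congr rfl fun J _ => ?_
  rw [adInvariant_skew hB_symm hB_inv, mul_neg]
  simp only [ip_smulLB_comm _ _ (f P _)]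

theorem tens_bktSL_self (hB_symm : ∀ x y : 𝔤, B x y = B y x)
    (hB_inv : ∀ x y z : 𝔤, B ⁅x, y⁆ z = -B y ⁅x, z⁆) (q : ι → Fin D.nT → LocBdd ℝ)
    (f : ι → PwLB D) : tens b B l2LB f (bktSL b q f) = 0 := by
  have := tens_bktSL_skew b hB_symm hB_inv q f f
  linarith

/-! ## Energy dissipation -/

variable {S} in
-- The dependence on `A` and `E` is exposed through linear maps; `q` enters only as a parameter, so
-- no linearity in `q` is called for.
theorem constraintFun_eq (A E : ι → D.XCurl) (q : ι → D.XGrad) :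
    constraintFun S b B A E q = tens b B S.ipCurl E (gG S q) + tens b B l2LB (gPcurlL S E)
      (bktSL b (fun I T => toLB (S.potGrad (q I) T)) (gPcurlL S A)) := by
  rw [constraintFun, gPcurl_eq, gPcurl_eq, ← tens_l2Dom, ← bktS_coe]
  rfl

variable {S}

/-- The constraint is preserved by the scheme. -/
theorem IsSolution.constraintFun_eq_zero
    (hB_symm : ∀ x y : 𝔤, B x y = B y x) (hB_pos : ∀ x : 𝔤, x ≠ 0 → 0 < B x x)
    (hB_inv : ∀ x y z : 𝔤, B ⁅x, y⁆ z = -B y ⁅x, z⁆)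
    {m : Variant} {N : ℕ} {t : ℕ → ℝ} (ht : ∀ n < N, t n < t (n + 1))
    {A E : ℕ → ι → D.XCurl} {lam : ℕ → ι → D.XGrad} (hsol : IsSolution S b B m N t A E lam)
    (hC0 : ∀ q : ι → D.XGrad, constraintFun S b B (A 0) (E 0) q = 0) (q : ι → D.XGrad) :
    ∀ n ≤ N, constraintFun S b B (A n) (E n) q = 0 := by
  have hc := S.isPSDForm_ipCurl.tens b B hB_symm hB_pos
  have hl := (isPSDForm_l2LB (D := D)).tens b B hB_symm hB_pos
  intro n
  induction n with
  | zero => exact fun _ => hC0 q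
  | succ n ih =>
    intro hn
    have ih := ih (by omega)
    have hτ : 0 < (t (n + 1) - t n)⁻¹ := inv_pos.2 (sub_pos.2 (ht n hn))
    -- The constraint equation of the scheme is the constraint functional with `A n` frozen, which
    -- is linear in `E`.
    have hcon : (t (n + 1) - t n)⁻¹ * (constraintFun S b B (A n) (E (n + 1)) q -
        constraintFun S b B (A n) (E n) q) = 0 := by
      have h : constraintFun S b B (A n) ((t (n + 1) - t n)⁻¹ • (E (n + 1) - E n)) q = 0 :=
        hsol.constraint n hn q
      rw [constraintFun_eq, map_smul, map_sub, hc.smul_left, hl.smul_left, hc.sub_left,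
        hl.sub_left] at h
      rw [constraintFun_eq, constraintFun_eq]
      linarith
    rw [ih, sub_zero] at hcon
    have hE : constraintFun S b B (A n) (E (n + 1)) q = 0 :=
      (mul_eq_zero.1 hcon).resolve_left hτ.ne'
    have hA : A (n + 1) = A n - (t (n + 1) - t n) • E (n + 1) := by
      have h := congrArg ((t (n + 1) - t n) • ·) (hsol.potential n hn)
      simp only [smul_smul, mul_inv_cancel₀ (sub_pos.2 (ht n hn)).ne', one_smul, smul_neg] at h
      rw [sub_eq_add_neg, ← h]
      abel
    rw [constraintFun_eq] at hE ⊢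
    -- Replacing `A n` by `A (n + 1)` changes the functional only by a multiple of the product of
    -- the potential of `E (n + 1)` with its own bracket with `q`, which is zero.
    rw [hA, map_sub, map_smul, map_sub, map_smul, hl.sub_right, hl.smul_right, tens_bktSL_self b hB_symm hB_inv]
    linarith

/-- The multiplier terms vanish when tested with the electric field. -/
theorem multiplier_eq_constraintFun
    (hB_symm : ∀ x y : 𝔤, B x y = B y x) (hB_pos : ∀ x : 𝔤, x ≠ 0 → 0 < B x x)
    (A E : ι → D.XCurl) (q : ι → D.XGrad) :
    tens b B S.ipCurl (gG S q) E
      + tens b B l2Dom (bktS b (gPcurl S A) (gPgrad S q)) (gPcurl S E) =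
    constraintFun S b B A E q := by
  have hc := S.isPSDForm_ipCurl.tens b B hB_symm hB_pos
  have hl := (isPSDForm_l2LB (D := D)).tens b B hB_symm hB_pos
  have h := bktS_coe b (gPcurlL S A) (fun I T => toLB (S.potGrad (q I) T))
  simp only [coe_toLB] at h
  rw [constraintFun_eq, hc.symm, ← hl.symm, ← tens_l2Dom, gPcurl_eq, gPcurl_eq, ← h]
  rfl

/-- The potential of a discrete curl is the element curl (`potDivL_uCL`). In the second variant this
brings the linear curl term into the `L²` product in which the brackets are taken. -/
theorem ipDiv_gC (v w : ι → D.XCurl) :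
    tens b B Serendipity.ipDiv (gC S v) (gC S w) =
      tens b B l2LB (gCpwL S v) (gCpwL S w) + tens b B sDivGlob (gCL S v) (gCL S w) := by
  have h : ∀ I J, Serendipity.ipDiv (gCL S v I) (gCL S w J) =
      l2LB (gCpwL S v I) (gCpwL S w J) + sDivGlob (gCL S v I) (gCL S w J) := fun I J => by
    have hp : ∀ (v : ι → D.XCurl) I T,
        (Serendipity.potDiv (gCL S v I) T).1 = (gCpwL S v I T).1 := fun v I T => by
      rw [Serendipity.potDiv_eq]
      exact congrArg Subtype.val (S.potDivL_uCL (v I) T)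
    simp only [Serendipity.ipDiv, hp, Finset.sum_add_distrib]
    rfl
  simp only [tens, gC_eq, h, add_mul, Finset.sum_add_distrib]

/-- The work of the magnetic terms bounds the increment of the magnetic energy. -/
theorem work_le (hB_symm : ∀ x y : 𝔤, B x y = B y x) (hB_pos : ∀ x : 𝔤, x ≠ 0 → 0 < B x x)
    (m : Variant) (A A' : ι → D.XCurl) {τ : ℝ} (hτ : 0 ≤ τ) :
    tens b B Serendipity.ipDiv (gC S A') (gC S (-(τ • (A' - A))))
      + nonlin S b B m A A' (-(τ • (A' - A))) ≤
    -(τ * (magEnergy S b B m A' - magEnergy S b B m A)) := by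
  cases m with
  | one =>
    -- Here the curl and the bracket both lie in the divergence space, and a single square is
    -- completed there.
    have hd := (Serendipity.isPSDForm_ipDiv (D := D)).tens b B hB_symm hB_pos
    simp only [nonlin, magEnergy, magOne, gC_eq, bktDiv_eq]
    rw [hd.work_eq (gCL S) (bktDivL S b) (bktDivL_comm S b), neg_le_neg_iff]
    exact mul_le_mul_of_nonneg_left (hd.half_sub_half_le _ _) hτ
  | two =>
    have hl := (isPSDForm_l2LB (D := D)).tens b B hB_symm hB_pos
    have hs := (Serendipity.isPSDForm_sDivGlob (D := D)).tens b B hB_symm hB_pos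
    have hw := hl.work_eq (gCpwL S) ((bktVL b).compl₁₂ (gPcurlL S) (gPcurlL S))
      (fun v w => bktVL_comm b _ _) A A' τ
    have hm : ∀ A, magEnergy S b B .two A =
        1 / 2 * tens b B l2LB (gCpwL S A + (1 / 2 : ℝ) • bktVL b (gPcurlL S A) (gPcurlL S A))
          (gCpwL S A + (1 / 2 : ℝ) • bktVL b (gPcurlL S A) (gPcurlL S A))
        + 1 / 2 * tens b B sDivGlob (gCL S A) (gCL S A) := fun A => by
      simp only [magEnergy, magTwo, gCpw_eq, gPcurl_eq, bktV_coe, gC_eq]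
      rfl
    have hn : ∀ v, nonlin S b B .two A A' v =
        tens b B l2LB (gCpwL S A')
          (bktVL b (gPcurlL S ((1 / 2 : ℝ) • (A + A'))) (gPcurlL S v))
        + tens b B l2LB ((1 / 2 : ℝ) • bktVL b (gPcurlL S A') (gPcurlL S A'))
          (gCpwL S v + bktVL b (gPcurlL S ((1 / 2 : ℝ) • (A + A'))) (gPcurlL S v)) := fun v => by
      simp only [nonlin, gCpw_eq, gPcurl_eq, bktV_coe]
      rfl
    -- After the splitting, the `L²` part completes the square with the brackets, while the
    -- stabilisation involves the discrete curl alone; the convexity inequality is applied to each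
    -- of the two.
    simp only [LinearMap.compl₁₂_apply] at hw
    rw [hn, hm, hm, ipDiv_gC b, add_right_comm, hw, hs.map_neg_smul_sub_right]
    have h1 := mul_le_mul_of_nonneg_left (hl.half_sub_half_le
      (gCpwL S A + (1 / 2 : ℝ) • bktVL b (gPcurlL S A) (gPcurlL S A))
      (gCpwL S A' + (1 / 2 : ℝ) • bktVL b (gPcurlL S A') (gPcurlL S A'))) hτ
    have h2 := mul_le_mul_of_nonneg_left (hs.half_sub_half_le (gCL S A) (gCL S A')) hτ
    linarith

end LieValued

end

end YM

theorem proposition2 {D : YM.Discretisation} (S : YM.Serendipity D)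
    {ι : Type*} [Fintype ι] {𝔤 : Type*} [LieRing 𝔤] [LieAlgebra ℝ 𝔤]
    (b : Module.Basis ι ℝ 𝔤) (B : LinearMap.BilinForm ℝ 𝔤)
    (hB_symm : ∀ x y : 𝔤, B x y = B y x) (hB_pos : ∀ x : 𝔤, x ≠ 0 → 0 < B x x)
    (hB_inv : ∀ x y z : 𝔤, B ⁅x, y⁆ z = -B y ⁅x, z⁆)
    (m : YM.Variant) (N : ℕ) (t : ℕ → ℝ) (ht0 : t 0 = 0) (ht : ∀ n < N, t n < t (n + 1))
    (A E : ℕ → ι → D.XCurl) (lam : ℕ → ι → D.XGrad)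
    (hsol : YM.IsSolution S b B m N t A E lam)
    (hC0 : ∀ q : ι → D.XGrad, YM.constraintFun S b B (A 0) (E 0) q = 0) :
    ∀ n < N,
      1 / 2 * YM.tens b B S.ipCurl (E (n + 1)) (E (n + 1)) + YM.magEnergy S b B m (A (n + 1))
        ≤ 1 / 2 * YM.tens b B S.ipCurl (E n) (E n) + YM.magEnergy S b B m (A n) := by
  intro n hn
  have hc := S.isPSDForm_ipCurl.tens b B hB_symm hB_pos
  have hτ : 0 < (t (n + 1) - t n)⁻¹ := inv_pos.2 (sub_pos.2 (ht n hn))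
  have hE : E (n + 1) = -((t (n + 1) - t n)⁻¹ • (A (n + 1) - A n)) := by
    rw [hsol.potential n hn, neg_neg]
  -- The test field equals minus the discrete time derivative of the potential, so the right side is
  -- the work of the magnetic terms.
  have hev := hsol.evolution n hn (E (n + 1))
  have hwork := YM.work_le (S := S) b hB_symm hB_pos m (A n) (A (n + 1)) hτ.le
  rw [← hE] at hwork
  rw [add_assoc, YM.multiplier_eq_constraintFun b hB_symm hB_pos,
    hsol.constraintFun_eq_zero b hB_symm hB_pos hB_inv ht hC0 _ _ hn, add_zero, hc.smul_left,
    hc.symm] at hev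
  have h1 := mul_le_mul_of_nonneg_left (hc.half_sub_half_le (E n) (E (n + 1))) hτ.le
  -- Both inequalities carry the inverse time step as a factor, which is positive and is cancelled.
  refine le_of_mul_le_mul_left ?_ hτ
  linarith
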